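/- Conventions. All tensor products of C*-algebras are minimal, $\mathcal M(A)$ is the multiplier algebra, $\mathbf N=\{1,2,3,\dots\}$, and $E^{(n)}_{j,k}$ are the standard matrix units of $M_n=M_n(\mathbf C)$. A *C\*-bialgebra* is a pair $(A,\Delta)$ of a C*-algebra $A$ and a $*$-homomorphism $\Delta:A\to\mathcal M(A\otimes A)$ such that the linear span of $\{\Delta(a)(b\otimes c):a,b,c\in A\}$ is norm dense in $A\otimes A$ and $(\Delta\otimes \mathrm{id})\circ\Delta=(\mathrm{id}\otimes\Delta)\circ\Delta$. A *right comodule-C\*-algebra* of a C*-bialgebra $(A,\Delta)$ is a pair $(B,\Gamma)$ of a C*-algebra $B$ and a nondegenerate $*$-homomorphism $\Gamma:B\to\mathcal M(B\otimes A)$ (the span of $\Gamma(B)(B\otimes A)$ is dense in $B\otimes A$) with $(\Gamma\otimes \mathrm{id})\circ\Gamma=(\mathrm{id}\otimes\Delta)\circ\Gamma$. In these identities $\Delta\otimes\mathrm{id}$, $\mathrm{id}\otimes\Delta$ and $\Gamma\otimes\mathrm{id}$ are extended to unital $*$-homomorphisms between multiplier algebras. Let $S$ be the set of all sequences $a=(a_1,a_2,\dots)$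 of integers $\ge 2$ together with $\mathbf 1=(1,1,\dots)$; under the entrywise product $a\cdot b$ it is a monoid. For $a\in S$ let $\mathcal A(a)=\varinjlim_n M_{a_1}\otimes\cdots\otimes M_{a_n}$ (with the embeddings $x\mapsto x\otimes 1$; so $\mathcal A(\mathbf 1)=\mathbf C$), and for $J,K\in\prod_{i=1}^n\{1,\dots,a_i\}$ put $E^{(a)}_{J,K}=E^{(a_1)}_{j_1,k_1}\otimes\cdots\otimes E^{(a_n)}_{j_n,k_n}\in\mathcal A(a)$. Let $\mathcal A(*)=\bigoplus_{a\in S}\mathcal A(a)$ be the C*-direct sum. For $a,b\in S$ there is a unique $*$-homomorphism $\varphi_{a,b}:\mathcal A(a\cdot b)\to\mathcal A(a)\otimes\mathcal A(b)$ with $$\varphi_{a,b}(E^{(a\cdot b)}_{J,K})=E^{(a)}_{J',K'}\otimes E^{(b)}_{J'',K''},\qquad j_i=b_i(j_i'-1)+j_i'',\quad k_i=b_i(k_i'-1)+k_i'',$$ where $1\le j_i',k_i'\le a_i$ and $1\le j_i'',k_i''\le b_i$. There is a unique $*$-homomorphism $\Delta_\varphi:\mathcal A(*)\to\mathcal M(\mathcal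 A(*)\otimes\mathcal A(*))=\prod_{a,b\in S}\mathcal A(a)\otimes\mathcal A(b)$ such that, for $x\in\mathcal A(c)$, the component of $\Delta_\varphi(x)$ at $(a,b)$ is $\varphi_{a,b}(x)$ if $a\cdot b=c$ and $0$ otherwise. Let $s_1,s_2,\dots$ be isometries on a nonzero Hilbert space with $s_i^*s_j=0$ for $i\ne j$, so that they generate the Cuntz algebra $\mathcal O_\infty$. For $J,K\in\mathbf N^n$ put $E^{(\infty)}_{J,K}=s_{j_1}\cdots s_{j_n}s_{k_n}^*\cdots s_{k_1}^*$, and let $UHF_\infty\subset\mathcal O_\infty$ be the unital C*-subalgebra generated by all $E^{(\infty)}_{J,K}$, $J,K\in\mathbf N^n$, $n\ge1$. **Theorem.** For every $a\in S$ there is a unique unital $*$-homomorphism $\varphi_{\infty,a}:UHF_\infty\to UHF_\infty\otimes\mathcal A(a)$ with $$\varphi_{\infty,a}(E^{(\infty)}_{J,K})=E^{(\infty)}_{J',K'}\otimes E^{(a)}_{J'',K''}\qquad(J,K\in\mathbf N^n,\ n\ge1),$$ where $j_i=a_i(j_i'-1)+j_i''$, $k_i=a_i(k_i'-1)+k_i''$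 with $j_i',k_i'\in\mathbf N$ and $1\le j_i'',k_i''\le a_i$. There is a unique $*$-homomorphism $$\Gamma_\varphi:UHF_\infty\to\mathcal M(UHF_\infty\otimes\mathcal A(*))=\prod_{a\in S}UHF_\infty\otimes\mathcal A(a),\qquad \Gamma_\varphi(x)=\prod_{a\in S}\varphi_{\infty,a}(x).$$ The pair $(\mathcal A(*),\Delta_\varphi)$ is a C*-bialgebra, and $(UHF_\infty,\Gamma_\varphi)$ is a right comodule-C*-algebra of $(\mathcal A(*),\Delta_\varphi)$. -/

import Mathlib

open scoped MultiplierAlgebra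

noncomputable section

namespace KroneckerCoproduct

/-! ### Operators on the Hilbert spaces `ℓ²(ι)` -/

/-- The Hilbert space `ℓ²(ι)` (up to unitary equivalence, the general Hilbert space). -/
abbrev L2 (ι : Type*) : Type _ := lp (fun _ : ι => ℂ) 2

/-- The C*-algebra `B(ℓ²(ι))` of bounded operators on `ℓ²(ι)`. -/
abbrev Op (ι : Type*) : Type _ := L2 ι →L[ℂ] L2 ι

theorem memlp_two_iff {ι : Type*} (f : ι → ℂ) :
    Memℓp f 2 ↔ Summable fun i => ‖f i‖ ^ 2 := by
  rw [memℓp_gen_iff (by norm_num)]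
  norm_num

theorem summable_sq {ι : Type*} (f : L2 ι) : Summable fun i => ‖f i‖ ^ 2 :=
  (memlp_two_iff _).1 (lp.memℓp f)

theorem norm_sq_eq {ι : Type*} (f : L2 ι) : ‖f‖ ^ 2 = ∑' i, ‖f i‖ ^ 2 := by
  have := lp.norm_rpow_eq_tsum (p := 2) (by norm_num) f
  norm_num at this
  exact this

theorem hasSum_extend {ι κ : Type*} (e : ι ↪ κ) (f : L2 ι) :
    HasSum (fun k => ‖Function.extend e f 0 k‖ ^ 2) (‖f‖ ^ 2) := by
  rw [norm_sq_eq, ← e.injective.hasSum_iff]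
  · simpa [Function.comp_def, e.injective.extend_apply] using (summable_sq f).hasSum
  · intro k hk
    rw [Function.extend_apply' _ _ _ (by simpa using hk)]
    simp

/-- The isometry `ℓ²(ι) → ℓ²(κ)` which an injection `e : ι ↪ κ` induces:
`δ_i ↦ δ_{e i}`, that is, extension by zero along `e`. -/
def push {ι κ : Type*} (e : ι ↪ κ) : L2 ι →ₗᵢ[ℂ] L2 κ where
  toFun f := ⟨Function.extend e f 0, (memlp_two_iff _).2 (hasSum_extend e f).summable⟩
  map_add' f g := by
    ext k
    change Function.extend e (⇑f + ⇑g) 0 k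
      = Function.extend e f 0 k + Function.extend e g 0 k
    by_cases hk : ∃ i, e i = k
    · obtain ⟨i, rfl⟩ := hk
      simp [e.injective.extend_apply]
    · simp [Function.extend_apply' _ _ _ hk]
  map_smul' c f := by
    ext k
    change Function.extend e (c • ⇑f) 0 k = c • Function.extend e f 0 k
    by_cases hk : ∃ i, e i = k
    · obtain ⟨i, rfl⟩ := hk
      simp [e.injective.extend_apply]
    · simp [Function.extend_apply' _ _ _ hk]
  norm_map' f := by
    rw [← sq_eq_sq₀ (norm_nonneg _) (norm_nonneg _), norm_sq_eq]
    exact (hasSum_extend e f).tsum_eq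

/-- The adjoint coisometry `ℓ²(κ) → ℓ²(ι)` of `push e`: restriction along `e`. -/
def pull {ι κ : Type*} (e : ι ↪ κ) : L2 κ →L[ℂ] L2 ι :=
  ContinuousLinearMap.adjoint (push e).toContinuousLinearMap

theorem push_apply {ι κ : Type*} (e : ι ↪ κ) (f : L2 ι) (i : ι) :
    push e f (e i) = f i := e.injective.extend_apply _ _ _

theorem push_apply_of_notMem {ι κ : Type*} (e : ι ↪ κ) (f : L2 ι) (k : κ)
    (hk : ¬ ∃ i, e i = k) : push e f k = 0 := Function.extend_apply' _ _ _ hk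

theorem push_single {ι κ : Type*} [DecidableEq ι] [DecidableEq κ] (e : ι ↪ κ) (i : ι)
    (c : ℂ) : push e (lp.single 2 i c) = lp.single 2 (e i) c := by
  ext k
  by_cases hk : ∃ j, e j = k
  · obtain ⟨j, rfl⟩ := hk
    rw [push_apply]
    simp [Pi.single_apply]
  · rw [push_apply_of_notMem e _ k hk, lp.coeFn_single, Pi.single_eq_of_ne]
    rintro rfl
    exact hk ⟨i, rfl⟩

theorem pull_apply {ι κ : Type*} (e : ι ↪ κ) (f : L2 κ) (i : ι) :
    pull e f i = f (e i) := by
  classical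
  have h := ContinuousLinearMap.adjoint_inner_right (push e).toContinuousLinearMap
    (lp.single 2 i (1 : ℂ)) f
  have h2 : (push e).toContinuousLinearMap (lp.single 2 i (1 : ℂ)) = lp.single 2 (e i) 1 :=
    push_single e i 1
  rw [h2, lp.inner_single_left, lp.inner_single_left] at h
  simpa [pull] using h

/-- The *-homomorphism `B(ℓ²(ι)) → B(ℓ²(κ))`, `T ↦ V T V*` with `V = push e`: the operator `T`
placed in the block of `ℓ²(κ)` indexed by the range of `e`, and zero elsewhere. -/
def extendOp {ι κ : Type*} (e : ι ↪ κ) (T : Op ι) : Op κ :=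
  (push e).toContinuousLinearMap ∘L T ∘L pull e

/-- The injection `i ↦ (i, k)`. -/
def sliceEmb (ι : Type*) {κ : Type*} (k : κ) : ι ↪ ι × κ :=
  ⟨fun i => (i, k), fun _ _ h => (Prod.ext_iff.1 h).1⟩

theorem hasSum_of_slices {ι κ : Type*} {g : ι × κ → ℝ} (hg : ∀ p, 0 ≤ g p) {c : κ → ℝ}
    (hc : ∀ k, HasSum (fun i => g (i, k)) (c k)) (hs : Summable c) : HasSum g (∑' k, c k) := by
  have h0 : ∀ q : κ × ι, 0 ≤ g (q.2, q.1) := fun q => hg _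
  have h1 : Summable (fun q : κ × ι => g (q.2, q.1)) :=
    (summable_prod_of_nonneg h0).2
      ⟨fun k => (hc k).summable, hs.congr fun k => (hc k).tsum_eq.symm⟩
  have h2 : ∑' q : κ × ι, g (q.2, q.1) = ∑' k, c k := by
    rw [h1.tsum_prod]
    exact tsum_congr fun k => (hc k).tsum_eq
  have h3 : HasSum (g ∘ Equiv.prodComm κ ι) (∑' k, c k) := h2 ▸ h1.hasSum
  exact (Equiv.prodComm κ ι).hasSum_iff.1 h3

theorem hasSum_norm_sq {ι : Type*} (f : L2 ι) : HasSum (fun i => ‖f i‖ ^ 2) (‖f‖ ^ 2) :=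
  norm_sq_eq f ▸ (summable_sq f).hasSum

theorem hasSum_slice {ι κ : Type*} (f : L2 (ι × κ)) :
    HasSum (fun k => ‖pull (sliceEmb ι k) f‖ ^ 2) (‖f‖ ^ 2) := by
  have hk : ∀ k, HasSum (fun i => ‖f (i, k)‖ ^ 2) (‖pull (sliceEmb ι k) f‖ ^ 2) := by
    intro k
    refine (hasSum_norm_sq (pull (sliceEmb ι k) f)).congr_fun fun i => ?_
    rw [pull_apply]
    rfl
  have hs : Summable fun k => ‖pull (sliceEmb ι k) f‖ ^ 2 := by
    have h : Summable ((fun p => ‖f p‖ ^ 2) ∘ Equiv.prodComm κ ι) :=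
      (Equiv.prodComm κ ι).summable_iff.2 (summable_sq f)
    have h' := ((summable_prod_of_nonneg (fun _ => sq_nonneg _)).1 h).2
    exact h'.congr fun k => (hk k).tsum_eq
  have h := hasSum_of_slices (fun p => sq_nonneg ‖f p‖) hk hs
  rw [(hasSum_norm_sq f).unique h]
  exact hs.hasSum

theorem hasSum_family {ι κ : Type*} (F : κ → L2 ι) (hF : Summable fun k => ‖F k‖ ^ 2) :
    HasSum (fun p : ι × κ => ‖F p.2 p.1‖ ^ 2) (∑' k, ‖F k‖ ^ 2) :=
  hasSum_of_slices (g := fun p : ι × κ => ‖F p.2 p.1‖ ^ 2) (fun p => sq_nonneg ‖F p.2 p.1‖)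
    (fun k => hasSum_norm_sq (F k)) hF

theorem hasSum_ampl {ι κ : Type*} (a : Op ι) (f : L2 (ι × κ)) :
    ∃ r, HasSum (fun p : ι × κ => ‖a (pull (sliceEmb ι p.2) f) p.1‖ ^ 2) r ∧
      r ≤ (‖a‖ * ‖f‖) ^ 2 := by
  have hle : ∀ k, ‖a (pull (sliceEmb ι k) f)‖ ^ 2 ≤ ‖a‖ ^ 2 * ‖pull (sliceEmb ι k) f‖ ^ 2 := by
    intro k
    rw [← mul_pow]
    exact pow_le_pow_left₀ (norm_nonneg _) (a.le_opNorm _) 2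
  have hs := (hasSum_slice f).mul_left (‖a‖ ^ 2)
  have hs' : Summable fun k => ‖a (pull (sliceEmb ι k) f)‖ ^ 2 :=
    Summable.of_nonneg_of_le (fun _ => sq_nonneg _) hle hs.summable
  refine ⟨_, hasSum_family (fun k => a (pull (sliceEmb ι k) f)) hs', ?_⟩
  rw [mul_pow, ← hs.tsum_eq]
  exact hs'.tsum_le_tsum hle hs.summable

/-- The amplification `a ⊗ 1` on `ℓ²(ι × κ) = ℓ²(ι) ⊗ ℓ²(κ)`: it applies `a` to each of the
slices `f(·, k)`. -/
def ampl {ι : Type*} (κ : Type*) (a : Op ι) : Op (ι × κ) :=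
  LinearMap.mkContinuous
    { toFun := fun f =>
        (⟨fun p => a (pull (sliceEmb ι p.2) f) p.1, (memlp_two_iff _).2 (hasSum_ampl a f).choose_spec.1.summable⟩ :
          L2 (ι × κ))
      map_add' := fun f g => by
        ext p
        change a (pull (sliceEmb ι p.2) (f + g)) p.1
          = a (pull (sliceEmb ι p.2) f) p.1 + a (pull (sliceEmb ι p.2) g) p.1
        rw [map_add, map_add]
        rfl
      map_smul' := fun c f => by
        ext p
        change a (pull (sliceEmb ι p.2) (c • f)) p.1 = c • a (pull (sliceEmb ι p.2) f) p.1
        rw [map_smul, map_smul]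
        rfl } ‖a‖ fun f => by
    refine abs_le_of_sq_le_sq' ?_ (by positivity) |>.2
    rw [norm_sq_eq]
    obtain ⟨r, h, hr⟩ := hasSum_ampl a f
    exact h.tsum_eq.trans_le hr

/-- The tensor product operator `a ⊗ b = (a ⊗ 1)(1 ⊗ b)` on `ℓ²(ι × κ) = ℓ²(ι) ⊗ ℓ²(κ)`, where
`1 ⊗ b` is the amplification of `b`, conjugated by the flip. -/
def opTensor {ι κ : Type*} (a : Op ι) (b : Op κ) : Op (ι × κ) :=
  ampl κ a ∘L extendOp (Equiv.prodComm κ ι).toEmbedding (ampl ι b)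

/-- The vector `x ⊗ y` of `ℓ²(ι × κ) = ℓ²(ι) ⊗ ℓ²(κ)`. -/
def vecTensor {ι κ : Type*} (x : L2 ι) (y : L2 κ) : L2 (ι × κ) :=
  ⟨fun p => x p.1 * y p.2, (memlp_two_iff _).2 <| by
    have h := Summable.mul_of_nonneg (f := fun i => ‖x i‖ ^ 2) (g := fun k => ‖y k‖ ^ 2)
      (summable_sq x) (summable_sq y) (fun i => sq_nonneg ‖x i‖) (fun k => sq_nonneg ‖y k‖)
    refine h.congr fun p => ?_
    rw [norm_mul, mul_pow]⟩

theorem ampl_vecTensor {ι κ : Type*} (a : Op ι) (x : L2 ι) (y : L2 κ) :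
    ampl κ a (vecTensor x y) = vecTensor (a x) y := by
  ext p
  change a (pull (sliceEmb ι p.2) (vecTensor x y)) p.1 = a x p.1 * y p.2
  have h : pull (sliceEmb ι p.2) (vecTensor x y) = y p.2 • x := by
    ext i
    rw [pull_apply]
    change x i * y p.2 = y p.2 * x i
    ring
  rw [h, map_smul]
  change y p.2 * a x p.1 = _
  ring

/-- The characteristic property of `a ⊗ b`. -/
theorem opTensor_vecTensor {ι κ : Type*} (a : Op ι) (b : Op κ) (x : L2 ι) (y : L2 κ) :
    opTensor a b (vecTensor x y) = vecTensor (a x) (b y) := by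
  have h1 : pull (Equiv.prodComm κ ι).toEmbedding (vecTensor x y) = vecTensor y x := by
    ext p
    rw [pull_apply]
    change x p.2 * y p.1 = y p.1 * x p.2
    ring
  have h2 : push (Equiv.prodComm κ ι).toEmbedding (vecTensor (b y) x) = vecTensor x (b y) := by
    ext p
    have := push_apply (Equiv.prodComm κ ι).toEmbedding (vecTensor (b y) x) (p.2, p.1)
    refine this.trans ?_
    change b y p.2 * x p.1 = x p.1 * b y p.2
    ring
  change ampl κ a (push _ (ampl ι b (pull _ (vecTensor x y)))) = _
  rw [h1, ampl_vecTensor, h2, ampl_vecTensor]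

/-! ### Concrete C*-algebras, spatial tensor products, direct sums -/

/-- A concrete C*-algebra: a C*-algebra together with a faithful representation on `ℓ²(ι)`. -/
structure ConcreteCStar.{u} (ι : Type u) where
  /-- the elements -/
  Elem : Type u
  [inst : NonUnitalCStarAlgebra Elem]
  /-- the faithful representation -/
  op : Elem →⋆ₙₐ[ℂ] Op ι
  op_injective : Function.Injective op

attribute [instance] ConcreteCStar.inst

instance {ι : Type*} : CoeSort (ConcreteCStar ι) (Type _) := ⟨ConcreteCStar.Elem⟩

theorem exists_cstarGen {ι : Type*} (S : Set (Op ι)) : ∃ A : ConcreteCStar ι,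
    Set.range A.op = ((NonUnitalStarAlgebra.adjoin ℂ S).topologicalClosure : Set (Op ι)) := by
  have : IsClosed ((NonUnitalStarAlgebra.adjoin ℂ S).topologicalClosure : Set (Op ι)) :=
    NonUnitalStarSubalgebra.isClosed_topologicalClosure _
  let _ := NonUnitalStarSubalgebra.nonUnitalCStarAlgebra
    (NonUnitalStarAlgebra.adjoin ℂ S).topologicalClosure
  exact ⟨{ Elem := (NonUnitalStarAlgebra.adjoin ℂ S).topologicalClosure
           op := NonUnitalStarSubalgebraClass.subtype _
           op_injective := Subtype.val_injective }, Subtype.range_coe⟩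

/-- The C*-subalgebra of `B(ℓ²(ι))` generated by a set `S` of operators, that is, the norm closure
of the *-algebra generated by `S`.  Up to a unique isomorphism the next theorem determines it; the
choice only keeps its instances from being unfolded. -/
def cstarGen {ι : Type*} (S : Set (Op ι)) : ConcreteCStar ι := (exists_cstarGen S).choose

theorem range_cstarGen {ι : Type*} (S : Set (Op ι)) : Set.range (cstarGen S).op
    = ((NonUnitalStarAlgebra.adjoin ℂ S).topologicalClosure : Set (Op ι)) :=
  (exists_cstarGen S).choose_spec

theorem subset_range_cstarGen {ι : Type*} (S : Set (Op ι)) : S ⊆ Set.range (cstarGen S).op := by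
  rw [range_cstarGen]
  exact (NonUnitalStarAlgebra.subset_adjoin ℂ S).trans
    (NonUnitalStarSubalgebra.le_topologicalClosure _)

/-- A generator as an element of the C*-algebra generated by `S`. -/
def cstarGen.of {ι : Type*} {S : Set (Op ι)} (T : Op ι) (hT : T ∈ S) : cstarGen S :=
  (subset_range_cstarGen S hT).choose

theorem op_of {ι : Type*} {S : Set (Op ι)} (T : Op ι) (hT : T ∈ S) :
    (cstarGen S).op (cstarGen.of T hT) = T :=
  (subset_range_cstarGen S hT).choose_spec

/-- The minimal C*-tensor product `A ⊗ B`, realized as the spatial tensor product (which does not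
depend on the faithful representations): the closed linear span of the operators `a ⊗ b`, which
already span a *-algebra. -/
def spatialTensor {ι κ : Type*} (A : ConcreteCStar ι) (B : ConcreteCStar κ) :
    ConcreteCStar (ι × κ) :=
  cstarGen {T | ∃ (a : A) (b : B), T = opTensor (A.op a) (B.op b)}

/-- The elementary tensor `a ⊗ b` in `A ⊗ B`. -/
def tmul {ι κ : Type*} {A : ConcreteCStar ι} {B : ConcreteCStar κ} (a : A) (b : B) :
    spatialTensor A B :=
  cstarGen.of (opTensor (A.op a) (B.op b)) ⟨a, b, rfl⟩

/-- The injection of the index set of a summand into the index set of `⨁ ℓ²(κ j)`. -/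
def sigmaEmb {J : Type*} (κ : J → Type*) (j : J) : κ j ↪ Σ j, κ j :=
  ⟨Sigma.mk j, sigma_mk_injective⟩

/-- The C*-direct sum `⨁ A j` (families whose norms tend to zero, that is, the norm closure of
the algebraic direct sum), acting on `⨁ ℓ²(κ j) = ℓ²(Σ j, κ j)`. -/
def directSum {J : Type*} {κ : J → Type*} (A : ∀ j, ConcreteCStar (κ j)) :
    ConcreteCStar (Σ j, κ j) :=
  cstarGen {T | ∃ (j : J) (x : A j), T = extendOp (sigmaEmb κ j) ((A j).op x)}

/-- The embedding of a summand into `⨁ A j`. -/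
def summand {J : Type*} {κ : J → Type*} (A : ∀ j, ConcreteCStar (κ j)) (j : J) (x : A j) :
    directSum A :=
  cstarGen.of (extendOp (sigmaEmb κ j) ((A j).op x)) ⟨j, x, rfl⟩

/-! ### C*-bialgebras and comodule-C*-algebras

The multiplier algebra `M(A) = 𝓜(ℂ, A)` is the algebra of double centralizers `m`, where
`m.fst x` is the product `m x` for `x` in `A`; `DoubleCentralizer.coe` is the embedding of `A`. -/

section Bialgebra

variable {ι κ μ : Type*}

/-- `Θ` is the extension of `f ⊗ id : A ⊗ B → M(C ⊗ B)` to a unital *-homomorphism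
`M(A ⊗ B) → M(C ⊗ B)`; here `(f ⊗ id)(a ⊗ b)` is the multiplier
`c ⊗ b' ↦ f(a)c ⊗ bb'`.  If `f` is nondegenerate, then there is exactly one such `Θ`. -/
def IsTensorId {A : ConcreteCStar ι} {C : ConcreteCStar κ}
    (B : ConcreteCStar μ) (f : A →⋆ₙₐ[ℂ] 𝓜(ℂ, C))
    (Θ : 𝓜(ℂ, spatialTensor A B) →⋆ₐ[ℂ] 𝓜(ℂ, spatialTensor C B)) : Prop :=
  ∀ (a : A) (b : B) (c : C) (b' : B),
    (Θ (DoubleCentralizer.coe ℂ (tmul a b))).fst (tmul c b') = tmul ((f a).fst c) (b * b')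

/-- `Θ` is the extension of `id ⊗ f : B ⊗ A → M(B ⊗ C)` to a unital *-homomorphism
`M(B ⊗ A) → M(B ⊗ C)`. -/
def IsIdTensor {A : ConcreteCStar ι} {C : ConcreteCStar κ}
    (B : ConcreteCStar μ) (f : A →⋆ₙₐ[ℂ] 𝓜(ℂ, C))
    (Θ : 𝓜(ℂ, spatialTensor B A) →⋆ₐ[ℂ] 𝓜(ℂ, spatialTensor B C)) : Prop :=
  ∀ (b : B) (a : A) (b' : B) (c : C),
    (Θ (DoubleCentralizer.coe ℂ (tmul b a))).fst (tmul b' c) = tmul (b * b') ((f a).fst c)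

/-- The multipliers `m` of `(A ⊗ B) ⊗ C` and `m'` of `A ⊗ (B ⊗ C)` agree under the
identification of these two algebras by `(ι × κ) × μ ≃ ι × (κ × μ)`. -/
def AssocEq {A : ConcreteCStar ι} {B : ConcreteCStar κ}
    {C : ConcreteCStar μ} (m : 𝓜(ℂ, spatialTensor (spatialTensor A B) C))
    (m' : 𝓜(ℂ, spatialTensor A (spatialTensor B C))) : Prop :=
  ∀ (a : A) (b : B) (c : C),
    extendOp (Equiv.prodAssoc ι κ μ).toEmbedding ((spatialTensor (spatialTensor A B) C).op (m.fst (tmul (tmul a b) c)))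
      = (spatialTensor A (spatialTensor B C)).op (m'.fst (tmul a (tmul b c)))

/-- `(A, Δ)` is a C*-bialgebra. -/
structure IsCStarBialgebra (A : ConcreteCStar κ)
    (Δ : A →⋆ₙₐ[ℂ] 𝓜(ℂ, spatialTensor A A)) : Prop where
  dense : Dense (Submodule.span ℂ
    {t : spatialTensor A A | ∃ a b c : A, t = (Δ a).fst (tmul b c)} : Set (spatialTensor A A))
  coassoc : ∃ (Θ₁ : 𝓜(ℂ, spatialTensor A A) →⋆ₐ[ℂ] 𝓜(ℂ, spatialTensor (spatialTensor A A) A))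
    (Θ₂ : 𝓜(ℂ, spatialTensor A A) →⋆ₐ[ℂ] 𝓜(ℂ, spatialTensor A (spatialTensor A A))),
    IsTensorId A Δ Θ₁ ∧ IsIdTensor A Δ Θ₂ ∧ ∀ a : A, AssocEq (Θ₁ (Δ a)) (Θ₂ (Δ a))

/-- `(B, Γ)` is a right comodule-C*-algebra of the C*-bialgebra `(A, Δ)`, with the right
coaction `Γ`. -/
structure IsRightComoduleCStarAlgebra (B : ConcreteCStar ι)
    (A : ConcreteCStar κ) (Δ : A →⋆ₙₐ[ℂ] 𝓜(ℂ, spatialTensor A A))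
    (Γ : B →⋆ₙₐ[ℂ] 𝓜(ℂ, spatialTensor B A)) : Prop where
  bialgebra : IsCStarBialgebra A Δ
  nondegenerate : Dense (Submodule.span ℂ
    {t : spatialTensor B A | ∃ (b : B) (y : spatialTensor B A), t = (Γ b).fst y} :
      Set (spatialTensor B A))
  coaction : ∃ (Θ₁ : 𝓜(ℂ, spatialTensor B A) →⋆ₐ[ℂ] 𝓜(ℂ, spatialTensor (spatialTensor B A) A))
    (Θ₂ : 𝓜(ℂ, spatialTensor B A) →⋆ₐ[ℂ] 𝓜(ℂ, spatialTensor B (spatialTensor A A))),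
    IsTensorId A Γ Θ₁ ∧ IsIdTensor B Δ Θ₂ ∧ ∀ b : B, AssocEq (Θ₁ (Γ b)) (Θ₂ (Γ b))

end Bialgebra

/-! ### The UHF algebras `𝒜(a)`

Indices start at `0`: the matrix units of `M_n` are indexed by `Fin n`. -/

/-- The monoid of all sequences of integers `≥ 2` together with the unit `(1, 1, 1, …)`, under
the entrywise product. -/
def seqMonoid : Submonoid (ℕ → ℕ) where
  carrier := {a | (∀ i, 2 ≤ a i) ∨ a = 1}
  one_mem' := Or.inr rfl
  mul_mem' := by
    rintro a b (ha | rfl) (hb | rfl)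
    · exact Or.inl fun i => (ha i).trans (Nat.le_mul_of_pos_right _ (by have := hb i; omega))
    · simpa using Or.inl ha
    · simpa using Or.inl hb
    · simp

/-- The infinite paths `∏ i, {0, …, a i - 1}`. -/
abbrev Path (a : seqMonoid) : Type := ∀ i : ℕ, Fin (a.1 i)

/-- The words `∏_{i < n} {0, …, a i - 1}`. -/
abbrev Word (a : seqMonoid) (n : ℕ) : Type := ∀ i : Fin n, Fin (a.1 i)

/-- The injection which puts the word `J` in front of a tail. -/
def prepend {a : seqMonoid} {n : ℕ} (J : Word a n) :
    (∀ i : {i : ℕ // n ≤ i}, Fin (a.1 i)) ↪ Path a where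
  toFun y i := if h : i < n then J ⟨i, h⟩ else y ⟨i, not_lt.1 h⟩
  inj' y z h := by
    ext i
    have := congrFun h i.1
    simp only [not_lt.2 i.2, dif_neg, not_false_eq_true] at this
    exact congrArg Fin.val this

theorem prepend_apply {a : seqMonoid} {n : ℕ} (J : Word a n)
    (y : ∀ i : {i : ℕ // n ≤ i}, Fin (a.1 i)) (i : ℕ) :
    prepend J y i = if h : i < n then J ⟨i, h⟩ else y ⟨i, not_lt.1 h⟩ := rfl

/-- The operator `E_{J,K} = E_{j_1,k_1} ⊗ ⋯ ⊗ E_{j_n,k_n} ⊗ 1 ⊗ 1 ⊗ ⋯` on the Hilbert space with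
the orthonormal basis `δ_x`, `x ∈ ∏ i, {0, …, a i - 1}`: it maps `δ_{K y}` to `δ_{J y}`, and `δ_x`
to `0` if `x` does not begin with `K`. -/
def matUnitOp {a : seqMonoid} {n : ℕ} (J K : Word a n) : Op (Path a) :=
  (push (prepend J)).toContinuousLinearMap ∘L pull (prepend K)

/-- The UHF algebra `𝒜(a) = M_{a 0} ⊗ M_{a 1} ⊗ ⋯`.  For fixed `n`, the `E_{J,K}` with `J`, `K` of
length `n` are a system of matrix units of `𝒜_n(a) = M_{a 0} ⊗ ⋯ ⊗ M_{a (n-1)}`, and these matrix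
algebras are embedded into each other by `x ↦ x ⊗ 1`; the norm closure of their union is the
inductive limit.  For `a = (1, 1, …)` this is `ℂ`. -/
def uhf (a : seqMonoid) : ConcreteCStar (Path a) :=
  cstarGen {T | ∃ (n : ℕ) (J K : Word a n), T = matUnitOp J K}

/-- The element `E_{J,K}` of `𝒜(a)`. -/
def matUnit {a : seqMonoid} {n : ℕ} (J K : Word a n) : uhf a :=
  cstarGen.of (matUnitOp J K) ⟨n, J, K, rfl⟩

/-- The direct sum `𝒜(*)` of all the `𝒜(a)`. -/
def uhfSum : ConcreteCStar (Σ a : seqMonoid, Path a) := directSum uhf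

/-- The word `J` with the letters `j_i = b_i j'_i + j''_i`. -/
def combine {a b : seqMonoid} {n : ℕ} (J' : Word a n) (J'' : Word b n) : Word (a * b) n :=
  fun i => (finProdFinEquiv (J' i, J'' i) : Fin (a.1 i * b.1 i))

/-- The Kronecker coproducts `φ_{a,b} : 𝒜(a·b) → 𝒜(a) ⊗ 𝒜(b)`:
`φ_{a,b}(E_{J,K}) = E_{J',K'} ⊗ E_{J'',K''}`. -/
def IsKroneckerCoproduct
    (φ : ∀ a b : seqMonoid, uhf (a * b) →⋆ₙₐ[ℂ] spatialTensor (uhf a) (uhf b)) : Prop :=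
  ∀ (a b : seqMonoid) (n : ℕ) (J' K' : Word a n) (J'' K'' : Word b n),
    φ a b (matUnit (combine J' J'') (combine K' K'')) = tmul (matUnit J' K') (matUnit J'' K'')

/-- The injection of index sets which belongs to the summand `𝒜(a) ⊗ 𝒜(b)` of
`𝒜(*) ⊗ 𝒜(*)`. -/
def blockEmb (a b : seqMonoid) :
    Path a × Path b ↪ (Σ a : seqMonoid, Path a) × (Σ a : seqMonoid, Path a) :=
  (sigmaEmb (fun a : seqMonoid => Path a) a).prodMap (sigmaEmb (fun a : seqMonoid => Path a) b)

/-- `Δ` is the comultiplication `Δ_φ` of `𝒜(*)`: for `x ∈ 𝒜(c)`, the component of the multiplier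
`Δ(x)` at the summand `𝒜(a) ⊗ 𝒜(b)` of `𝒜(*) ⊗ 𝒜(*)` is `φ_{a,b}(x)` if `a·b = c`, and is `0`
otherwise. -/
structure IsComultiplication
    (φ : ∀ a b : seqMonoid, uhf (a * b) →⋆ₙₐ[ℂ] spatialTensor (uhf a) (uhf b))
    (Δ : uhfSum →⋆ₙₐ[ℂ] 𝓜(ℂ, spatialTensor uhfSum uhfSum)) : Prop where
  component : ∀ (a b : seqMonoid) (x : uhf (a * b)) (y : uhf a) (z : uhf b),
    (spatialTensor uhfSum uhfSum).op
        ((Δ (summand uhf (a * b) x)).fst (tmul (summand uhf a y) (summand uhf b z)))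
      = extendOp (blockEmb a b) ((spatialTensor (uhf a) (uhf b)).op (φ a b x * tmul y z))
  component_zero : ∀ (a b c : seqMonoid), a * b ≠ c → ∀ (x : uhf c) (y : uhf a) (z : uhf b),
    (Δ (summand uhf c x)).fst (tmul (summand uhf a y) (summand uhf b z)) = 0

/-! ### The algebra `UHF_∞` and the coaction -/

/-- `s 0, s 1, …` are isometries with pairwise orthogonal ranges, that is, canonical generators of
a Cuntz algebra `𝒪_∞ ⊆ B(ℓ²(ι))`. -/
def IsCuntzFamily {ι : Type*} (s : ℕ → Op ι) : Prop :=
  ∀ i j, star (s i) * s j = if i = j then 1 else 0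

/-- `E_{J,K} = s_{j_1} ⋯ s_{j_n} s_{k_n}^* ⋯ s_{k_1}^*`; it is `1` for `n = 0`. -/
def cuntzUnitOp {ι : Type*} (s : ℕ → Op ι) {n : ℕ} (J K : Fin n → ℕ) : Op ι :=
  (List.ofFn fun i => s (J i)).prod * star (List.ofFn fun i => s (K i)).prod

/-- `UHF_∞ ⊆ B(ℓ²(ι))`, the unital C*-subalgebra of `𝒪_∞` generated by the `E_{J,K}`; the unit is the
`E_{J,K}` with `n = 0`. -/
def uhfInfty {ι : Type*} (s : ℕ → Op ι) : ConcreteCStar ι :=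
  cstarGen {T | ∃ (n : ℕ) (J K : Fin n → ℕ), T = cuntzUnitOp s J K}

/-- The element `E_{J,K}` of `UHF_∞`. -/
def cuntzUnit {ι : Type*} (s : ℕ → Op ι) {n : ℕ} (J K : Fin n → ℕ) : uhfInfty s :=
  cstarGen.of (cuntzUnitOp s J K) ⟨n, J, K, rfl⟩

/-- The word `J` with the letters `j_i = a_i j'_i + j''_i`, where `j'_i` is any index. -/
def combineInfty {a : seqMonoid} {n : ℕ} (J' : Fin n → ℕ) (J'' : Word a n) : Fin n → ℕ :=
  fun i => a.1 i * J' i + J'' i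

/-- The maps `φ_{∞,a} : UHF_∞ → UHF_∞ ⊗ 𝒜(a)`:
`φ_{∞,a}(E_{J,K}) = E_{J',K'} ⊗ E_{J'',K''}` (and so `1 ↦ 1 ⊗ 1`). -/
def IsInftyCoproduct {ι : Type*} (s : ℕ → Op ι)
    (φ : ∀ a : seqMonoid, uhfInfty s →⋆ₙₐ[ℂ] spatialTensor (uhfInfty s) (uhf a)) : Prop :=
  ∀ (a : seqMonoid) (n : ℕ) (J' K' : Fin n → ℕ) (J'' K'' : Word a n),
    φ a (cuntzUnit s (combineInfty J' J'') (combineInfty K' K''))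
      = tmul (cuntzUnit s J' K') (matUnit J'' K'')

/-- `Γ` is the product of the maps `φ_{∞,a}`: for every `a`, the component of the multiplier `Γ(x)`
at the summand `UHF_∞ ⊗ 𝒜(a)` of `UHF_∞ ⊗ 𝒜(*)` is `φ_{∞,a}(x)`. -/
def IsProductCoaction {ι : Type*} (s : ℕ → Op ι)
    (φ : ∀ a : seqMonoid, uhfInfty s →⋆ₙₐ[ℂ] spatialTensor (uhfInfty s) (uhf a))
    (Γ : uhfInfty s →⋆ₙₐ[ℂ] 𝓜(ℂ, spatialTensor (uhfInfty s) uhfSum)) : Prop :=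
  ∀ (x : uhfInfty s) (a : seqMonoid) (b : uhfInfty s) (y : uhf a),
    (spatialTensor (uhfInfty s) uhfSum).op ((Γ x).fst (tmul b (summand uhf a y)))
      = extendOp ((Function.Embedding.refl ι).prodMap (sigmaEmb (fun a : seqMonoid => Path a) a))
          ((spatialTensor (uhfInfty s) (uhf a)).op (φ a x * tmul b y))

end KroneckerCoproduct

end

open KroneckerCoproduct

noncomputable section

namespace KroneckerCoproduct

/-! ### Operators on `ℓ²` -/

section Operators

variable {ι κ μ ι' κ' : Type*}

/-! The Kronecker coproducts `φ_{a,b}` are spatial. Writing letters as `x_i = b_i x'_i + x''_i`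
identifies paths of `a·b` with pairs of paths, and conjugation by the resulting unitary carries
`E_{J,K}` to `E_{J',K'} ⊗ E_{J'',K''}` (`extendOp_matUnitOp_combine`).

For `φ_{∞,a}` no such unitary is at hand, because the `s_i` act on an arbitrary space. These maps
come from a universal property of `UHF_∞` (`exists_uhfInfty_lift`): any system `v_{J,K}` with the
adjoint and prefix-product relations of the `E_{J,K}` is the image of the `E_{J,K}` under a
*-homomorphism. Since there are infinitely many `s_i`, no finite sum `∑ s_i s_i^*` is `1`, and all
`E_{J,K}` of all lengths are linearly independent (`linearIndependent_cuntzUnitOp`), so `E_{J,K} ↦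
v_{J,K}` is well defined. Units of bounded length with bounded letters span a finite-dimensional
C*-algebra, where a *-homomorphism is automatically contractive (`norm_snd_le_of_mem_span`).
Letterwise division with remainder respects prefixes, so the tensors `E_{J',K'} ⊗ E_{J'',K''}` do
satisfy the relations.

The multiplier algebras are handled through `Blocks`. The algebra `𝒜(*)` and its tensor products are
`c₀`-sums of unital blocks. A multiplier is determined by its components at the block units
(`Blocks.ext_comp`), and conversely the algebra is an ideal in the bounded product of its blocks, so
a family of *-homomorphisms into the blocks gives one into the multiplier algebra (`Blocks.family`).
Existence and uniqueness of `Δ_φ` and `Γ_φ` follow, and the extensions of `f ⊗ id` and `id ⊗ f` to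
multipliers are built in the same way (`Blocks.exists_tensorId`, `Blocks.exists_idTensor`). On the
blocks themselves `f ⊗ id` exists for the minimal tensor product because *-homomorphisms are
completely contractive (`norm_le_of_mem_tensorGraph`).

Coassociativity and the coaction identity thus become identities between components. On matrix units
they say that splitting a letter into three digits does not depend on the order of the two divisions
(`combine_assoc_val`, `combineInfty_assoc`). -/

theorem pull_push (e : ι ↪ κ) (f : L2 ι) : pull e (push e f) = f := by
  ext i
  rw [pull_apply, push_apply]

theorem pull_push_of_disjoint (e : ι ↪ μ) (e' : κ ↪ μ) (h : ∀ i k, e i ≠ e' k) (f : L2 κ) :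
    pull e (push e' f) = 0 := by
  ext i
  rw [pull_apply, push_apply_of_notMem e' f _ (by rintro ⟨k, hk⟩; exact h i k hk.symm)]
  rfl

theorem extendOp_apply (e : ι ↪ κ) (T : Op ι) (f : L2 κ) :
    extendOp e T f = push e (T (pull e f)) := rfl

/-- `extendOp` as a *-homomorphism. -/
def extendHom (e : ι ↪ κ) : Op ι →⋆ₙₐ[ℂ] Op κ where
  toFun := extendOp e
  map_smul' c T := by
    ext1 f
    simp [extendOp_apply]
  map_zero' := by
    ext1 f
    simp [extendOp_apply]
  map_add' S T := by
    ext1 f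
    simp [extendOp_apply]
  map_mul' S T := by
    ext1 f
    simp [extendOp_apply, pull_push]
  map_star' T := by
    simp only [ContinuousLinearMap.star_eq_adjoint, extendOp, pull,
      ContinuousLinearMap.adjoint_comp, ContinuousLinearMap.adjoint_adjoint,
      ContinuousLinearMap.comp_assoc]

@[simp] theorem extendHom_apply (e : ι ↪ κ) (T : Op ι) : extendHom e T = extendOp e T := rfl

theorem extendOp_injective (e : ι ↪ κ) : Function.Injective (extendOp e) := by
  intro S T h
  ext1 f
  have := congrArg (fun X : Op κ => pull e (X (push e f))) h
  simpa [extendOp_apply, pull_push] using this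

theorem extendOp_mul (e : ι ↪ κ) (S T : Op ι) :
    extendOp e (S * T) = extendOp e S * extendOp e T := map_mul (extendHom e) S T

theorem extendOp_star (e : ι ↪ κ) (T : Op ι) : extendOp e (star T) = star (extendOp e T) :=
  map_star (extendHom e) T

theorem extendOp_mul_of_disjoint (e : ι ↪ μ) (e' : κ ↪ μ) (h : ∀ i k, e i ≠ e' k)
    (S : Op ι) (T : Op κ) : extendOp e S * extendOp e' T = 0 := by
  ext1 f
  simp [extendOp_apply, pull_push_of_disjoint e e' h]

theorem push_push (e : ι ↪ κ) (e' : κ ↪ μ) (f : L2 ι) :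
    push e' (push e f) = push (e.trans e') f := by
  ext m
  by_cases h : ∃ k, e' k = m
  · obtain ⟨k, rfl⟩ := h
    rw [push_apply]
    by_cases h' : ∃ i, e i = k
    · obtain ⟨i, rfl⟩ := h'
      rw [push_apply]
      exact (push_apply (e.trans e') f i).symm
    · rw [push_apply_of_notMem e f k h', push_apply_of_notMem]
      rintro ⟨i, hi⟩
      exact h' ⟨i, e'.injective hi⟩
  · rw [push_apply_of_notMem e' _ m h, push_apply_of_notMem]
    rintro ⟨i, hi⟩
    exact h ⟨e i, hi⟩

theorem pull_pull (e : ι ↪ κ) (e' : κ ↪ μ) (f : L2 μ) :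
    pull e (pull e' f) = pull (e.trans e') f := by
  ext i
  simp [pull_apply]

theorem extendOp_trans (e : ι ↪ κ) (e' : κ ↪ μ) (T : Op ι) :
    extendOp e' (extendOp e T) = extendOp (e.trans e') T := by
  ext1 f
  simp [extendOp_apply, push_push, pull_pull]

theorem extendOp_symm_extendOp (e : ι ≃ κ) (T : Op ι) :
    extendOp e.symm.toEmbedding (extendOp e.toEmbedding T) = T := by
  have h1 : ∀ f, pull e.toEmbedding (pull e.symm.toEmbedding f) = f := by
    intro f
    ext i
    simp [pull_apply]
  have h2 : ∀ f, push e.symm.toEmbedding (push e.toEmbedding f) = f := by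
    intro f
    ext i
    have := push_apply e.symm.toEmbedding (push e.toEmbedding f) (e i)
    rw [Equiv.coe_toEmbedding, Equiv.symm_apply_apply] at this
    exact this.trans (push_apply e.toEmbedding f i)
  ext1 f
  simp [extendOp_apply, h1, h2]

/-! #### Vectors -/

/-- The basis expansion of a vector converges in norm, so a continuous linear map is determined by
its values on the basis. -/
theorem op_ext_single [DecidableEq ι] {E : Type*} [NormedAddCommGroup E] [NormedSpace ℂ E]
    {S T : L2 ι →L[ℂ] E}
    (h : ∀ i, S (lp.single 2 i (1 : ℂ)) = T (lp.single 2 i (1 : ℂ))) : S = T := by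
  ext1 f
  have hf := lp.hasSum_single (p := 2) (by norm_num) f
  have hi : ∀ i, S (lp.single 2 i (f i)) = T (lp.single 2 i (f i)) := by
    intro i
    have : (lp.single 2 i (f i) : L2 ι) = f i • lp.single 2 i (1 : ℂ) := by
      rw [← lp.single_smul, smul_eq_mul, mul_one]
    rw [this, map_smul, map_smul, h]
  have h1 := S.hasSum hf
  have h2 := T.hasSum hf
  simp only [hi] at h1
  exact h1.unique h2

theorem vecTensor_apply (x : L2 ι) (y : L2 κ) (p : ι × κ) : vecTensor x y p = x p.1 * y p.2 := rfl

theorem vecTensor_single [DecidableEq ι] [DecidableEq κ] (i : ι) (k : κ) :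
    vecTensor (lp.single 2 i (1 : ℂ)) (lp.single 2 k (1 : ℂ)) = lp.single 2 (i, k) 1 := by
  ext ⟨i', k'⟩
  rw [vecTensor_apply]
  by_cases h : i' = i <;> by_cases h' : k' = k <;> simp [h, h']

/-- The basis vectors of `ℓ²(ι × κ)` are elementary tensors. Identities about `opTensor` thereby
reduce to `opTensor_vecTensor`. -/
theorem op_ext_vecTensor {E : Type*} [NormedAddCommGroup E] [NormedSpace ℂ E]
    {S T : L2 (ι × κ) →L[ℂ] E} (h : ∀ x y, S (vecTensor x y) = T (vecTensor x y)) : S = T := by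
  classical
  refine op_ext_single fun p => ?_
  rw [← vecTensor_single]
  exact h _ _

theorem inner_vecTensor (x x' : L2 ι) (y y' : L2 κ) :
    inner ℂ (vecTensor x y) (vecTensor x' y') = inner ℂ x x' * inner ℂ y y' := by
  have h1 := lp.hasSum_inner (𝕜 := ℂ) x x'
  have h2 := lp.hasSum_inner (𝕜 := ℂ) y y'
  have h3 := lp.hasSum_inner (𝕜 := ℂ) (vecTensor x y) (vecTensor x' y')
  have h4 := tsum_mul_tsum_of_summable_norm h1.summable.norm h2.summable.norm
  rw [h1.tsum_eq, h2.tsum_eq] at h4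
  rw [h4, ← h3.tsum_eq]
  refine tsum_congr fun p => ?_
  simp only [vecTensor_apply, RCLike.inner_apply, map_mul]
  ring

theorem vecTensor_add_left (x x' : L2 ι) (y : L2 κ) :
    vecTensor (x + x') y = vecTensor x y + vecTensor x' y := by
  ext p
  exact add_mul (x p.1) (x' p.1) (y p.2)

theorem vecTensor_add_right (x : L2 ι) (y y' : L2 κ) :
    vecTensor x (y + y') = vecTensor x y + vecTensor x y' := by
  ext p
  exact mul_add (x p.1) (y p.2) (y' p.2)

theorem vecTensor_smul_left (c : ℂ) (x : L2 ι) (y : L2 κ) :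
    vecTensor (c • x) y = c • vecTensor x y := by
  ext p
  exact mul_assoc c (x p.1) (y p.2)

theorem vecTensor_smul_right (c : ℂ) (x : L2 ι) (y : L2 κ) :
    vecTensor x (c • y) = c • vecTensor x y := by
  ext p
  exact mul_left_comm (x p.1) c (y p.2)

theorem pull_vecTensor (e : ι ↪ ι') (e' : κ ↪ κ') (x : L2 ι') (y : L2 κ') :
    pull (e.prodMap e') (vecTensor x y) = vecTensor (pull e x) (pull e' y) := by
  ext p
  simp [pull_apply, vecTensor_apply]

theorem push_vecTensor (e : ι ↪ ι') (e' : κ ↪ κ') (x : L2 ι) (y : L2 κ) :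
    push (e.prodMap e') (vecTensor x y) = vecTensor (push e x) (push e' y) := by
  ext ⟨i, k⟩
  rw [vecTensor_apply]
  by_cases hi : ∃ j, e j = i
  · obtain ⟨i, rfl⟩ := hi
    by_cases hk : ∃ j, e' j = k
    · obtain ⟨k, rfl⟩ := hk
      rw [push_apply, push_apply]
      exact push_apply (e.prodMap e') (vecTensor x y) (i, k)
    · rw [push_apply_of_notMem e' y k hk, mul_zero, push_apply_of_notMem]
      rintro ⟨⟨j, l⟩, h⟩
      exact hk ⟨l, congrArg Prod.snd h⟩
  · rw [push_apply_of_notMem e x i hi, zero_mul, push_apply_of_notMem]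
    rintro ⟨⟨j, l⟩, h⟩
    exact hi ⟨j, congrArg Prod.fst h⟩

/-! #### Tensor products of operators -/

theorem opTensor_mul (a a' : Op ι) (b b' : Op κ) :
    opTensor a b * opTensor a' b' = opTensor (a * a') (b * b') := by
  refine op_ext_vecTensor fun x y => ?_
  simp [opTensor_vecTensor]

theorem opTensor_add_left (a a' : Op ι) (b : Op κ) :
    opTensor (a + a') b = opTensor a b + opTensor a' b := by
  refine op_ext_vecTensor fun x y => ?_
  simp [opTensor_vecTensor, vecTensor_add_left]

theorem opTensor_add_right (a : Op ι) (b b' : Op κ) :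
    opTensor a (b + b') = opTensor a b + opTensor a b' := by
  refine op_ext_vecTensor fun x y => ?_
  simp [opTensor_vecTensor, vecTensor_add_right]

theorem opTensor_smul_left (c : ℂ) (a : Op ι) (b : Op κ) :
    opTensor (c • a) b = c • opTensor a b := by
  refine op_ext_vecTensor fun x y => ?_
  simp [opTensor_vecTensor, vecTensor_smul_left]

theorem opTensor_smul_right (c : ℂ) (a : Op ι) (b : Op κ) :
    opTensor a (c • b) = c • opTensor a b := by
  refine op_ext_vecTensor fun x y => ?_
  simp [opTensor_vecTensor, vecTensor_smul_right]

theorem opTensor_one : opTensor (1 : Op ι) (1 : Op κ) = 1 := by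
  refine op_ext_vecTensor fun x y => ?_
  simp [opTensor_vecTensor]

theorem opTensor_star (a : Op ι) (b : Op κ) :
    opTensor (star a) (star b) = star (opTensor a b) := by
  refine op_ext_vecTensor fun x y => ?_
  refine ext_inner_left ℂ fun v => ?_
  -- The test vector `v` is not elementary, so the extensionality principle is used a second time,
  -- for the functionals that pair with the two vectors to be compared.
  have key : innerSL ℂ (opTensor (star a) (star b) (vecTensor x y))
      = innerSL ℂ (star (opTensor a b) (vecTensor x y)) := by
    refine op_ext_vecTensor fun x' y' => ?_
    simp only [innerSL_apply_apply, ContinuousLinearMap.star_eq_adjoint,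
      ContinuousLinearMap.adjoint_inner_left, opTensor_vecTensor, inner_vecTensor]
  have := congrArg (fun L : L2 (ι × κ) →L[ℂ] ℂ => star (L v)) key
  simpa using this

/-- Each of the two factors in the definition of `opTensor` comes from an amplification, which does
not increase the norm; conjugation by the flip is a *-homomorphism and hence contractive. -/
theorem norm_opTensor_le (a : Op ι) (b : Op κ) : ‖opTensor a b‖ ≤ ‖a‖ * ‖b‖ := by
  refine (ContinuousLinearMap.opNorm_comp_le _ _).trans ?_
  refine mul_le_mul (LinearMap.mkContinuous_norm_le _ (norm_nonneg _) _) ?_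
    (norm_nonneg _) (norm_nonneg _)
  exact (NonUnitalStarAlgHom.norm_apply_le (extendHom (Equiv.prodComm κ ι).toEmbedding)
    (ampl ι b)).trans (LinearMap.mkContinuous_norm_le _ (norm_nonneg _) _)

theorem extendOp_opTensor (e : ι ↪ ι') (e' : κ ↪ κ') (a : Op ι) (b : Op κ) :
    extendOp (e.prodMap e') (opTensor a b) = opTensor (extendOp e a) (extendOp e' b) := by
  refine op_ext_vecTensor fun x y => ?_
  rw [opTensor_vecTensor, extendOp_apply, pull_vecTensor, opTensor_vecTensor, push_vecTensor]
  rfl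

theorem push_prodComm (x : L2 ι) (y : L2 κ) :
    push (Equiv.prodComm ι κ).toEmbedding (vecTensor x y) = vecTensor y x := by
  ext ⟨k, i⟩
  exact (push_apply (Equiv.prodComm ι κ).toEmbedding (vecTensor x y) (i, k)).trans (mul_comm _ _)

theorem extendOp_prodComm (a : Op ι) (b : Op κ) :
    extendOp (Equiv.prodComm ι κ).toEmbedding (opTensor a b) = opTensor b a := by
  refine op_ext_vecTensor fun x y => ?_
  rw [opTensor_vecTensor, ← push_prodComm y x, extendOp_apply, pull_push, opTensor_vecTensor,
    push_prodComm]

theorem push_prodAssoc (x : L2 ι) (y : L2 κ) (z : L2 μ) :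
    push (Equiv.prodAssoc ι κ μ).toEmbedding (vecTensor (vecTensor x y) z)
      = vecTensor x (vecTensor y z) := by
  ext ⟨i, k, m⟩
  exact (push_apply (Equiv.prodAssoc ι κ μ).toEmbedding _ ((i, k), m)).trans (mul_assoc _ _ _)

theorem extendOp_prodAssoc (a : Op ι) (b : Op κ) (c : Op μ) :
    extendOp (Equiv.prodAssoc ι κ μ).toEmbedding (opTensor (opTensor a b) c)
      = opTensor a (opTensor b c) := by
  classical
  refine op_ext_single fun p => ?_
  rw [← vecTensor_single p.1 p.2, ← vecTensor_single p.2.1 p.2.2, ← push_prodAssoc,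
    extendOp_apply, pull_push, push_prodAssoc]
  simp only [opTensor_vecTensor, push_prodAssoc]

end Operators

/-! ### *-homomorphisms of C*-algebras -/

section Hom

variable {A B L : Type*} [NonUnitalCStarAlgebra A] [NonUnitalCStarAlgebra B]
  [NonUnitalCStarAlgebra L]

theorem continuous_hom (f : A →⋆ₙₐ[ℂ] B) : Continuous f :=
  AddMonoidHomClass.continuous_of_bound f 1 fun x => by
    simpa using NonUnitalStarAlgHom.norm_apply_le f x

/-- An injective *-homomorphism of C*-algebras is isometric, and the isometric image of a complete
space is closed. -/
theorem isClosed_range_hom (f : A →⋆ₙₐ[ℂ] B) (hf : Function.Injective f) :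
    IsClosed (Set.range f) :=
  (NonUnitalStarAlgHom.isometry f hf).isClosedEmbedding.isClosed_range

/-- The factorization of a *-homomorphism through an injective one. -/
def codLift (π : A →⋆ₙₐ[ℂ] L) (hπ : Function.Injective π) (f : B →⋆ₙₐ[ℂ] L)
    (h : ∀ x, f x ∈ Set.range π) : B →⋆ₙₐ[ℂ] A where
  toFun x := (h x).choose
  map_smul' c x := hπ <| by
    rw [(h _).choose_spec, map_smul, map_smul, MonoidHom.id_apply, (h x).choose_spec]
  map_zero' := hπ <| by rw [(h _).choose_spec, map_zero, map_zero]
  map_add' x y := hπ <| by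
    rw [(h _).choose_spec, map_add, map_add, (h x).choose_spec, (h y).choose_spec]
  map_mul' x y := hπ <| by
    rw [(h _).choose_spec, map_mul, map_mul, (h x).choose_spec, (h y).choose_spec]
  map_star' x := hπ <| by
    rw [(h _).choose_spec, map_star, map_star, (h x).choose_spec]

theorem codLift_spec (π : A →⋆ₙₐ[ℂ] L) (hπ : Function.Injective π) (f : B →⋆ₙₐ[ℂ] L)
    (h : ∀ x, f x ∈ Set.range π) (x : B) : π (codLift π hπ f h x) = f x := (h x).choose_spec

/-- The span of a set which is closed under products and adjoints up to linear combinations. -/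
def spanStar (W : Set A) (hmul : ∀ x ∈ W, ∀ y ∈ W, x * y ∈ Submodule.span ℂ W)
    (hstar : ∀ x ∈ W, star x ∈ Submodule.span ℂ W) : NonUnitalStarSubalgebra ℂ A where
  carrier := Submodule.span ℂ W
  add_mem' := Submodule.add_mem _
  zero_mem' := Submodule.zero_mem _
  smul_mem' c _ := Submodule.smul_mem _ c
  mul_mem' {a b} ha hb := by
    induction ha using Submodule.span_induction with
    | zero => simp
    | add x y _ _ hx hy => rw [add_mul]; exact Submodule.add_mem _ hx hy
    | smul c x _ hx => rw [smul_mul_assoc]; exact Submodule.smul_mem _ c hx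
    | mem x hx =>
      induction hb using Submodule.span_induction with
      | zero => simp
      | add y z _ _ hy hz => rw [mul_add]; exact Submodule.add_mem _ hy hz
      | smul c y _ hy => rw [mul_smul_comm]; exact Submodule.smul_mem _ c hy
      | mem y hy => exact hmul x hx y hy
  star_mem' {a} ha := by
    induction ha using Submodule.span_induction with
    | zero => simp
    | add x y _ _ hx hy => rw [star_add]; exact Submodule.add_mem _ hx hy
    | smul c x _ hx => rw [star_smul]; exact Submodule.smul_mem _ _ hx
    | mem x hx => exact hstar x hx

/-- Under these hypotheses the span is itself a *-algebra, so it contains the *-algebra generated by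
`W`. -/
theorem dense_span_of_adjoin {W : Set A} (hmul : ∀ x ∈ W, ∀ y ∈ W, x * y ∈ Submodule.span ℂ W)
    (hstar : ∀ x ∈ W, star x ∈ Submodule.span ℂ W)
    (h : (NonUnitalStarAlgebra.adjoin ℂ W).topologicalClosure = ⊤) :
    Dense (Submodule.span ℂ W : Set A) := by
  intro x
  have hx : x ∈ (NonUnitalStarAlgebra.adjoin ℂ W).topologicalClosure := by
    rw [h]; exact NonUnitalStarAlgebra.mem_top
  have hle : NonUnitalStarAlgebra.adjoin ℂ W ≤ spanStar W hmul hstar :=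
    NonUnitalStarAlgebra.adjoin_le Submodule.subset_span
  exact closure_mono (show (NonUnitalStarAlgebra.adjoin ℂ W : Set A) ⊆ _ from hle) hx

theorem eq_of_dense_span {E F : Type*} [NormedAddCommGroup E] [NormedSpace ℂ E]
    [NormedAddCommGroup F] [NormedSpace ℂ F] {W : Set E}
    (hW : Dense (Submodule.span ℂ W : Set E)) {S T : E →L[ℂ] F} (h : ∀ x ∈ W, S x = T x) :
    S = T :=
  ContinuousLinearMap.ext_on hW h

/-- By continuity `a * x = 0` for every `x`; the choice `x = star a` and the C*-identity give `a =
0`. -/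
theorem eq_zero_of_mul_dense {W : Set A} (hW : Dense (Submodule.span ℂ W : Set A)) {a : A}
    (h : ∀ x ∈ W, a * x = 0) : a = 0 := by
  have h1 : ContinuousLinearMap.mul ℂ A a = 0 :=
    eq_of_dense_span hW fun x hx => by simpa using h x hx
  have h2 := congrArg (fun T : A →L[ℂ] A => T (star a)) h1
  simpa using h2

end Hom

/-! ### Generated C*-algebras -/

section Gen

variable {ι κ : Type*}

theorem isometry_op (A : ConcreteCStar ι) : Isometry A.op :=
  NonUnitalStarAlgHom.isometry A.op A.op_injective

theorem norm_op (A : ConcreteCStar ι) (a : A) : ‖A.op a‖ = ‖a‖ :=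
  NonUnitalStarAlgHom.norm_map A.op A.op_injective a

/-- Only the range of `(cstarGen S).op` is known. This map is isometric, hence closed: a limit of
images of polynomials in the generators is the image of such a limit, and injectivity brings the
statement back to `cstarGen S`. -/
theorem adjoin_cstarGen (S : Set (Op ι)) :
    (NonUnitalStarAlgebra.adjoin ℂ {t : cstarGen S | (cstarGen S).op t ∈ S}).topologicalClosure
      = ⊤ := by
  rw [NonUnitalStarAlgebra.eq_top_iff]
  intro x
  have hx : (cstarGen S).op x ∈ Set.range (cstarGen S).op := ⟨x, rfl⟩
  rw [range_cstarGen] at hx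
  have himg : (cstarGen S).op '' {t : cstarGen S | (cstarGen S).op t ∈ S} = S :=
    Set.image_preimage_eq_of_subset (subset_range_cstarGen S)
  have hmap := NonUnitalStarAlgHom.map_adjoin (R := ℂ) (cstarGen S).op
    {t : cstarGen S | (cstarGen S).op t ∈ S}
  rw [himg] at hmap
  rw [← hmap] at hx
  change (cstarGen S).op x ∈ closure ((cstarGen S).op ''
    (NonUnitalStarAlgebra.adjoin ℂ {t : cstarGen S | (cstarGen S).op t ∈ S} : Set _)) at hx
  obtain ⟨y, hy, hxy⟩ := (isometry_op (cstarGen S)).isClosedEmbedding.isClosedMap.closure_image_subset _ hx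
  rwa [← (cstarGen S).op_injective hxy]

/-- The induction principle for generated C*-algebras: a property that cuts out a closed
*-subalgebra need only be checked on generators. -/
theorem cstarGen_le {S : Set (Op ι)} (P : NonUnitalStarSubalgebra ℂ (cstarGen S))
    (hP : IsClosed (P : Set (cstarGen S)))
    (h : ∀ t, (cstarGen S).op t ∈ S → t ∈ P) (x : cstarGen S) : x ∈ P := by
  have hx : x ∈ (NonUnitalStarAlgebra.adjoin ℂ
      {t : cstarGen S | (cstarGen S).op t ∈ S}).topologicalClosure := by
    rw [adjoin_cstarGen]; exact NonUnitalStarAlgebra.mem_top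
  exact NonUnitalStarSubalgebra.topologicalClosure_minimal _
    (NonUnitalStarAlgebra.adjoin_le h) hP hx

theorem cstarGen_hom_ext {B : Type*} [NonUnitalCStarAlgebra B] {S : Set (Op ι)}
    {f g : cstarGen S →⋆ₙₐ[ℂ] B} (h : ∀ T (hT : T ∈ S), f (cstarGen.of T hT) = g (cstarGen.of T hT)) :
    f = g := by
  ext x
  refine cstarGen_le (NonUnitalStarAlgHom.equalizer f g)
    (isClosed_eq (continuous_hom f) (continuous_hom g)) (fun t ht => ?_) x
  have : t = cstarGen.of _ ht := (cstarGen S).op_injective (op_of _ ht).symm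
  rw [this]
  exact h _ ht

theorem dense_span_cstarGen {S : Set (Op ι)} (hmul : ∀ x ∈ S, ∀ y ∈ S, x * y ∈ S)
    (hstar : ∀ x ∈ S, star x ∈ S) :
    Dense (Submodule.span ℂ {t : cstarGen S | (cstarGen S).op t ∈ S} : Set (cstarGen S)) := by
  refine dense_span_of_adjoin (fun x hx y hy => Submodule.subset_span ?_)
    (fun x hx => Submodule.subset_span ?_) (adjoin_cstarGen S)
  · simpa using hmul _ hx _ hy
  · rw [Set.mem_ofPred_eq, map_star]
    exact hstar _ hx

/-- The *-homomorphism of a generated C*-algebra into `A` which a *-homomorphism into a bigger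
algebra `L` induces. -/
theorem exists_cstarGen_lift {A L : Type*} [NonUnitalCStarAlgebra A] [NonUnitalCStarAlgebra L]
    {S : Set (Op ι)} (π : A →⋆ₙₐ[ℂ] L)
    (hπ : Function.Injective π) (h : cstarGen S →⋆ₙₐ[ℂ] L)
    (hS : ∀ t, (cstarGen S).op t ∈ S → h t ∈ Set.range π) :
    ∃ f : cstarGen S →⋆ₙₐ[ℂ] A, ∀ x, π (f x) = h x := by
  have key : ∀ x, h x ∈ Set.range π := fun x =>
    cstarGen_le ((NonUnitalStarAlgHom.range π).comap h)
      ((isClosed_range_hom π hπ).preimage (continuous_hom h)) hS x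
  exact ⟨codLift π hπ h key, codLift_spec π hπ h key⟩

theorem exists_spatial_hom {A : ConcreteCStar κ} {S : Set (Op ι)} (h : Op ι →⋆ₙₐ[ℂ] Op κ)
    (hS : ∀ T ∈ S, h T ∈ Set.range A.op) :
    ∃ f : cstarGen S →⋆ₙₐ[ℂ] A, ∀ x, A.op (f x) = h ((cstarGen S).op x) :=
  exists_cstarGen_lift A.op A.op_injective (h.comp (cstarGen S).op) fun _ ht => hS _ ht

/-- A contractive *-relation extends to a *-homomorphism. -/
theorem exists_hom_of_graph {B : Type*} [NonUnitalCStarAlgebra B] {S : Set (Op ι)}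
    (D : NonUnitalStarSubalgebra ℂ (Op ι × B)) (hD : ∀ d ∈ D, ‖d.2‖ ≤ ‖d.1‖)
    (hS : ∀ T ∈ S, ∃ b, (T, b) ∈ D) :
    ∃ f : cstarGen S →⋆ₙₐ[ℂ] B, ∀ x b, ((cstarGen S).op x, b) ∈ D → f x = b := by
  have hcl : IsClosed (D.topologicalClosure : Set (Op ι × B)) :=
    NonUnitalStarSubalgebra.isClosed_topologicalClosure _
  have hE : ∀ d ∈ D.topologicalClosure, ‖d.2‖ ≤ ‖d.1‖ := fun d hd =>
    closure_minimal (s := (D : Set (Op ι × B))) (t := {d | ‖d.2‖ ≤ ‖d.1‖}) hD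
      (isClosed_le (by fun_prop) (by fun_prop)) hd
  -- The norm bound survives in the closure of `D` and makes it the graph of a function of the first
  -- coordinate. The representation of `cstarGen S` lifts to this graph, and the second coordinate
  -- of the lift is the required map.
  let π : D.topologicalClosure →⋆ₙₐ[ℂ] Op ι :=
    (NonUnitalStarAlgHom.fst ℂ (Op ι) B).comp (NonUnitalStarSubalgebraClass.subtype _)
  have hπ : Function.Injective π := by
    rw [injective_iff_map_eq_zero]
    intro d hd
    have h1 : d.1.1 = 0 := hd
    have h2 := hE d.1 d.2
    rw [h1, norm_zero, norm_le_zero_iff] at h2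
    exact Subtype.ext (Prod.ext h1 h2)
  obtain ⟨f, hf⟩ := exists_cstarGen_lift π hπ (cstarGen S).op fun t ht => by
    obtain ⟨b, hb⟩ := hS _ ht
    exact ⟨⟨_, NonUnitalStarSubalgebra.le_topologicalClosure _ hb⟩, rfl⟩
  refine ⟨((NonUnitalStarAlgHom.snd ℂ (Op ι) B).comp
    (NonUnitalStarSubalgebraClass.subtype _)).comp f, fun x b hb => ?_⟩
  have : f x = ⟨_, NonUnitalStarSubalgebra.le_topologicalClosure _ hb⟩ := hπ (hf x)
  change (f x).1.2 = b
  rw [this]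

end Gen

/-! ### Spatial tensor products -/

section Tensor

variable {ι κ μ : Type*}

theorem op_tmul {A : ConcreteCStar ι} {B : ConcreteCStar κ} (a : A) (b : B) :
    (spatialTensor A B).op (tmul a b) = opTensor (A.op a) (B.op b) := op_of _ _

variable {A : ConcreteCStar ι} {B : ConcreteCStar κ}

theorem tmul_mul_tmul (a a' : A) (b b' : B) :
    tmul a b * tmul a' b' = tmul (a * a') (b * b') := by
  apply (spatialTensor A B).op_injective
  simp [op_tmul, opTensor_mul]

theorem star_tmul (a : A) (b : B) : star (tmul a b) = tmul (star a) (star b) := by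
  apply (spatialTensor A B).op_injective
  rw [map_star, op_tmul, op_tmul, map_star, map_star, opTensor_star]

theorem norm_tmul_le (a : A) (b : B) : ‖tmul a b‖ ≤ ‖a‖ * ‖b‖ := by
  rw [← norm_op, op_tmul, ← norm_op A, ← norm_op B]
  exact norm_opTensor_le _ _

theorem tmul_add_left (a a' : A) (b : B) : tmul (a + a') b = tmul a b + tmul a' b := by
  apply (spatialTensor A B).op_injective
  simp [op_tmul, opTensor_add_left]

theorem tmul_add_right (a : A) (b b' : B) : tmul a (b + b') = tmul a b + tmul a b' := by
  apply (spatialTensor A B).op_injective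
  simp [op_tmul, opTensor_add_right]

theorem tmul_smul_left (c : ℂ) (a : A) (b : B) : tmul (c • a) b = c • tmul a b := by
  apply (spatialTensor A B).op_injective
  simp [op_tmul, opTensor_smul_left]

theorem tmul_smul_right (c : ℂ) (a : A) (b : B) : tmul a (c • b) = c • tmul a b := by
  apply (spatialTensor A B).op_injective
  simp [op_tmul, opTensor_smul_right]

variable (A B) in
/-- `tmul` as a continuous bilinear map. -/
def tmulL : A →L[ℂ] B →L[ℂ] spatialTensor A B :=
  LinearMap.mkContinuous₂ (LinearMap.mk₂ ℂ (fun a b => tmul a b) tmul_add_left tmul_smul_left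
    tmul_add_right tmul_smul_right) 1 fun a b => by simpa using norm_tmul_le a b

@[simp] theorem tmulL_apply (a : A) (b : B) : tmulL A B a b = tmul a b := rfl

@[simp] theorem tmul_zero_left (b : B) : tmul (0 : A) b = 0 := by
  rw [← tmulL_apply, map_zero]; rfl

@[simp] theorem tmul_zero_right (a : A) : tmul a (0 : B) = 0 := by
  rw [← tmulL_apply, map_zero]

theorem spatialTensor_generator {t : spatialTensor A B}
    (ht : (spatialTensor A B).op t ∈
      {T | ∃ (a : A) (b : B), T = opTensor (A.op a) (B.op b)}) : ∃ a b, t = tmul a b := by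
  obtain ⟨a, b, h⟩ := ht
  exact ⟨a, b, (spatialTensor A B).op_injective (h.trans (op_tmul a b).symm)⟩

theorem dense_span_tmul :
    Dense (Submodule.span ℂ {t : spatialTensor A B | ∃ a b, t = tmul a b} :
      Set (spatialTensor A B)) := by
  have h : {t : spatialTensor A B | ∃ a b, t = tmul a b}
      = {t : spatialTensor A B | (spatialTensor A B).op t ∈
        {T | ∃ (a : A) (b : B), T = opTensor (A.op a) (B.op b)}} := by
    ext t
    refine ⟨?_, spatialTensor_generator⟩
    rintro ⟨a, b, rfl⟩
    exact ⟨a, b, op_tmul a b⟩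
  rw [h]
  refine dense_span_cstarGen ?_ ?_
  · rintro _ ⟨a, b, rfl⟩ _ ⟨a', b', rfl⟩
    exact ⟨a * a', b * b', by rw [opTensor_mul, map_mul, map_mul]⟩
  · rintro _ ⟨a, b, rfl⟩
    exact ⟨star a, star b, by rw [map_star, map_star, opTensor_star]⟩

/-- Tensors of vectors from dense subspaces span a dense subspace. -/
theorem dense_span_tmul_of_dense {V : Set A} {W : Set B}
    (hV : Dense (Submodule.span ℂ V : Set A)) (hW : Dense (Submodule.span ℂ W : Set B)) :
    Dense (Submodule.span ℂ {t : spatialTensor A B | ∃ a ∈ V, ∃ b ∈ W, t = tmul a b} :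
      Set (spatialTensor A B)) := by
  set Q := Submodule.span ℂ {t : spatialTensor A B | ∃ a ∈ V, ∃ b ∈ W, t = tmul a b}
  have h1 : ∀ a ∈ V, ∀ b, tmul a b ∈ Q.topologicalClosure := by
    intro a ha b
    have hc : IsClosed ((Q.topologicalClosure.comap (tmulL A B a).toLinearMap : Submodule ℂ B) :
        Set B) := Q.isClosed_topologicalClosure.preimage (tmulL A B a).continuous
    have hle : Submodule.span ℂ W ≤ Q.topologicalClosure.comap (tmulL A B a).toLinearMap :=
      Submodule.span_le.2 fun b hb =>
        Q.le_topologicalClosure (Submodule.subset_span ⟨a, ha, b, hb, rfl⟩)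
    exact closure_minimal hle hc (hW b)
  have h2 : ∀ a b, tmul a b ∈ Q.topologicalClosure := by
    intro a b
    have hc : IsClosed ((Q.topologicalClosure.comap ((tmulL A B).flip b).toLinearMap :
        Submodule ℂ A) : Set A) :=
      Q.isClosed_topologicalClosure.preimage ((tmulL A B).flip b).continuous
    have hle : Submodule.span ℂ V ≤ Q.topologicalClosure.comap ((tmulL A B).flip b).toLinearMap :=
      Submodule.span_le.2 fun a ha => h1 a ha b
    exact closure_minimal hle hc (hV a)
  have h3 : Submodule.span ℂ {t : spatialTensor A B | ∃ a b, t = tmul a b}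
      ≤ Q.topologicalClosure := Submodule.span_le.2 (by rintro _ ⟨a, b, rfl⟩; exact h2 a b)
  intro t
  exact closure_minimal h3 Q.isClosed_topologicalClosure (dense_span_tmul t)

end Tensor

/-! ### Direct sums -/

section DirectSum

variable {J : Type*} {κ : J → Type*} (A : ∀ j, ConcreteCStar (κ j))

theorem op_summand (j : J) (x : A j) :
    (directSum A).op (summand A j x) = extendOp (sigmaEmb κ j) ((A j).op x) := op_of _ _

theorem directSum_generator {t : directSum A}
    (ht : (directSum A).op t ∈ {T | ∃ (j : J) (x : A j), T = extendOp (sigmaEmb κ j) ((A j).op x)}) :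
    ∃ j x, t = summand A j x := by
  obtain ⟨j, x, h⟩ := ht
  exact ⟨j, x, (directSum A).op_injective (h.trans (op_summand A j x).symm)⟩

theorem sigmaEmb_ne {i j : J} (h : i ≠ j) (x : κ i) (y : κ j) :
    sigmaEmb κ i x ≠ sigmaEmb κ j y := fun e => h (congrArg Sigma.fst e)

theorem dense_span_summand :
    Dense (Submodule.span ℂ {t : directSum A | ∃ j x, t = summand A j x} : Set (directSum A)) := by
  have h : {t : directSum A | ∃ j x, t = summand A j x}
      = {t : directSum A | (directSum A).op t ∈
        {T | ∃ (j : J) (x : A j), T = extendOp (sigmaEmb κ j) ((A j).op x)}} := by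
    ext t
    refine ⟨?_, directSum_generator A⟩
    rintro ⟨j, x, rfl⟩
    exact ⟨j, x, op_summand A j x⟩
  rw [h]
  refine dense_span_cstarGen ?_ ?_
  · rintro _ ⟨i, x, rfl⟩ _ ⟨j, y, rfl⟩
    by_cases hij : i = j
    · subst hij
      exact ⟨i, x * y, by rw [map_mul, extendOp_mul]⟩
    · refine ⟨i, 0, ?_⟩
      rw [extendOp_mul_of_disjoint _ _ (sigmaEmb_ne hij), map_zero]
      exact (map_zero (extendHom _)).symm
  · rintro _ ⟨i, x, rfl⟩
    exact ⟨i, star x, by rw [map_star, extendOp_star]⟩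

/-- `summand` as a *-homomorphism. -/
def summandHom (j : J) : A j →⋆ₙₐ[ℂ] directSum A :=
  codLift (directSum A).op (directSum A).op_injective ((extendHom (sigmaEmb κ j)).comp (A j).op)
    fun x => ⟨summand A j x, op_summand A j x⟩

theorem summandHom_apply (j : J) (x : A j) : summandHom A j x = summand A j x :=
  (directSum A).op_injective ((codLift_spec ..).trans (op_summand A j x).symm)

end DirectSum

/-! ### Matrix entries of operators on `ℓ²(ι × κ)` -/

/-- The closed *-algebra `D` is a C*-algebra in the maximum norm. By `h` its first projection is
injective, hence isometric, and so `‖d.2‖ ≤ max ‖d.1‖ ‖d.2‖ = ‖d.1‖`. This is automatic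
contractivity for a *-homomorphism that is given only by its graph. -/
theorem norm_snd_le_of_closed {A B : Type*} [NonUnitalCStarAlgebra A] [NonUnitalCStarAlgebra B]
    (D : NonUnitalStarSubalgebra ℂ (A × B)) (hD : IsClosed (D : Set (A × B)))
    (h : ∀ d ∈ D, d.1 = 0 → d.2 = 0) (d : A × B) (hd : d ∈ D) : ‖d.2‖ ≤ ‖d.1‖ := by
  let π : D →⋆ₙₐ[ℂ] A :=
    (NonUnitalStarAlgHom.fst ℂ A B).comp (NonUnitalStarSubalgebraClass.subtype D)
  have hπ : Function.Injective π := by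
    rw [injective_iff_map_eq_zero]
    intro d hd
    exact Subtype.ext (Prod.ext hd (h d.1 d.2 hd))
  have h1 : ‖d.1‖ = ‖d‖ := NonUnitalStarAlgHom.norm_map π hπ ⟨d, hd⟩
  rw [h1]
  exact le_max_right _ _

section Entries

variable {ι κ ι' : Type*}

/-- The matrix entries in `B(ℓ²(ι))` of an operator on `ℓ²(ι × κ)`. -/
def entry (k l : κ) (T : Op (ι × κ)) : Op ι :=
  pull (sliceEmb ι k) ∘L T ∘L (push (sliceEmb ι l)).toContinuousLinearMap

theorem entry_apply (k l : κ) (T : Op (ι × κ)) (x : L2 ι) :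
    entry k l T x = pull (sliceEmb ι k) (T (push (sliceEmb ι l) x)) := rfl

theorem continuous_entry (k l : κ) : Continuous (entry (ι := ι) k l) :=
  continuous_const.clm_comp (continuous_id.clm_comp continuous_const)

theorem entry_add (k l : κ) (S T : Op (ι × κ)) : entry k l (S + T) = entry k l S + entry k l T := by
  ext1 x
  simp [entry_apply]

theorem entry_smul (k l : κ) (c : ℂ) (T : Op (ι × κ)) : entry k l (c • T) = c • entry k l T := by
  ext1 x
  simp [entry_apply]

theorem entry_zero (k l : κ) : entry k l (0 : Op (ι × κ)) = 0 := by
  ext1 x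
  simp [entry_apply]

theorem entry_star (k l : κ) (T : Op (ι × κ)) : entry k l (star T) = star (entry l k T) := by
  simp only [ContinuousLinearMap.star_eq_adjoint, entry, pull, ContinuousLinearMap.adjoint_comp,
    ContinuousLinearMap.adjoint_adjoint, ContinuousLinearMap.comp_assoc]

theorem push_sliceEmb [DecidableEq κ] (l : κ) (x : L2 ι) :
    push (sliceEmb ι l) x = vecTensor x (lp.single 2 l (1 : ℂ)) := by
  ext ⟨i, k⟩
  rw [vecTensor_apply]
  by_cases h : k = l
  · subst h
    exact (push_apply (sliceEmb ι k) x i).trans (by simp)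
  · rw [push_apply_of_notMem]
    · simp [h]
    · rintro ⟨j, hj⟩
      exact h (congrArg Prod.snd hj).symm

theorem pull_sliceEmb_vecTensor (k : κ) (x : L2 ι) (y : L2 κ) :
    pull (sliceEmb ι k) (vecTensor x y) = y k • x := by
  ext i
  rw [pull_apply]
  exact mul_comm (x i) (y k)

/-- Taking an entry is slicing by the functional `⟨δ_k, · δ_l⟩` on the second factor; consequently
entries of sums of elementary tensors are linear combinations of their first factors. -/
theorem entry_opTensor [DecidableEq κ] (k l : κ) (a : Op ι) (b : Op κ) :
    entry k l (opTensor a b) = b (lp.single 2 l (1 : ℂ)) k • a := by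
  ext1 x
  rw [entry_apply, push_sliceEmb, opTensor_vecTensor, pull_sliceEmb_vecTensor]
  rfl

theorem eq_zero_of_entry {T : Op (ι × κ)} (h : ∀ k l, entry k l T = 0) : T = 0 := by
  classical
  refine op_ext_single fun p => ?_
  rw [← vecTensor_single, ← push_sliceEmb]
  ext ⟨i, k⟩
  have := congrArg (fun S : Op ι => S (lp.single 2 p.1 1) i) (h k p.2)
  simp only [entry_apply, pull_apply] at this
  exact this

theorem sum_slices [Fintype κ] (f : L2 (ι × κ)) :
    ∑ k, push (sliceEmb ι k) (pull (sliceEmb ι k) f) = f := by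
  classical
  ext ⟨i, k⟩
  rw [lp.coeFn_sum, Finset.sum_apply, Finset.sum_eq_single k]
  · exact (push_apply (sliceEmb ι k) _ i).trans (by rw [pull_apply]; rfl)
  · intro l _ hl
    refine push_apply_of_notMem _ _ _ ?_
    rintro ⟨j, hj⟩
    exact hl (congrArg Prod.snd hj)
  · simp

/-- For finite `κ` the slice projections form a finite decomposition of the identity, so composition
is matrix multiplication without any question of convergence. Infinite `κ` is reached afterwards
through finite compressions. -/
theorem entry_mul [Fintype κ] (k l : κ) (S T : Op (ι × κ)) :
    entry k l (S * T) = ∑ m, entry k m S * entry m l T := by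
  ext1 x
  have h : T (push (sliceEmb ι l) x)
      = ∑ m, push (sliceEmb ι m) (pull (sliceEmb ι m) (T (push (sliceEmb ι l) x))) :=
    (sum_slices _).symm
  rw [entry_apply, mul_apply_eq_comp, h]
  simp [entry_apply]

/-- Pairs of operators all of whose entries are in `G`. -/
def entryAlgebra (F : Type*) [Fintype F] (G : NonUnitalStarSubalgebra ℂ (Op ι × Op ι')) :
    NonUnitalStarSubalgebra ℂ (Op (ι × F) × Op (ι' × F)) where
  carrier := {p | ∀ k l, (entry k l p.1, entry k l p.2) ∈ G}
  add_mem' {p q} hp hq k l := by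
    simpa [entry_add] using add_mem (hp k l) (hq k l)
  zero_mem' k l := by
    simp only [Prod.fst_zero, Prod.snd_zero, entry_zero]
    exact zero_mem G
  smul_mem' c p hp k l := by
    simpa [entry_smul] using SMulMemClass.smul_mem c (hp k l)
  mul_mem' {p q} hp hq k l := by
    have := sum_mem fun m (_ : m ∈ Finset.univ) => mul_mem (hp k m) (hq m l)
    convert this using 1
    ext1
    · simp [entry_mul, Prod.fst_sum]
    · simp [entry_mul, Prod.snd_sum]
  star_mem' {p} hp k l := by
    have := star_mem (hp l k)
    convert this using 1
    ext1
    · exact entry_star k l p.1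
    · exact entry_star k l p.2

/-- The pairs with all entries in `G` form the matrix algebra `M_F(G)`, a closed *-algebra in which
vanishing of a coordinate is tested on entries, so `norm_snd_le_of_closed` applies. If `G` is the
graph of a *-homomorphism, this is the contractivity of its matrix amplifications. -/
theorem norm_le_of_entry {F : Type*} [Fintype F] (G : NonUnitalStarSubalgebra ℂ (Op ι × Op ι'))
    (hG : IsClosed (G : Set (Op ι × Op ι'))) (h : ∀ g ∈ G, g.1 = 0 → g.2 = 0)
    (p : Op (ι × F) × Op (ι' × F)) (hp : ∀ k l, (entry k l p.1, entry k l p.2) ∈ G) :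
    ‖p.2‖ ≤ ‖p.1‖ := by
  refine norm_snd_le_of_closed (entryAlgebra F G) ?_ ?_ p hp
  · have : ((entryAlgebra F G : NonUnitalStarSubalgebra ℂ _) : Set (Op (ι × F) × Op (ι' × F)))
        = ⋂ k, ⋂ l, (fun p => (entry k l p.1, entry k l p.2)) ⁻¹' (G : Set (Op ι × Op ι')) := by
      ext p
      simp only [Set.mem_iInter]
      rfl
    rw [this]
    exact isClosed_iInter fun k => isClosed_iInter fun l => hG.preimage
      (((continuous_entry k l).comp continuous_fst).prodMk
        ((continuous_entry k l).comp continuous_snd))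
  · intro d hd h0
    refine eq_zero_of_entry fun k l => h _ (hd k l) ?_
    simp [h0, entry_zero]

/-! #### Finite compressions -/

/-- The inclusion of `ι × F` into `ι × κ`. -/
def finEmb (ι : Type*) {κ : Type*} (F : Finset κ) : ι × F ↪ ι × κ :=
  (Function.Embedding.refl ι).prodMap (Function.Embedding.subtype (· ∈ F))

/-- The compression of an operator to `ℓ²(ι × F)`. -/
def compress (F : Finset κ) (T : Op (ι × κ)) : Op (ι × F) :=
  pull (finEmb ι F) ∘L T ∘L (push (finEmb ι F)).toContinuousLinearMap

theorem norm_pull_le (e : ι ↪ κ) (f : L2 κ) : ‖pull e f‖ ≤ ‖f‖ := by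
  have h : ‖pull e‖ ≤ 1 := by
    rw [pull, LinearIsometryEquiv.norm_map]
    exact (push e).norm_toContinuousLinearMap_le
  simpa using (pull e).le_of_opNorm_le h f

theorem compress_apply (F : Finset κ) (T : Op (ι × κ)) (f : L2 (ι × F)) :
    compress F T f = pull (finEmb ι F) (T (push (finEmb ι F) f)) := rfl

theorem norm_compress_le (F : Finset κ) (T : Op (ι × κ)) : ‖compress F T‖ ≤ ‖T‖ := by
  refine ContinuousLinearMap.opNorm_le_bound _ (norm_nonneg _) fun f => ?_
  rw [compress_apply, ← (push (finEmb ι F)).norm_map f]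
  exact (norm_pull_le _ _).trans (T.le_opNorm _)

theorem sliceEmb_trans_finEmb (F : Finset κ) (k : F) :
    (sliceEmb ι k).trans (finEmb ι F) = sliceEmb ι (k : κ) := by
  ext1 i
  rfl

theorem entry_compress (F : Finset κ) (k l : F) (T : Op (ι × κ)) :
    entry k l (compress F T) = entry (k : κ) (l : κ) T := by
  ext1 x
  rw [entry_apply, entry_apply, compress_apply, pull_pull, push_push, sliceEmb_trans_finEmb,
    sliceEmb_trans_finEmb]

/-- Pythagoras, `push e ∘ pull e` being the orthogonal projection onto the range of the isometry
`push e`. -/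
theorem norm_sub_push_pull (e : ι ↪ κ) (f : L2 κ) :
    ‖f - push e (pull e f)‖ ^ 2 = ‖f‖ ^ 2 - ‖pull e f‖ ^ 2 := by
  have h : inner ℂ f (push e (pull e f)) = inner ℂ (pull e f) (pull e f) :=
    (ContinuousLinearMap.adjoint_inner_left (push e).toContinuousLinearMap (pull e f) f).symm
  rw [@norm_sub_sq ℂ, h, LinearIsometry.norm_map, inner_self_eq_norm_sq]
  ring

theorem norm_sq_pull_finEmb (F : Finset κ) (f : L2 (ι × κ)) :
    ‖pull (finEmb ι F) f‖ ^ 2 = ∑ k ∈ F, ‖pull (sliceEmb ι k) f‖ ^ 2 := by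
  rw [← (hasSum_slice (pull (finEmb ι F) f)).tsum_eq, tsum_fintype,
    ← Finset.sum_coe_sort F fun k => ‖pull (sliceEmb ι k) f‖ ^ 2]
  refine Finset.sum_congr rfl fun k _ => ?_
  rw [pull_pull, sliceEmb_trans_finEmb]

open Filter Topology in
theorem tendsto_push_pull_finEmb (f : L2 (ι × κ)) :
    Tendsto (fun F : Finset κ => push (finEmb ι F) (pull (finEmb ι F) f)) atTop (𝓝 f) := by
  rw [tendsto_iff_norm_sub_tendsto_zero]
  have h1 : Tendsto (fun F : Finset κ => ‖f‖ ^ 2 - ‖pull (finEmb ι F) f‖ ^ 2) atTop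
      (𝓝 (‖f‖ ^ 2 - ‖f‖ ^ 2)) := by
    refine tendsto_const_nhds.sub ?_
    simp only [norm_sq_pull_finEmb]
    exact hasSum_slice f
  have h2 := h1.sqrt
  simp only [← norm_sub_push_pull, sub_self, Real.sqrt_zero] at h2
  simpa [norm_sub_rev, Real.sqrt_sq] using h2

open Filter Topology in
-- With `P_F` the projection onto `ℓ²(ι × F)`, the operators `P_F T P_F` converge strongly to `T`,
-- and a uniform bound passes to the limit.
theorem norm_le_of_compress {T : Op (ι × κ)} {C : ℝ} (hC : 0 ≤ C)
    (h : ∀ F : Finset κ, ‖compress F T‖ ≤ C) : ‖T‖ ≤ C := by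
  refine ContinuousLinearMap.opNorm_le_bound _ hC fun f => ?_
  let P : Finset κ → L2 (ι × κ) → L2 (ι × κ) :=
    fun F g => push (finEmb ι F) (pull (finEmb ι F) g)
  have hP : ∀ F g, ‖P F g‖ ≤ ‖g‖ := fun F g => by
    simpa [P] using norm_pull_le (finEmb ι F) g
  have h1 : Tendsto (fun F => P F (T (P F f))) atTop (𝓝 (T f)) := by
    have h2 : Tendsto (fun F => P F (T f)) atTop (𝓝 (T f)) := tendsto_push_pull_finEmb _
    have h3 : Tendsto (fun F => ‖T (P F f) - T f‖) atTop (𝓝 0) :=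
      tendsto_iff_norm_sub_tendsto_zero.1 ((T.continuous.tendsto _).comp
        (tendsto_push_pull_finEmb f))
    have h4 : Tendsto (fun F => P F (T (P F f) - T f)) atTop (𝓝 0) :=
      squeeze_zero_norm (fun F => hP F _) h3
    have h5 := h4.add h2
    rw [zero_add] at h5
    refine h5.congr fun F => ?_
    simp [P]
  refine le_of_tendsto h1.norm (Eventually.of_forall fun F => ?_)
  calc ‖P F (T (P F f))‖ = ‖compress F T (pull (finEmb ι F) f)‖ := (push _).norm_map _
    _ ≤ C * ‖pull (finEmb ι F) f‖ := (compress F T).le_of_opNorm_le (h F) _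
    _ ≤ C * ‖f‖ := mul_le_mul_of_nonneg_left (norm_pull_le _ _) hC

end Entries

/-! ### Tensor products of *-homomorphisms -/

section TensorMap

variable {ι κ ι' : Type*} {A : ConcreteCStar ι} {C : ConcreteCStar ι'}

/-- The graph of `f ⊗ id` on elementary tensors. -/
def tensorGraph (f : A →⋆ₙₐ[ℂ] C) (B : ConcreteCStar κ) : Set (Op (ι × κ) × Op (ι' × κ)) :=
  {p | ∃ (a : A) (b : B), p = (opTensor (A.op a) (B.op b), opTensor (C.op (f a)) (B.op b))}

theorem tensorGraph_mul (f : A →⋆ₙₐ[ℂ] C) (B : ConcreteCStar κ) :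
    ∀ x ∈ tensorGraph f B, ∀ y ∈ tensorGraph f B, x * y ∈ Submodule.span ℂ (tensorGraph f B) := by
  rintro _ ⟨a, b, rfl⟩ _ ⟨a', b', rfl⟩
  refine Submodule.subset_span ⟨a * a', b * b', ?_⟩
  rw [Prod.mk_mul_mk, opTensor_mul, opTensor_mul]
  simp only [map_mul]

theorem tensorGraph_star (f : A →⋆ₙₐ[ℂ] C) (B : ConcreteCStar κ) :
    ∀ x ∈ tensorGraph f B, star x ∈ Submodule.span ℂ (tensorGraph f B) := by
  rintro _ ⟨a, b, rfl⟩
  refine Submodule.subset_span ⟨star a, star b, ?_⟩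
  simp only [map_star, opTensor_star]
  rfl

theorem entry_mem_of_mem_span {G : NonUnitalStarSubalgebra ℂ (Op ι × Op ι')}
    {W : Set (Op (ι × κ) × Op (ι' × κ))} (k l : κ)
    (hW : ∀ d ∈ W, (entry k l d.1, entry k l d.2) ∈ G)
    {d : Op (ι × κ) × Op (ι' × κ)} (hd : d ∈ Submodule.span ℂ W) :
    (entry k l d.1, entry k l d.2) ∈ G := by
  induction hd using Submodule.span_induction with
  | mem x hx => exact hW x hx
  | zero =>
    simp only [Prod.fst_zero, Prod.snd_zero, entry_zero]
    exact zero_mem G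
  | add x y _ _ hx hy =>
    simp only [Prod.fst_add, Prod.snd_add, entry_add]
    rw [← Prod.mk_add_mk]
    exact add_mem hx hy
  | smul c x _ hx =>
    simp only [Prod.smul_fst, Prod.smul_snd, entry_smul]
    rw [← Prod.smul_mk]
    exact SMulMemClass.smul_mem c hx

/-- For `∑ a_i ⊗ b_i` and `∑ f(a_i) ⊗ b_i` the entries are the same linear combination, of the `a_i`
and of the `f(a_i)` respectively, with the entries of the `b_i` as coefficients. Each pair of
entries therefore lies in the graph of `f`. -/
theorem entry_tensorGraph (f : A →⋆ₙₐ[ℂ] C) (B : ConcreteCStar κ)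
    {d : Op (ι × κ) × Op (ι' × κ)} (hd : d ∈ Submodule.span ℂ (tensorGraph f B)) (k l : κ) :
    (entry k l d.1, entry k l d.2) ∈
      NonUnitalStarAlgHom.range (NonUnitalStarAlgHom.prod A.op (C.op.comp f)) := by
  classical
  refine entry_mem_of_mem_span k l ?_ hd
  rintro _ ⟨a, b, rfl⟩
  refine ⟨B.op b (lp.single 2 l 1) k • a, ?_⟩
  simp only [entry_opTensor]
  exact Prod.ext (map_smul A.op _ a) (map_smul (C.op.comp f) _ a)

/-- Complete contractivity: compressed to finitely many slices, `f ⊗ id` acts as a matrix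
amplification of `f`, which is contractive, and finite compressions compute the norm. The bound also
shows that `f ⊗ id` is well defined on sums of elementary tensors. -/
theorem norm_le_of_mem_tensorGraph (f : A →⋆ₙₐ[ℂ] C) (B : ConcreteCStar κ)
    {d : Op (ι × κ) × Op (ι' × κ)} (hd : d ∈ Submodule.span ℂ (tensorGraph f B)) :
    ‖d.2‖ ≤ ‖d.1‖ := by
  have hγ : Function.Injective (NonUnitalStarAlgHom.prod A.op (C.op.comp f)) :=
    fun a a' h => A.op_injective (congrArg Prod.fst h)
  have hγ0 : ∀ g ∈ NonUnitalStarAlgHom.range (NonUnitalStarAlgHom.prod A.op (C.op.comp f)),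
      g.1 = 0 → g.2 = 0 := by
    rintro _ ⟨a, rfl⟩ h
    have : a = 0 := A.op_injective (h.trans (map_zero A.op).symm)
    subst this
    exact map_zero (C.op.comp f)
  refine norm_le_of_compress (norm_nonneg _) fun F => ?_
  refine (norm_le_of_entry (F := F) _ (isClosed_range_hom _ hγ) hγ0 (compress F d.1, compress F d.2)
    fun k l => ?_).trans (norm_compress_le F d.1)
  simp only [entry_compress]
  exact entry_tensorGraph f B hd k l

theorem exists_tensorMap (f : A →⋆ₙₐ[ℂ] C) (B : ConcreteCStar κ) :
    ∃ g : spatialTensor A B →⋆ₙₐ[ℂ] spatialTensor C B, ∀ a b, g (tmul a b) = tmul (f a) b := by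
  obtain ⟨h, hh⟩ := exists_hom_of_graph
    (S := {T | ∃ (a : A) (b : B), T = opTensor (A.op a) (B.op b)})
    (spanStar _ (tensorGraph_mul f B) (tensorGraph_star f B))
    (fun d hd => norm_le_of_mem_tensorGraph f B hd) (by
    rintro _ ⟨a, b, rfl⟩
    exact ⟨_, Submodule.subset_span ⟨a, b, rfl⟩⟩)
  have hh' : ∀ (a : A) (b : B), h (tmul a b : spatialTensor A B) = opTensor (C.op (f a)) (B.op b) := by
    intro a b
    refine hh (tmul a b : spatialTensor A B) _ (Submodule.subset_span ⟨a, b, Prod.ext ?_ rfl⟩)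
    exact op_tmul a b
  obtain ⟨g, hg⟩ := exists_cstarGen_lift (spatialTensor C B).op (spatialTensor C B).op_injective h
    (by
      intro t ht
      obtain ⟨a, b, rfl⟩ := spatialTensor_generator (t := t) ht
      exact ⟨tmul (f a) b, (op_tmul (f a) b).trans (hh' a b).symm⟩)
  exact ⟨g, fun a b => (spatialTensor C B).op_injective
    ((hg (tmul a b : spatialTensor A B)).trans ((hh' a b).trans (op_tmul (f a) b).symm))⟩

/-- The *-homomorphism `f ⊗ id`. -/
def tensorMap (f : A →⋆ₙₐ[ℂ] C) (B : ConcreteCStar κ) :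
    spatialTensor A B →⋆ₙₐ[ℂ] spatialTensor C B := (exists_tensorMap f B).choose

@[simp] theorem tensorMap_tmul (f : A →⋆ₙₐ[ℂ] C) (B : ConcreteCStar κ) (a : A) (b : B) :
    tensorMap f B (tmul a b) = tmul (f a) b := (exists_tensorMap f B).choose_spec a b

theorem exists_flip (A : ConcreteCStar ι) (B : ConcreteCStar κ) :
    ∃ g : spatialTensor A B →⋆ₙₐ[ℂ] spatialTensor B A, ∀ a b, g (tmul a b) = tmul b a := by
  obtain ⟨g, hg⟩ := exists_spatial_hom (A := spatialTensor B A)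
    (S := {T | ∃ (a : A) (b : B), T = opTensor (A.op a) (B.op b)})
    (extendHom (Equiv.prodComm ι κ).toEmbedding) (by
      rintro _ ⟨a, b, rfl⟩
      exact ⟨tmul b a, by rw [op_tmul, extendHom_apply, extendOp_prodComm]⟩)
  refine ⟨g, fun a b => (spatialTensor B A).op_injective ?_⟩
  rw [op_tmul]
  refine (hg (tmul a b : spatialTensor A B)).trans ?_
  exact (congrArg _ (op_tmul a b)).trans (extendOp_prodComm _ _)

/-- The *-homomorphism `id ⊗ f`. -/
def tensorMapRight (B : ConcreteCStar κ) (f : A →⋆ₙₐ[ℂ] C) :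
    spatialTensor B A →⋆ₙₐ[ℂ] spatialTensor B C :=
  ((exists_flip C B).choose.comp (tensorMap f B)).comp (exists_flip B A).choose

@[simp] theorem tensorMapRight_tmul (B : ConcreteCStar κ) (f : A →⋆ₙₐ[ℂ] C) (b : B) (a : A) :
    tensorMapRight B f (tmul b a) = tmul b (f a) := by
  rw [tensorMapRight, NonUnitalStarAlgHom.comp_apply, NonUnitalStarAlgHom.comp_apply,
    (exists_flip B A).choose_spec, tensorMap_tmul, (exists_flip C B).choose_spec]

end TensorMap

/-! ### Multipliers -/

section Multiplier

variable {A L : Type*} [NonUnitalCStarAlgebra A] [NonUnitalCStarAlgebra L]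

theorem eq_of_mul_left_eq {x y : A} (h : ∀ a : A, a * x = a * y) : x = y := by
  have h1 := h (star (x - y))
  rw [← sub_eq_zero, ← mul_sub, CStarRing.star_mul_self_eq_zero_iff] at h1
  exact sub_eq_zero.1 h1

theorem eq_of_mul_right_eq {x y : A} (h : ∀ a : A, x * a = y * a) : x = y := by
  have h1 := h (star (x - y))
  rw [← sub_eq_zero, ← sub_mul, CStarRing.mul_star_self_eq_zero_iff] at h1
  exact sub_eq_zero.1 h1

/-- After left multiplication by an arbitrary `a`, the relation `central` moves `m` onto `a`, where
both sides agree; left multiplications separate the points of a C*-algebra. -/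
theorem multiplier_fst_mul (m : 𝓜(ℂ, A)) (x y : A) : m.fst (x * y) = m.fst x * y :=
  eq_of_mul_left_eq fun a => by
    rw [← m.central, ← mul_assoc, ← mul_assoc, m.central]

/-- Through `central`, the left part of a double centralizer determines all products `m.snd x * a`,
and thus the right part. -/
theorem multiplier_ext {m m' : 𝓜(ℂ, A)} (h : ∀ x, m.fst x = m'.fst x) : m = m' := by
  refine DoubleCentralizer.ext _ _ _ _ (Prod.ext (ContinuousLinearMap.ext h)
    (ContinuousLinearMap.ext fun x => eq_of_mul_right_eq fun a => ?_))
  rw [m.central, m'.central, h]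

variable (π : A →⋆ₙₐ[ℂ] L) (hπ : Function.Injective π)

/-- Left multiplication by an element of `L` on an ideal. -/
def idealMul (h : ∀ l a, l * π a ∈ Set.range π) (l : L) : A →L[ℂ] A :=
  LinearMap.mkContinuous
    { toFun := fun a => (h l a).choose
      map_add' := fun a b => hπ <| by
        rw [(h _ _).choose_spec, map_add, map_add, (h l a).choose_spec, (h l b).choose_spec,
          mul_add]
      map_smul' := fun c a => hπ <| by
        rw [(h _ _).choose_spec, map_smul, map_smul, (h l a).choose_spec, mul_smul_comm]
        rfl } ‖l‖ fun a => by
    rw [← NonUnitalStarAlgHom.norm_map π hπ]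
    refine (congrArg norm (h l a).choose_spec).le.trans ((norm_mul_le _ _).trans ?_)
    rw [NonUnitalStarAlgHom.norm_map π hπ]

theorem idealMul_spec (h : ∀ l a, l * π a ∈ Set.range π) (l : L) (a : A) :
    π (idealMul π hπ h l a) = l * π a := (h l a).choose_spec

/-- The range of `π` is self-adjoint, so as a left ideal it is also a right ideal. The formula
supplies the right part of the multiplier. -/
theorem ideal_right (h : ∀ l a, l * π a ∈ Set.range π) (l : L) (a : A) :
    π (star (idealMul π hπ h (star l) (star a))) = π a * l := by
  rw [map_star, idealMul_spec, map_star, star_mul, star_star, star_star]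

/-- An algebra acts on its ideals by multipliers. -/
def idealMultiplier (h : ∀ l a, l * π a ∈ Set.range π) (l : L) : 𝓜(ℂ, A) where
  fst := idealMul π hπ h l
  snd := LinearMap.mkContinuous
    { toFun := fun a => star (idealMul π hπ h (star l) (star a))
      map_add' := fun a b => by simp
      map_smul' := fun c a => by simp } ‖idealMul π hπ h (star l)‖ fun a => by
    simpa using (idealMul π hπ h (star l)).le_opNorm (star a)
  central x y := hπ <| by
    change π (star (idealMul π hπ h (star l) (star x)) * y) = π (x * idealMul π hπ h l y)
    rw [map_mul, map_mul, ideal_right, idealMul_spec, mul_assoc]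

theorem idealMultiplier_fst (h : ∀ l a, l * π a ∈ Set.range π) (l : L) (a : A) :
    π ((idealMultiplier π hπ h l).fst a) = l * π a := idealMul_spec π hπ h l a

theorem idealMultiplier_snd (h : ∀ l a, l * π a ∈ Set.range π) (l : L) (a : A) :
    π ((idealMultiplier π hπ h l).snd a) = π a * l := ideal_right π hπ h l a

/-- `idealMultiplier` as a *-homomorphism. -/
def idealHom (h : ∀ l a, l * π a ∈ Set.range π) : L →⋆ₙₐ[ℂ] 𝓜(ℂ, A) where
  toFun := idealMultiplier π hπ h
  map_smul' c l := multiplier_ext fun x => hπ <| by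
    rw [MonoidHom.id_apply, DoubleCentralizer.smul_fst, idealMultiplier_fst,
      _root_.smul_apply, map_smul, idealMultiplier_fst, smul_mul_assoc]
  map_zero' := multiplier_ext fun x => hπ <| by
    rw [idealMultiplier_fst, zero_mul, DoubleCentralizer.zero_fst, _root_.zero_apply,
      map_zero]
  map_add' l l' := multiplier_ext fun x => hπ <| by
    rw [idealMultiplier_fst, DoubleCentralizer.add_fst, _root_.add_apply, map_add,
      idealMultiplier_fst, idealMultiplier_fst, add_mul]
  map_mul' l l' := multiplier_ext fun x => hπ <| by
    rw [idealMultiplier_fst, DoubleCentralizer.mul_fst]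
    refine Eq.trans ?_ (idealMultiplier_fst π hπ h l _).symm
    rw [mul_assoc]
    exact congrArg (l * ·) (idealMultiplier_fst π hπ h l' x).symm
  map_star' l := multiplier_ext fun x => hπ <| by
    rw [idealMultiplier_fst, DoubleCentralizer.star_fst, map_star, idealMultiplier_snd, map_star,
      star_mul, star_star]

end Multiplier

/-! ### Decompositions into unital blocks -/

/-- A C*-algebra as the C*-direct sum of unital blocks, placed on orthogonal subspaces. -/
structure Blocks.{u, v, w} {K : Type u} (A : ConcreteCStar K) {J : Type w} {κ : J → Type v}
    (A' : ∀ j, ConcreteCStar (κ j)) where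
  /-- the inclusions of the index sets -/
  emb : ∀ j, κ j ↪ K
  /-- the inclusions of the blocks -/
  incl : ∀ j, A' j →⋆ₙₐ[ℂ] A
  op_incl : ∀ j x, A.op (incl j x) = extendOp (emb j) ((A' j).op x)
  disjoint : ∀ i j, i ≠ j → ∀ x y, emb i x ≠ emb j y
  dense : Dense (Submodule.span ℂ {t : A | ∃ j x, t = incl j x} : Set A)
  /-- the units of the blocks -/
  unit : ∀ j, A' j
  op_unit : ∀ j, (A' j).op (unit j) = 1

namespace Blocks

variable {K J : Type*} {κ : J → Type*} {A : ConcreteCStar K} {A' : ∀ j, ConcreteCStar (κ j)}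
  (β : Blocks A A')

include β in
theorem incl_injective (j : J) : Function.Injective (β.incl j) := by
  intro x y h
  apply (A' j).op_injective
  apply extendOp_injective (β.emb j)
  rw [← β.op_incl, ← β.op_incl, h]

theorem unit_mul (j : J) (x : A' j) : β.unit j * x = x :=
  (A' j).op_injective (by rw [map_mul, β.op_unit, one_mul])

theorem mul_unit (j : J) (x : A' j) : x * β.unit j = x :=
  (A' j).op_injective (by rw [map_mul, β.op_unit, mul_one])

theorem star_unit (j : J) : star (β.unit j) = β.unit j :=
  (A' j).op_injective (by rw [map_star, β.op_unit, star_one])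

theorem star_incl_unit (j : J) : star (β.incl j (β.unit j)) = β.incl j (β.unit j) := by
  rw [← map_star, β.star_unit]

theorem incl_mul_incl {i j : J} (h : i ≠ j) (x : A' i) (y : A' j) :
    β.incl i x * β.incl j y = 0 := by
  apply A.op_injective
  rw [map_mul, β.op_incl, β.op_incl, extendOp_mul_of_disjoint _ _ (β.disjoint i j h), map_zero]

/-- Right multiplication by the unit of block `j` fixes that block and kills the others. As the
block is closed and the blocks span a dense subspace, it maps all of `A` into block `j`. -/
theorem mul_incl_unit_mem (j : J) (a : A) :
    a * β.incl j (β.unit j) ∈ Set.range (β.incl j) := by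
  let R : A →L[ℂ] A := (ContinuousLinearMap.mul ℂ A).flip (β.incl j (β.unit j))
  let Q : Submodule ℂ A :=
    (NonUnitalStarAlgHom.range (β.incl j)).toSubmodule.comap R.toLinearMap
  have hQ : IsClosed (Q : Set A) :=
    (isClosed_range_hom _ (β.incl_injective j)).preimage R.continuous
  have hle : Submodule.span ℂ {t : A | ∃ j x, t = β.incl j x} ≤ Q := by
    refine Submodule.span_le.2 ?_
    rintro _ ⟨i, x, rfl⟩
    change β.incl i x * β.incl j (β.unit j) ∈ Set.range (β.incl j)
    by_cases h : i = j
    · subst h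
      exact ⟨x, by rw [← map_mul, β.mul_unit]⟩
    · exact ⟨0, by rw [β.incl_mul_incl h, map_zero]⟩
  exact closure_minimal hle hQ (β.dense a)

/-- For the block unit `u` one has `m u = m (u u) = (m u) u`, which lies in the block by the
preceding lemma. -/
theorem fst_incl_unit_mem (m : 𝓜(ℂ, A)) (j : J) :
    m.fst (β.incl j (β.unit j)) ∈ Set.range (β.incl j) := by
  have h := β.mul_incl_unit_mem j (m.fst (β.incl j (β.unit j)))
  rwa [← multiplier_fst_mul, ← map_mul, β.unit_mul] at h

/-- Block units are central among multipliers: `u m` and `m u` both lie in the block, where `u` is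
neutral, and `(u m) u = u (m u)`. This is why `comp` respects adjoints. -/
theorem snd_incl_unit (m : 𝓜(ℂ, A)) (j : J) :
    m.snd (β.incl j (β.unit j)) = m.fst (β.incl j (β.unit j)) := by
  have h1 : m.snd (β.incl j (β.unit j)) ∈ Set.range (β.incl j) := by
    obtain ⟨y, hy⟩ := β.fst_incl_unit_mem (star m) j
    rw [DoubleCentralizer.star_fst, β.star_incl_unit] at hy
    exact ⟨star y, by rw [map_star, hy, star_star]⟩
  obtain ⟨x, hx⟩ := β.fst_incl_unit_mem m j
  obtain ⟨y, hy⟩ := h1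
  have := m.central (β.incl j (β.unit j)) (β.incl j (β.unit j))
  rwa [← hx, ← hy, ← map_mul, ← map_mul, β.mul_unit, β.unit_mul, hx, hy] at this

/-- The component of a multiplier at a block. -/
def comp (j : J) : 𝓜(ℂ, A) →⋆ₙₐ[ℂ] A' j where
  toFun m := (β.fst_incl_unit_mem m j).choose
  map_smul' c m := β.incl_injective j <| by
    rw [(β.fst_incl_unit_mem _ j).choose_spec, map_smul, MonoidHom.id_apply,
      (β.fst_incl_unit_mem m j).choose_spec]
    rfl
  map_zero' := β.incl_injective j <| by
    rw [(β.fst_incl_unit_mem _ j).choose_spec, map_zero]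
    rfl
  map_add' m m' := β.incl_injective j <| by
    rw [(β.fst_incl_unit_mem _ j).choose_spec, map_add,
      (β.fst_incl_unit_mem m j).choose_spec, (β.fst_incl_unit_mem m' j).choose_spec]
    rfl
  map_mul' m m' := β.incl_injective j <| by
    rw [(β.fst_incl_unit_mem _ j).choose_spec, map_mul,
      (β.fst_incl_unit_mem m j).choose_spec, (β.fst_incl_unit_mem m' j).choose_spec,
      ← multiplier_fst_mul]
    obtain ⟨y, hy⟩ := β.fst_incl_unit_mem m' j
    rw [← hy, ← map_mul, β.unit_mul, hy]
    rfl
  map_star' m := β.incl_injective j <| by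
    rw [(β.fst_incl_unit_mem _ j).choose_spec, map_star,
      (β.fst_incl_unit_mem m j).choose_spec, DoubleCentralizer.star_fst, β.star_incl_unit,
      β.snd_incl_unit]

theorem incl_comp (m : 𝓜(ℂ, A)) (j : J) : β.incl j (β.comp j m) = m.fst (β.incl j (β.unit j)) :=
  (β.fst_incl_unit_mem m j).choose_spec

theorem fst_incl (m : 𝓜(ℂ, A)) (j : J) (y : A' j) :
    m.fst (β.incl j y) = β.incl j (β.comp j m * y) := by
  rw [map_mul, incl_comp, ← multiplier_fst_mul, ← map_mul, β.unit_mul]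

theorem comp_eq_of_fst {m : 𝓜(ℂ, A)} {j : J} {x : A' j}
    (h : m.fst (β.incl j (β.unit j)) = β.incl j (x * β.unit j)) : β.comp j m = x :=
  β.incl_injective j (by rw [incl_comp, h, β.mul_unit])

theorem comp_one (j : J) : β.comp j 1 = β.unit j :=
  β.comp_eq_of_fst (by rw [β.mul_unit]; rfl)

theorem ext_comp {m m' : 𝓜(ℂ, A)} (h : ∀ j, β.comp j m = β.comp j m') : m = m' := by
  have : m.fst = m'.fst := eq_of_dense_span β.dense (by
    rintro _ ⟨j, x, rfl⟩
    rw [fst_incl, fst_incl, h])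
  exact multiplier_ext fun x => by rw [this]

/-- The component of an element at a block. -/
def compA (j : J) : A →⋆ₙₐ[ℂ] A' j := (β.comp j).comp DoubleCentralizer.coeHom

theorem comp_coe (j : J) (a : A) : β.comp j (DoubleCentralizer.coe ℂ a) = β.compA j a := rfl

theorem mul_incl (j : J) (a : A) (y : A' j) : a * β.incl j y = β.incl j (β.compA j a * y) :=
  β.fst_incl (DoubleCentralizer.coe ℂ a) j y

theorem compA_incl (j : J) (x : A' j) : β.compA j (β.incl j x) = x :=
  β.comp_eq_of_fst (map_mul (β.incl j) x (β.unit j)).symm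

theorem compA_incl_of_ne {i j : J} (h : i ≠ j) (x : A' i) : β.compA j (β.incl i x) = 0 := by
  refine β.comp_eq_of_fst ?_
  rw [zero_mul, map_zero]
  exact β.incl_mul_incl h x (β.unit j)

theorem compA_injective {a : A} (h : ∀ j, β.compA j a = 0) : a = 0 :=
  eq_zero_of_mul_dense β.dense (by
    rintro _ ⟨j, x, rfl⟩
    rw [mul_incl, h, zero_mul, map_zero])

open scoped ENNReal in
/-- A family of *-homomorphisms into the blocks as a *-homomorphism into their product. -/
def toLp {B : Type*} [NonUnitalCStarAlgebra B] (ψ : ∀ j, B →⋆ₙₐ[ℂ] A' j) :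
    B →⋆ₙₐ[ℂ] lp (fun j => (A' j).Elem) ∞ where
  toFun x := ⟨fun j => ψ j x, memℓp_infty ⟨‖x‖, by
    rintro _ ⟨j, rfl⟩
    exact NonUnitalStarAlgHom.norm_apply_le (ψ j) x⟩⟩
  map_smul' c x := by
    ext j
    exact map_smul (ψ j) c x
  map_zero' := by
    ext j
    exact map_zero (ψ j)
  map_add' x y := by
    ext j
    exact map_add (ψ j) x y
  map_mul' x y := by
    ext j
    exact map_mul (ψ j) x y
  map_star' x := by
    ext j
    exact map_star (ψ j) x

theorem toLp_apply {B : Type*} [NonUnitalCStarAlgebra B] (ψ : ∀ j, B →⋆ₙₐ[ℂ] A' j) (x : B) (j : J) :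
    toLp ψ x j = ψ j x := rfl

theorem toLp_compA_injective : Function.Injective (toLp β.compA) := by
  rw [injective_iff_map_eq_zero]
  intro a ha
  refine β.compA_injective fun j => ?_
  rw [← toLp_apply β.compA, ha]
  rfl

open scoped ENNReal in
-- `A` sits in the bounded product of its blocks as their `c₀`-sum. A bounded family times an
-- element of one block stays in that block, and density together with the closed range extends this
-- to `A`. Hence `A` is an ideal and the product acts on it by multipliers.
theorem mul_toLp_compA_mem (l : lp (fun j => (A' j).Elem) ∞) (a : A) :
    l * toLp β.compA a ∈ Set.range (toLp β.compA) := by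
  let R : A → lp (fun j => (A' j).Elem) ∞ := fun a => l * toLp β.compA a
  have hR : Continuous R := continuous_const.mul (continuous_hom _)
  let Q : Submodule ℂ A :=
    (NonUnitalStarAlgHom.range (toLp β.compA)).toSubmodule.comap
      ((ContinuousLinearMap.mul ℂ (lp (fun j => (A' j).Elem) ∞) l).toLinearMap ∘ₗ
        ((toLp β.compA : A →ₗ[ℂ] lp (fun j => (A' j).Elem) ∞)))
  have hQ : IsClosed (Q : Set A) :=
    (isClosed_range_hom _ β.toLp_compA_injective).preimage hR
  have hle : Submodule.span ℂ {t : A | ∃ j x, t = β.incl j x} ≤ Q := by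
    refine Submodule.span_le.2 ?_
    rintro _ ⟨i, x, rfl⟩
    refine ⟨β.incl i (l i * x), ?_⟩
    ext j
    change β.compA j (β.incl i (l i * x)) = l j * β.compA j (β.incl i x)
    by_cases h : i = j
    · subst h
      rw [compA_incl, compA_incl]
    · rw [β.compA_incl_of_ne h, β.compA_incl_of_ne h, mul_zero]
  exact closure_minimal hle hQ (β.dense a)

/-- The *-homomorphism into the multiplier algebra with given components. -/
def family {B : Type*} [NonUnitalCStarAlgebra B] (ψ : ∀ j, B →⋆ₙₐ[ℂ] A' j) : B →⋆ₙₐ[ℂ] 𝓜(ℂ, A) :=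
  (idealHom (toLp β.compA) β.toLp_compA_injective β.mul_toLp_compA_mem).comp (toLp ψ)

/-- Together with `ext_comp` this identifies *-homomorphisms into `𝓜(ℂ, A)` with families of
*-homomorphisms into the blocks: existence here, uniqueness there. -/
theorem comp_family {B : Type*} [NonUnitalCStarAlgebra B] (ψ : ∀ j, B →⋆ₙₐ[ℂ] A' j) (x : B)
    (j : J) : β.comp j (β.family ψ x) = ψ j x := by
  have h := idealMultiplier_fst (toLp β.compA) β.toLp_compA_injective β.mul_toLp_compA_mem
    (toLp ψ x) (β.incl j (β.unit j))
  have h1 := congrArg (fun l => l j) h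
  change β.compA j ((β.family ψ x).fst (β.incl j (β.unit j)))
    = ψ j x * β.compA j (β.incl j (β.unit j)) at h1
  rwa [fst_incl, compA_incl, compA_incl, β.mul_unit, β.mul_unit] at h1

end Blocks

/-- A *-homomorphism as a continuous linear map. -/
def homL {A B : Type*} [NonUnitalCStarAlgebra A] [NonUnitalCStarAlgebra B] (f : A →⋆ₙₐ[ℂ] B) :
    A →L[ℂ] B := ⟨(f : A →ₗ[ℂ] B), continuous_hom f⟩

theorem extendOp_refl {ι : Type*} (T : Op ι) : extendOp (Function.Embedding.refl ι) T = T :=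
  (extendOp_trans (Function.Embedding.refl ι) (Function.Embedding.refl ι) T).symm.trans
    (extendOp_symm_extendOp (Equiv.refl ι) T)

theorem exists_inclTensor {ι κ ι' κ' : Type*} {A : ConcreteCStar ι} {B : ConcreteCStar κ}
    {A' : ConcreteCStar ι'} {B' : ConcreteCStar κ'} {e : ι' ↪ ι} {e' : κ' ↪ κ}
    {f : A' →⋆ₙₐ[ℂ] A} {g : B' →⋆ₙₐ[ℂ] B} (hf : ∀ x, A.op (f x) = extendOp e (A'.op x))
    (hg : ∀ x, B.op (g x) = extendOp e' (B'.op x)) :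
    ∃ h : spatialTensor A' B' →⋆ₙₐ[ℂ] spatialTensor A B,
      (∀ x, (spatialTensor A B).op (h x)
        = extendOp (e.prodMap e') ((spatialTensor A' B').op x)) ∧
      ∀ a b, h (tmul a b) = tmul (f a) (g b) := by
  obtain ⟨h, hh⟩ := exists_spatial_hom (A := spatialTensor A B)
    (S := {T | ∃ (a : A') (b : B'), T = opTensor (A'.op a) (B'.op b)})
    (extendHom (e.prodMap e')) (by
      rintro _ ⟨a, b, rfl⟩
      refine ⟨tmul (f a) (g b), ?_⟩
      rw [op_tmul, hf, hg, extendHom_apply, extendOp_opTensor])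
  have hh' : ∀ x : spatialTensor A' B', (spatialTensor A B).op (h x)
      = extendOp (e.prodMap e') ((spatialTensor A' B').op x) := hh
  refine ⟨h, hh', fun a b => (spatialTensor A B).op_injective ?_⟩
  rw [op_tmul, hf, hg, ← extendOp_opTensor, ← op_tmul]
  exact hh' _

namespace Blocks

/-- A unital C*-algebra as its only block. -/
def single {K : Type*} (A : ConcreteCStar K) (u : A) (hu : A.op u = 1) :
    Blocks A (fun _ : Unit => A) where
  emb _ := Function.Embedding.refl K
  incl _ := NonUnitalStarAlgHom.id ℂ A
  op_incl _ x := (extendOp_refl _).symm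
  disjoint i j h := (h (Subsingleton.elim i j)).elim
  dense := by
    have : {t : A | ∃ (j : Unit) (x : A), t = NonUnitalStarAlgHom.id ℂ A x} = Set.univ :=
      Set.eq_univ_of_forall fun x => ⟨(), x, rfl⟩
    rw [this, Submodule.span_univ]
    exact dense_univ
  unit _ := u
  op_unit _ := hu

/-- The blocks of a direct sum. -/
def ofDirectSum {J : Type*} {κ : J → Type*} (A : ∀ j, ConcreteCStar (κ j)) (u : ∀ j, A j)
    (hu : ∀ j, (A j).op (u j) = 1) : Blocks (directSum A) A where
  emb := sigmaEmb κ
  incl := summandHom A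
  op_incl j x := by rw [summandHom_apply, op_summand]
  disjoint i j h := sigmaEmb_ne h
  dense := by
    simp only [summandHom_apply]
    exact dense_span_summand A
  unit := u
  op_unit := hu

/-! ### Tensor products of block decompositions. -/

section Tensor

variable {K J K₂ J₂ : Type*} {κ : J → Type*} {κ₂ : J₂ → Type*}
  {A : ConcreteCStar K} {A' : ∀ j, ConcreteCStar (κ j)}
  {B : ConcreteCStar K₂} {B' : ∀ j, ConcreteCStar (κ₂ j)}
  (β : Blocks A A') (γ : Blocks B B')

/-- The blocks of a tensor product. -/
def tensor : Blocks (spatialTensor A B)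
    (fun p : J × J₂ => spatialTensor (A' p.1) (B' p.2)) where
  emb p := (β.emb p.1).prodMap (γ.emb p.2)
  incl p := (exists_inclTensor (β.op_incl p.1) (γ.op_incl p.2)).choose
  op_incl p := (exists_inclTensor (β.op_incl p.1) (γ.op_incl p.2)).choose_spec.1
  disjoint p q h x y hxy := by
    by_cases h1 : p.1 = q.1
    · exact γ.disjoint p.2 q.2 (fun h2 => h (Prod.ext h1 h2)) x.2 y.2 (congrArg Prod.snd hxy)
    · exact β.disjoint p.1 q.1 h1 x.1 y.1 (congrArg Prod.fst hxy)
  dense := by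
    refine (dense_span_tmul_of_dense β.dense γ.dense).mono (Submodule.span_mono ?_)
    rintro _ ⟨_, ⟨j, x, rfl⟩, _, ⟨k, y, rfl⟩, rfl⟩
    exact ⟨(j, k), tmul x y,
      ((exists_inclTensor (β.op_incl j) (γ.op_incl k)).choose_spec.2 x y).symm⟩
  unit p := tmul (β.unit p.1) (γ.unit p.2)
  op_unit p := by rw [op_tmul, β.op_unit, γ.op_unit, opTensor_one]

theorem tensor_incl_tmul (p : J × J₂) (x : A' p.1) (y : B' p.2) :
    (β.tensor γ).incl p (tmul x y) = tmul (β.incl p.1 x) (γ.incl p.2 y) :=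
  (exists_inclTensor (β.op_incl p.1) (γ.op_incl p.2)).choose_spec.2 x y

theorem tensor_compA_tmul (p : J × J₂) (a : A) (b : B) :
    (β.tensor γ).compA p (tmul a b) = tmul (β.compA p.1 a) (γ.compA p.2 b) := by
  apply (β.tensor γ).incl_injective p
  have h := (β.tensor γ).mul_incl p (tmul a b) ((β.tensor γ).unit p)
  rw [(β.tensor γ).mul_unit] at h
  rw [← h, tensor_incl_tmul]
  change tmul a b * (β.tensor γ).incl p (tmul (β.unit p.1) (γ.unit p.2)) = _
  rw [tensor_incl_tmul, tmul_mul_tmul, β.mul_incl, γ.mul_incl, β.mul_unit, γ.mul_unit]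

end Tensor

/-- A homomorphism into `𝓜(ℂ, B)` may be prescribed on components; the unit condition `hg` is what
makes the result unital. -/
theorem exists_familyOne {K J K₂ J₂ : Type*} {κ : J → Type*} {κ₂ : J₂ → Type*}
    {A : ConcreteCStar K} {A' : ∀ j, ConcreteCStar (κ j)}
    {B : ConcreteCStar K₂} {B' : ∀ j, ConcreteCStar (κ₂ j)}
    (β : Blocks A A') (γ : Blocks B B') (σ : J₂ → J) (g : ∀ j, A' (σ j) →⋆ₙₐ[ℂ] B' j)
    (hg : ∀ j, g j (β.unit (σ j)) = γ.unit j) :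
    ∃ Θ : 𝓜(ℂ, A) →⋆ₐ[ℂ] 𝓜(ℂ, B), ∀ m j, γ.comp j (Θ m) = g j (β.comp (σ j) m) := by
  let Ψ := γ.family fun j => (g j).comp (β.comp (σ j))
  have hΨ : ∀ m j, γ.comp j (Ψ m) = g j (β.comp (σ j) m) := fun m j => γ.comp_family _ m j
  have h1 : Ψ 1 = 1 := γ.ext_comp fun j => by
    rw [hΨ, β.comp_one, γ.comp_one, hg]
  refine ⟨{ toFun := Ψ
            map_one' := h1
            map_mul' := map_mul Ψ
            map_zero' := map_zero Ψ
            map_add' := map_add Ψ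
            map_star' := map_star Ψ
            commutes' := fun c => ?_ }, hΨ⟩
  rw [Algebra.algebraMap_eq_smul_one, map_smul, h1, ← Algebra.algebraMap_eq_smul_one]

/-! ### Extension of `f ⊗ id` and `id ⊗ f` to multiplier algebras, and associativity by components.
-/

section Extension

variable {K J K₂ J₂ K₃ J₃ : Type*} {κ : J → Type*} {κ₂ : J₂ → Type*} {κ₃ : J₃ → Type*}
  {A : ConcreteCStar K} {A' : ∀ j, ConcreteCStar (κ j)}
  {C : ConcreteCStar K₂} {C' : ∀ j, ConcreteCStar (κ₂ j)}
  {B : ConcreteCStar K₃} {B' : ∀ j, ConcreteCStar (κ₃ j)}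
  (β : Blocks A A') (γ : Blocks C C') (δ : Blocks B B')

/-- Hypothesis `hf` says that the component of `f` at `j` sees only the component of its argument at
`σ j`. It holds for `Δ_φ` with `σ (a, b) = a·b` and for `Γ_φ` with constant `σ`. The extension can
then be prescribed at the block `(j, k)` as `g j ⊗ id` of the component at `(σ j, k)`. -/
theorem exists_tensorId (σ : J₂ → J) (g : ∀ j, A' (σ j) →⋆ₙₐ[ℂ] C' j)
    (hg : ∀ j, g j (β.unit (σ j)) = γ.unit j) (f : A →⋆ₙₐ[ℂ] 𝓜(ℂ, C))
    (hf : ∀ a j, γ.comp j (f a) = g j (β.compA (σ j) a)) :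
    ∃ Θ : 𝓜(ℂ, spatialTensor A B) →⋆ₐ[ℂ] 𝓜(ℂ, spatialTensor C B), IsTensorId B f Θ ∧
      ∀ m j k, (γ.tensor δ).comp (j, k) (Θ m)
        = tensorMap (g j) (B' k) ((β.tensor δ).comp (σ j, k) m) := by
  obtain ⟨Θ, hΘ⟩ := exists_familyOne (β.tensor δ) (γ.tensor δ) (fun p => (σ p.1, p.2))
    (fun p => tensorMap (g p.1) (B' p.2)) (fun p => by
      change tensorMap (g p.1) (B' p.2) (tmul (β.unit (σ p.1)) (δ.unit p.2))
        = tmul (γ.unit p.1) (δ.unit p.2)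
      rw [tensorMap_tmul, hg])
  refine ⟨Θ, fun a b => ?_, fun m j k => hΘ m (j, k)⟩
  -- The defining formula is verified on elements of blocks and then extended by continuity and
  -- density, one tensor factor at a time.
  have key : ∀ j (w : C' j) k (z : B' k),
      (Θ (DoubleCentralizer.coe ℂ (tmul a b))).fst (tmul (γ.incl j w) (δ.incl k z))
        = tmul ((f a).fst (γ.incl j w)) (b * δ.incl k z) := by
    intro j w k z
    rw [γ.fst_incl, hf, δ.mul_incl]
    have h1 := γ.tensor_incl_tmul δ (j, k) w z
    have h2 := γ.tensor_incl_tmul δ (j, k) (g j (β.compA (σ j) a) * w) (δ.compA k b * z)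
    rw [← h1, ← h2, fst_incl, hΘ, comp_coe, tensor_compA_tmul, tensorMap_tmul, tmul_mul_tmul]
  let m := Θ (DoubleCentralizer.coe ℂ (tmul a b))
  have key2 : ∀ j (w : C' j) (b' : B),
      m.fst (tmul (γ.incl j w) b') = tmul ((f a).fst (γ.incl j w)) (b * b') := by
    intro j w b'
    have h : m.fst ∘L tmulL C B (γ.incl j w)
        = tmulL C B ((f a).fst (γ.incl j w)) ∘L ContinuousLinearMap.mul ℂ B b :=
      eq_of_dense_span δ.dense (by
        rintro _ ⟨k, z, rfl⟩
        exact key j w k z)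
    exact congrArg (fun T : B →L[ℂ] spatialTensor C B => T b') h
  intro c b'
  have h : m.fst ∘L (tmulL C B).flip b' = (tmulL C B).flip (b * b') ∘L (f a).fst :=
    eq_of_dense_span γ.dense (by
      rintro _ ⟨j, w, rfl⟩
      exact key2 j w b')
  exact congrArg (fun T : C →L[ℂ] spatialTensor C B => T c) h

theorem exists_idTensor (σ : J₂ → J) (g : ∀ j, A' (σ j) →⋆ₙₐ[ℂ] C' j)
    (hg : ∀ j, g j (β.unit (σ j)) = γ.unit j) (f : A →⋆ₙₐ[ℂ] 𝓜(ℂ, C))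
    (hf : ∀ a j, γ.comp j (f a) = g j (β.compA (σ j) a)) :
    ∃ Θ : 𝓜(ℂ, spatialTensor B A) →⋆ₐ[ℂ] 𝓜(ℂ, spatialTensor B C), IsIdTensor B f Θ ∧
      ∀ m k j, (δ.tensor γ).comp (k, j) (Θ m)
        = tensorMapRight (B' k) (g j) ((δ.tensor β).comp (k, σ j) m) := by
  obtain ⟨Θ, hΘ⟩ := exists_familyOne (δ.tensor β) (δ.tensor γ) (fun p => (p.1, σ p.2))
    (fun p => tensorMapRight (B' p.1) (g p.2)) (fun p => by
      change tensorMapRight (B' p.1) (g p.2) (tmul (δ.unit p.1) (β.unit (σ p.2)))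
        = tmul (δ.unit p.1) (γ.unit p.2)
      rw [tensorMapRight_tmul, hg])
  refine ⟨Θ, fun b a => ?_, fun m k j => hΘ m (k, j)⟩
  have key : ∀ k (z : B' k) j (w : C' j),
      (Θ (DoubleCentralizer.coe ℂ (tmul b a))).fst (tmul (δ.incl k z) (γ.incl j w))
        = tmul (b * δ.incl k z) ((f a).fst (γ.incl j w)) := by
    intro k z j w
    rw [γ.fst_incl, hf, δ.mul_incl]
    have h1 := δ.tensor_incl_tmul γ (k, j) z w
    have h2 := δ.tensor_incl_tmul γ (k, j) (δ.compA k b * z) (g j (β.compA (σ j) a) * w)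
    rw [← h1, ← h2, fst_incl, hΘ, comp_coe, tensor_compA_tmul, tensorMapRight_tmul, tmul_mul_tmul]
  let m := Θ (DoubleCentralizer.coe ℂ (tmul b a))
  have key2 : ∀ k (z : B' k) (c : C),
      m.fst (tmul (δ.incl k z) c) = tmul (b * δ.incl k z) ((f a).fst c) := by
    intro k z c
    have h : m.fst ∘L tmulL B C (δ.incl k z)
        = tmulL B C (b * δ.incl k z) ∘L (f a).fst :=
      eq_of_dense_span γ.dense (by
        rintro _ ⟨j, w, rfl⟩
        exact key k z j w)
    exact congrArg (fun T : C →L[ℂ] spatialTensor B C => T c) h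
  intro b' c
  have h : m.fst ∘L (tmulL B C).flip c
      = (tmulL B C).flip ((f a).fst c) ∘L ContinuousLinearMap.mul ℂ B b :=
    eq_of_dense_span δ.dense (by
      rintro _ ⟨k, z, rfl⟩
      exact key2 k z c)
  exact congrArg (fun T : B →L[ℂ] spatialTensor B C => T b') h

theorem prodAssoc_emb (j : J) (i : J₂) (k : J₃) :
    ((((β.emb j).prodMap (γ.emb i)).prodMap (δ.emb k)).trans
      (Equiv.prodAssoc K K₂ K₃).toEmbedding)
    = (Equiv.prodAssoc (κ j) (κ₂ i) (κ₃ k)).toEmbedding.trans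
      ((β.emb j).prodMap ((γ.emb i).prodMap (δ.emb k))) := rfl

/-- On a product of block elements a multiplier acts through one component, and reassociating the
large index sets restricts to reassociating those of the blocks (`prodAssoc_emb`). Density in each
of the three factors gives the general case. -/
theorem assocEq_of_comp (m : 𝓜(ℂ, spatialTensor (spatialTensor A C) B))
    (m' : 𝓜(ℂ, spatialTensor A (spatialTensor C B)))
    (h : ∀ j i k, extendOp (Equiv.prodAssoc (κ j) (κ₂ i) (κ₃ k)).toEmbedding
        ((spatialTensor (spatialTensor (A' j) (C' i)) (B' k)).op
          (((β.tensor γ).tensor δ).comp ((j, i), k) m))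
      = (spatialTensor (A' j) (spatialTensor (C' i) (B' k))).op
          ((β.tensor (γ.tensor δ)).comp (j, (i, k)) m')) : AssocEq m m' := by
  have key : ∀ j (x : A' j) i (y : C' i) k (z : B' k),
      extendOp (Equiv.prodAssoc K K₂ K₃).toEmbedding ((spatialTensor (spatialTensor A C) B).op
        (m.fst (tmul (tmul (β.incl j x) (γ.incl i y)) (δ.incl k z))))
      = (spatialTensor A (spatialTensor C B)).op
        (m'.fst (tmul (β.incl j x) (tmul (γ.incl i y) (δ.incl k z)))) := by
    intro j x i y k z
    have h1 := β.tensor_incl_tmul γ (j, i) x y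
    have h2 := (β.tensor γ).tensor_incl_tmul δ ((j, i), k) (tmul x y) z
    have h3 := γ.tensor_incl_tmul δ (i, k) y z
    have h4 := β.tensor_incl_tmul (γ.tensor δ) (j, (i, k)) x (tmul y z)
    rw [← h1, ← h2, ← h3, ← h4, fst_incl, fst_incl, op_incl, op_incl, extendOp_trans]
    change extendOp ((((β.emb j).prodMap (γ.emb i)).prodMap (δ.emb k)).trans
      (Equiv.prodAssoc K K₂ K₃).toEmbedding) _
      = extendOp ((β.emb j).prodMap ((γ.emb i).prodMap (δ.emb k))) _
    rw [prodAssoc_emb, ← extendOp_trans, map_mul, map_mul, extendOp_mul, h]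
    simp only [op_tmul, extendOp_prodAssoc]
  let E := homL (extendHom (Equiv.prodAssoc K K₂ K₃).toEmbedding) ∘L
    homL (spatialTensor (spatialTensor A C) B).op ∘L m.fst
  let E' := homL (spatialTensor A (spatialTensor C B)).op ∘L m'.fst
  have key2 : ∀ j (x : A' j) i (y : C' i) (b : B),
      E (tmul (tmul (β.incl j x) (γ.incl i y)) b) = E' (tmul (β.incl j x) (tmul (γ.incl i y) b)) := by
    intro j x i y b
    have h : E ∘L tmulL _ _ (tmul (β.incl j x) (γ.incl i y))
        = E' ∘L tmulL _ _ (β.incl j x) ∘L tmulL _ _ (γ.incl i y) :=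
      eq_of_dense_span δ.dense (by
        rintro _ ⟨k, z, rfl⟩
        exact key j x i y k z)
    exact congrArg (fun T : B →L[ℂ] Op (K × K₂ × K₃) => T b) h
  have key3 : ∀ j (x : A' j) (c : C) (b : B),
      E (tmul (tmul (β.incl j x) c) b) = E' (tmul (β.incl j x) (tmul c b)) := by
    intro j x c b
    have h : E ∘L (tmulL _ _).flip b ∘L tmulL _ _ (β.incl j x)
        = E' ∘L tmulL _ _ (β.incl j x) ∘L (tmulL _ _).flip b :=
      eq_of_dense_span γ.dense (by
        rintro _ ⟨i, y, rfl⟩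
        exact key2 j x i y b)
    exact congrArg (fun T : C →L[ℂ] Op (K × K₂ × K₃) => T c) h
  intro a c b
  have h : E ∘L (tmulL _ _).flip b ∘L (tmulL _ _).flip c
      = E' ∘L (tmulL _ _).flip (tmul c b) :=
    eq_of_dense_span β.dense (by
      rintro _ ⟨j, x, rfl⟩
      exact key3 j x c b)
  exact congrArg (fun T : A →L[ℂ] Op (K × K₂ × K₃) => T a) h

end Extension

end Blocks

/-! ### Systems of matrix units indexed by words -/

/-- The word `K` is a prefix of `L`. -/
def IsPrefix {β : ℕ → Type*} {n m : ℕ} (K : ∀ i : Fin n, β i) (L : ∀ i : Fin m, β i) : Prop :=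
  ∀ i (h : i < n) (h' : i < m), K ⟨i, h⟩ = L ⟨i, h'⟩

/-- The word `L` with its first `n` letters replaced by `J`. -/
def splice {β : ℕ → Type*} {n m : ℕ} (J : ∀ i : Fin n, β i) (L : ∀ i : Fin m, β i) :
    ∀ i : Fin m, β i := fun i => if h : (i : ℕ) < n then J ⟨i, h⟩ else L i

open scoped Classical in
/-- The relations of matrix units of varying length, `v_{J,K}` being identified with
the sum of the `v_{Jl,Kl}` up to a defect. -/
structure IsUnitSystem {β : ℕ → Type*} {B : Type*} [NonUnitalCStarAlgebra B]
    (v : ∀ n, (∀ i : Fin n, β i) → (∀ i : Fin n, β i) → B) : Prop where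
  star_eq : ∀ n J K, star (v n J K) = v n K J
  mul_eq : ∀ n m, n ≤ m → ∀ J K L M,
    v n J K * v m L M = if IsPrefix K L then v m (splice J L) M else 0

section UnitSystem

variable {β : ℕ → Type*} {B : Type*} [NonUnitalCStarAlgebra B]
  {v : ∀ n, (∀ i : Fin n, β i) → (∀ i : Fin n, β i) → B}

/-- The adjoint of `mul_eq`, for a left factor that is at least as long as the right one. -/
theorem IsUnitSystem.mul_eq' (hv : IsUnitSystem v) {n m : ℕ} (h : m ≤ n)
    (J K : ∀ i : Fin n, β i) (L M : ∀ i : Fin m, β i) [Decidable (IsPrefix L K)] :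
    v n J K * v m L M = if IsPrefix L K then v n J (splice M K) else 0 := by
  rw [← star_star (v n J K * v m L M), star_mul, hv.star_eq, hv.star_eq, hv.mul_eq m n h]
  split_ifs
  · rw [hv.star_eq]
  · rw [star_zero]

/-- Splicing keeps the greater length and uses only letters already present in their positions, so a
restriction `P` on letters and a bound on lengths survive products. With `P` the condition `j < N`
this yields finite-dimensional *-algebras. -/
theorem IsUnitSystem.mul_mem (hv : IsUnitSystem v) (P : ∀ i, β i → Prop) (N : ℕ)
    {n m : ℕ} (hn : n ≤ N) (hm : m ≤ N) {J K : ∀ i : Fin n, β i} {L M : ∀ i : Fin m, β i}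
    (hJ : ∀ i : Fin n, P i (J i)) (hK : ∀ i : Fin n, P i (K i)) (hL : ∀ i : Fin m, P i (L i)) (hM : ∀ i : Fin m, P i (M i)) :
    v n J K * v m L M = 0 ∨ ∃ k ≤ N, ∃ J' K' : ∀ i : Fin k, β i,
      (∀ i : Fin k, P i (J' i)) ∧ (∀ i : Fin k, P i (K' i)) ∧ v n J K * v m L M = v k J' K' := by
  classical
  have hs : ∀ {n m : ℕ} {J : ∀ i : Fin n, β i} {L : ∀ i : Fin m, β i}, (∀ i : Fin n, P i (J i)) →
      (∀ i : Fin m, P i (L i)) → ∀ i : Fin m, P i (splice J L i) := by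
    intro n m J L hJ hL i
    unfold splice
    split_ifs with h
    · exact hJ ⟨i, h⟩
    · exact hL i
  rcases le_total n m with h | h
  · rw [hv.mul_eq n m h]
    split_ifs
    · exact Or.inr ⟨m, hm, _, _, hs hJ hL, hM, rfl⟩
    · exact Or.inl rfl
  · rw [hv.mul_eq' h]
    split_ifs
    · exact Or.inr ⟨n, hn, _, _, hJ, hs hM hK, rfl⟩
    · exact Or.inl rfl

end UnitSystem

/-! ### The matrix units of `𝒜(a)` -/

section MatUnit

variable {a b : seqMonoid}

/-- The path `x` with its first `n` letters replaced by `K`. -/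
def spliceInf {n : ℕ} (K : Word a n) (x : Path a) : Path a := prepend K fun i => x i

theorem spliceInf_apply {n : ℕ} (K : Word a n) (x : Path a) (i : ℕ) :
    spliceInf K x i = if h : i < n then K ⟨i, h⟩ else x i := rfl

open scoped Classical in
theorem matUnitOp_apply {n : ℕ} (J K : Word a n) (f : L2 (Path a)) (x : Path a) :
    matUnitOp J K f x = if ∀ i : Fin n, x i = J i then f (spliceInf K x) else 0 := by
  change push (prepend J) (pull (prepend K) f) x = _
  split_ifs with h
  · have hx : prepend J (fun i => x i) = x := by
      funext i
      rw [prepend_apply]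
      split_ifs with hi
      · exact (h ⟨i, hi⟩).symm
      · rfl
    conv_lhs => rw [← hx]
    rw [push_apply, pull_apply]
    rfl
  · refine push_apply_of_notMem _ _ _ ?_
    rintro ⟨y, rfl⟩
    refine h fun i => ?_
    rw [prepend_apply, dif_pos i.2]

theorem matUnitOp_star {n : ℕ} (J K : Word a n) : star (matUnitOp J K) = matUnitOp K J := by
  simp only [ContinuousLinearMap.star_eq_adjoint, matUnitOp, pull, ContinuousLinearMap.adjoint_comp,
    ContinuousLinearMap.adjoint_adjoint]

open scoped Classical in
theorem matUnitOp_mul {n m : ℕ} (h : n ≤ m) (J K : Word a n) (L M : Word a m) :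
    matUnitOp J K * matUnitOp L M
      = if IsPrefix (β := fun i => Fin (a.1 i)) K L then
          matUnitOp (splice (β := fun i => Fin (a.1 i)) J L) M else 0 := by
  ext f x
  rw [mul_apply_eq_comp, matUnitOp_apply]
  -- `M` is at least as long as `K`, so it overwrites everything that `K` has replaced.
  have h1 : spliceInf M (spliceInf K x) = spliceInf M x := by
    funext i
    simp only [spliceInf_apply]
    split_ifs with h1 h2
    · rfl
    · omega
    · rfl
  rw [matUnitOp_apply, h1]
  by_cases hp : IsPrefix (β := fun i => Fin (a.1 i)) K L
  · rw [if_pos hp, matUnitOp_apply]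
    by_cases hx : ∀ i : Fin n, x i = J i
    · rw [if_pos hx]
      congr 1
      refine propext (forall_congr' fun i => ?_)
      rw [spliceInf_apply, splice]
      by_cases hi : (i : ℕ) < n
      · rw [dif_pos hi, dif_pos hi]
        exact iff_of_true (hp i hi i.2) (hx ⟨i, hi⟩)
      · rw [dif_neg hi, dif_neg hi]
    · rw [if_neg hx, if_neg]
      intro h2
      refine hx fun i => ?_
      have := h2 ⟨i, i.2.trans_le h⟩
      rw [splice, dif_pos i.2] at this
      exact this
  · rw [if_neg hp, if_neg (c := ∀ i : Fin m, spliceInf K x i = L i), ite_self]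
    · rfl
    · intro h2
      refine hp fun i hi hi' => ?_
      have := h2 ⟨i, hi'⟩
      rwa [spliceInf_apply, dif_pos hi] at this

theorem matUnitOp_zero (J K : Word a 0) : matUnitOp J K = 1 := by
  ext f x
  classical
  rw [matUnitOp_apply, if_pos fun i => i.elim0]
  rfl

theorem op_matUnit {n : ℕ} (J K : Word a n) : (uhf a).op (matUnit J K) = matUnitOp J K :=
  op_of _ _

theorem matUnit_isUnitSystem (a : seqMonoid) :
    IsUnitSystem (β := fun i => Fin (a.1 i)) (fun _ J K => (matUnit J K : uhf a)) where
  star_eq n J K := (uhf a).op_injective <| by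
    rw [map_star, op_matUnit, op_matUnit, matUnitOp_star]
  mul_eq n m h J K L M := (uhf a).op_injective <| by
    rw [map_mul, op_matUnit, op_matUnit, matUnitOp_mul h]
    split_ifs
    · rw [op_matUnit]
    · rw [map_zero]

theorem uhf_hom_ext {B : Type*} [NonUnitalCStarAlgebra B] {f g : uhf a →⋆ₙₐ[ℂ] B}
    (h : ∀ n (J K : Word a n), f (matUnit J K) = g (matUnit J K)) : f = g :=
  cstarGen_hom_ext (by
    rintro _ ⟨n, J, K, rfl⟩
    exact h n J K)

/-! #### The Kronecker coproducts -/

/-- The quotients of the letters of a word. -/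
def wordFst {n : ℕ} (J : Word (a * b) n) : Word a n :=
  fun i => (finProdFinEquiv.symm (J i : Fin (a.1 i * b.1 i))).1

/-- The remainders of the letters of a word. -/
def wordSnd {n : ℕ} (J : Word (a * b) n) : Word b n :=
  fun i => (finProdFinEquiv.symm (J i : Fin (a.1 i * b.1 i))).2

theorem combine_wordFst_wordSnd {n : ℕ} (J : Word (a * b) n) :
    combine (wordFst J) (wordSnd J) = J := by
  funext i
  exact finProdFinEquiv.apply_symm_apply _

/-- The decomposition of the paths of `a·b`. -/
def pathEquiv (a b : seqMonoid) : Path (a * b) ≃ Path a × Path b where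
  toFun x := (fun i => (finProdFinEquiv.symm (x i : Fin (a.1 i * b.1 i))).1,
    fun i => (finProdFinEquiv.symm (x i : Fin (a.1 i * b.1 i))).2)
  invFun p i := (finProdFinEquiv (p.1 i, p.2 i) : Fin (a.1 i * b.1 i))
  left_inv x := by
    funext i
    exact finProdFinEquiv.apply_symm_apply _
  right_inv p := by
    ext i
    · exact congrArg (fun q => (q.1 : ℕ)) (finProdFinEquiv.symm_apply_apply (p.1 i, p.2 i))
    · exact congrArg (fun q => (q.2 : ℕ)) (finProdFinEquiv.symm_apply_apply (p.1 i, p.2 i))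

theorem pathEquiv_symm_apply (p : Path a × Path b) (i : ℕ) :
    (pathEquiv a b).symm p i = (finProdFinEquiv (p.1 i, p.2 i) : Fin (a.1 i * b.1 i)) := rfl

theorem extendOp_equiv_apply {ι κ : Type*} (e : ι ≃ κ) (T : Op ι) (f : L2 κ) (k : κ) :
    extendOp e.toEmbedding T f k = T (pull e.toEmbedding f) (e.symm k) := by
  obtain ⟨i, rfl⟩ := e.surjective k
  rw [Equiv.symm_apply_apply]
  exact push_apply e.toEmbedding _ i

theorem spliceInf_combine {n : ℕ} (K' : Word a n) (K'' : Word b n) (p : Path a × Path b) :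
    spliceInf (combine K' K'') ((pathEquiv a b).symm p)
      = (pathEquiv a b).symm (spliceInf K' p.1, spliceInf K'' p.2) := by
  funext i
  rw [pathEquiv_symm_apply]
  simp only [spliceInf_apply]
  split_ifs <;> rfl

/-- Under the digit bijection, beginning with `combine J' J''` means that the two digit paths begin
with `J'` and `J''`, and replacing a prefix is done in both digit paths at once
(`spliceInf_combine`). -/
theorem extendOp_matUnitOp_combine {n : ℕ} (J' K' : Word a n) (J'' K'' : Word b n) :
    extendOp (pathEquiv a b).toEmbedding (matUnitOp (combine J' J'') (combine K' K''))
      = opTensor (matUnitOp J' K') (matUnitOp J'' K'') := by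
  classical
  refine op_ext_vecTensor fun x y => ?_
  rw [opTensor_vecTensor]
  ext p
  rw [extendOp_equiv_apply, matUnitOp_apply, vecTensor_apply, matUnitOp_apply, matUnitOp_apply,
    pull_apply, spliceInf_combine, Equiv.coe_toEmbedding, Equiv.apply_symm_apply]
  have h : (∀ i : Fin n, (pathEquiv a b).symm p i = combine J' J'' i)
      ↔ (∀ i : Fin n, p.1 i = J' i) ∧ ∀ i : Fin n, p.2 i = J'' i := by
    rw [← forall_and]
    refine forall_congr' fun i => ?_
    rw [pathEquiv_symm_apply]
    exact finProdFinEquiv.injective.eq_iff.trans Prod.mk_inj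
  by_cases h1 : ∀ i : Fin n, p.1 i = J' i <;> by_cases h2 : ∀ i : Fin n, p.2 i = J'' i
  · rw [if_pos (h.2 ⟨h1, h2⟩), if_pos h1, if_pos h2]
    rfl
  · rw [if_neg (fun h3 => h2 (h.1 h3).2), if_neg h2, mul_zero]
  · rw [if_neg (fun h3 => h1 (h.1 h3).1), if_neg h1, zero_mul]
  · rw [if_neg (fun h3 => h1 (h.1 h3).1), if_neg h1, zero_mul]

theorem exists_kroneckerCoproduct (a b : seqMonoid) :
    ∃ φ : uhf (a * b) →⋆ₙₐ[ℂ] spatialTensor (uhf a) (uhf b),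
      ∀ (n : ℕ) (J' K' : Word a n) (J'' K'' : Word b n),
        φ (matUnit (combine J' J'') (combine K' K''))
          = tmul (matUnit J' K') (matUnit J'' K'') := by
  obtain ⟨φ, hφ⟩ := exists_spatial_hom (A := spatialTensor (uhf a) (uhf b))
    (S := {T | ∃ (n : ℕ) (J K : Word (a * b) n), T = matUnitOp J K})
    (extendHom (pathEquiv a b).toEmbedding) (by
      rintro _ ⟨n, J, K, rfl⟩
      refine ⟨tmul (matUnit (wordFst J) (wordFst K)) (matUnit (wordSnd J) (wordSnd K)), ?_⟩
      rw [op_tmul, op_matUnit, op_matUnit, ← extendOp_matUnitOp_combine, combine_wordFst_wordSnd,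
        combine_wordFst_wordSnd, extendHom_apply])
  have hφ' : ∀ x : uhf (a * b), (spatialTensor (uhf a) (uhf b)).op (φ x)
      = extendOp (pathEquiv a b).toEmbedding ((uhf (a * b)).op x) := hφ
  refine ⟨φ, fun n J' K' J'' K'' => (spatialTensor (uhf a) (uhf b)).op_injective ?_⟩
  rw [op_tmul, op_matUnit, op_matUnit, ← extendOp_matUnitOp_combine, ← op_matUnit]
  exact hφ' _

theorem existsUnique_kroneckerCoproduct :
    ∃! φ : ∀ a b : seqMonoid, uhf (a * b) →⋆ₙₐ[ℂ] spatialTensor (uhf a) (uhf b),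
      IsKroneckerCoproduct φ := by
  choose φ hφ using exists_kroneckerCoproduct
  refine ⟨φ, fun a b n J' K' J'' K'' => hφ a b n J' K' J'' K'', fun ψ hψ => ?_⟩
  funext a b
  refine uhf_hom_ext fun n J K => ?_
  rw [← combine_wordFst_wordSnd J, ← combine_wordFst_wordSnd K, hφ, hψ]

end MatUnit

/-! ### The matrix units of `UHF_∞` -/

section Cuntz

variable {ι : Type*} {s : ℕ → Op ι}

/-- The isometry `s_{j_1} ⋯ s_{j_n}`. -/
def wordOp (s : ℕ → Op ι) {n : ℕ} (J : Fin n → ℕ) : Op ι := (List.ofFn fun i => s (J i)).prod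

theorem cuntzUnitOp_eq (s : ℕ → Op ι) {n : ℕ} (J K : Fin n → ℕ) :
    cuntzUnitOp s J K = wordOp s J * star (wordOp s K) := rfl

theorem wordOp_zero (J : Fin 0 → ℕ) : wordOp s J = 1 := by
  simp [wordOp]

theorem wordOp_succ {n : ℕ} (J : Fin (n + 1) → ℕ) :
    wordOp s J = s (J 0) * wordOp s fun i => J i.succ := by
  simp [wordOp, List.ofFn_succ]

theorem isPrefix_succ {n m : ℕ} (K : Fin (n + 1) → ℕ) (L : Fin (m + 1) → ℕ) :
    IsPrefix (β := fun _ => ℕ) K L ↔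
      K 0 = L 0 ∧ IsPrefix (β := fun _ => ℕ) (fun i => K i.succ) fun i => L i.succ := by
  refine ⟨fun h => ⟨h 0 (by omega) (by omega), fun i hi hi' => h (i + 1) (by omega) (by omega)⟩,
    ?_⟩
  rintro ⟨h0, h⟩ (_ | i) hi hi'
  · exact h0
  · exact h i (by omega) (by omega)

theorem splice_succ {n m : ℕ} (J : Fin (n + 1) → ℕ) (L : Fin (m + 1) → ℕ) :
    wordOp s (splice (β := fun _ => ℕ) J L)
      = s (J 0) * wordOp s (splice (β := fun _ => ℕ) (fun i => J i.succ) fun i => L i.succ) := by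
  rw [wordOp_succ]
  congr 2
  funext i
  simp [splice, Fin.succ]

open scoped Classical in
-- Induction along `K`: the innermost factor `star (s (K 0)) * s (L 0)` is `1` or `0`, so letters
-- cancel one by one until a mismatch or until `K`, the shorter word, is used up.
theorem wordOp_mul_star_mul (hs : IsCuntzFamily s) {n m : ℕ} (h : n ≤ m) (J K : Fin n → ℕ)
    (L : Fin m → ℕ) : wordOp s J * star (wordOp s K) * wordOp s L
      = if IsPrefix (β := fun _ => ℕ) K L then wordOp s (splice (β := fun _ => ℕ) J L) else 0 := by
  induction n generalizing m with
  | zero =>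
    rw [if_pos (c := IsPrefix (β := fun _ => ℕ) K L) fun i hi => absurd hi (by omega), wordOp_zero, wordOp_zero, star_one, one_mul,
      one_mul]
    congr 1
  | succ n ih =>
    obtain ⟨m, rfl⟩ : ∃ k, m = k + 1 := ⟨m - 1, by omega⟩
    have h1 : wordOp s J * star (wordOp s K) * wordOp s L
        = s (J 0) * ((wordOp s fun i => J i.succ) * star (wordOp s fun i => K i.succ)
          * ((star (s (K 0)) * s (L 0)) * wordOp s fun i => L i.succ)) := by
      rw [wordOp_succ J, wordOp_succ K, wordOp_succ L, star_mul]
      simp only [mul_assoc]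
    rw [h1, hs]
    by_cases h0 : K 0 = L 0
    · rw [if_pos h0, one_mul, ih (by omega), splice_succ]
      by_cases hp : IsPrefix (β := fun _ => ℕ) (fun i => K i.succ) fun i => L i.succ
      · rw [if_pos hp, if_pos ((isPrefix_succ K L).2 ⟨h0, hp⟩)]
      · rw [if_neg hp, if_neg fun h => hp ((isPrefix_succ K L).1 h).2, mul_zero]
    · rw [if_neg h0, zero_mul, mul_zero, mul_zero,
        if_neg fun h => h0 ((isPrefix_succ K L).1 h).1]

theorem star_wordOp_mul_wordOp (hs : IsCuntzFamily s) {n : ℕ} (J : Fin n → ℕ) :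
    star (wordOp s J) * wordOp s J = 1 := by
  induction n with
  | zero => simp [wordOp_zero]
  | succ n ih =>
    have h := hs (J 0) (J 0)
    rw [if_pos rfl] at h
    rw [wordOp_succ, star_mul, mul_assoc, ← mul_assoc (star (s (J 0))), h, one_mul, ih]

theorem cuntzUnitOp_isUnitSystem (hs : IsCuntzFamily s) :
    IsUnitSystem (β := fun _ => ℕ) (fun _ J K => cuntzUnitOp s J K) where
  star_eq n J K := by simp [cuntzUnitOp_eq]
  mul_eq n m h J K L M := by
    rw [cuntzUnitOp_eq, cuntzUnitOp_eq, ← mul_assoc, wordOp_mul_star_mul hs h]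
    split_ifs
    · rfl
    · rw [zero_mul]

/-- Sandwiching between the word isometries gives `1`, which is nonzero because `ι` is nonempty. -/
theorem cuntzUnitOp_ne_zero [Nonempty ι] (hs : IsCuntzFamily s) {n : ℕ} (J K : Fin n → ℕ) :
    cuntzUnitOp s J K ≠ 0 := by
  intro h
  classical
  have h1 : star (wordOp s J) * cuntzUnitOp s J K * wordOp s K = 1 := by
    rw [cuntzUnitOp_eq, mul_assoc, mul_assoc, star_wordOp_mul_wordOp hs, mul_one,
      star_wordOp_mul_wordOp hs]
  rw [h, mul_zero, zero_mul] at h1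
  obtain ⟨i⟩ := ‹Nonempty ι›
  have h2 := congrArg (fun T : Op ι => T (lp.single 2 i (1 : ℂ)) i) h1
  simp at h2

/-- The word `J` followed by the letter `N`. -/
def snocWord {n : ℕ} (J : Fin n → ℕ) (N : ℕ) : Fin (n + 1) → ℕ :=
  fun i => if h : (i : ℕ) < n then J ⟨i, h⟩ else N

theorem isPrefix_snocWord {n : ℕ} (J L : Fin n → ℕ) (N : ℕ) :
    IsPrefix (β := fun _ => ℕ) L (snocWord J N) ↔ L = J := by
  constructor
  · intro h
    funext i
    have := h i i.2 (by omega)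
    rwa [snocWord, dif_pos i.2] at this
  · rintro rfl i hi hi'
    rw [snocWord, dif_pos hi]

theorem splice_snocWord {n : ℕ} (J L : Fin n → ℕ) (N : ℕ) :
    splice (β := fun _ => ℕ) L (snocWord J N) = snocWord L N := by
  funext i
  unfold splice snocWord
  split_ifs <;> rfl

theorem splice_same {n : ℕ} (J L : Fin n → ℕ) : splice (β := fun _ => ℕ) J L = J := by
  funext i
  rw [splice, dif_pos i.2]

theorem isPrefix_same {n : ℕ} (J L : Fin n → ℕ) :
    IsPrefix (β := fun _ => ℕ) J L ↔ J = L :=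
  ⟨fun h => funext fun i => h i i.2 i.2, by rintro rfl i _ _; rfl⟩

theorem snocWord_injective {n : ℕ} {J L : Fin n → ℕ} {N : ℕ} (h : snocWord J N = snocWord L N) :
    J = L := by
  rw [← isPrefix_snocWord L J N, ← h, isPrefix_snocWord]

/-- The diagonal units of `J N` and `K N` isolate one unit of length `n`: a nonzero product forces
`M = K` on the right and then `L = J` on the left. -/
theorem cuntzUnitOp_compress_same (hs : IsCuntzFamily s) {n : ℕ} (N : ℕ) (J K L M : Fin n → ℕ)
    (h : ¬ (L = J ∧ M = K)) :
    cuntzUnitOp s (snocWord J N) (snocWord J N) * cuntzUnitOp s L M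
      * cuntzUnitOp s (snocWord K N) (snocWord K N) = 0 := by
  classical
  have hu := cuntzUnitOp_isUnitSystem hs
  rw [mul_assoc, hu.mul_eq n (n + 1) (by omega)]
  split_ifs with h1
  · rw [isPrefix_snocWord] at h1
    rw [hu.mul_eq (n + 1) (n + 1) le_rfl, splice_snocWord, if_neg]
    rw [isPrefix_same]
    exact fun h2 => h ⟨(snocWord_injective h2).symm, h1⟩
  · rw [mul_zero]

theorem cuntzUnitOp_compress_self (hs : IsCuntzFamily s) {n : ℕ} (N : ℕ) (J K : Fin n → ℕ) :
    cuntzUnitOp s (snocWord J N) (snocWord J N) * cuntzUnitOp s J K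
      * cuntzUnitOp s (snocWord K N) (snocWord K N)
      = cuntzUnitOp s (snocWord J N) (snocWord K N) := by
  classical
  have hu := cuntzUnitOp_isUnitSystem hs
  rw [mul_assoc, hu.mul_eq n (n + 1) (by omega), if_pos ((isPrefix_snocWord _ _ _).2 rfl),
    splice_snocWord, hu.mul_eq (n + 1) (n + 1) le_rfl, if_pos ((isPrefix_same _ _).2 rfl),
    splice_same]

/-- A longer word beginning with `J N` would have the letter `N` in position `n`. Infinitely many
isometries are essential here: some letter is always unused. -/
theorem cuntzUnitOp_compress_long (hs : IsCuntzFamily s) {n m : ℕ} (h : n < m) (N : ℕ)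
    (J : Fin n → ℕ) (L M : Fin m → ℕ) (hL : ∀ i, L i < N) :
    cuntzUnitOp s (snocWord J N) (snocWord J N) * cuntzUnitOp s L M = 0 := by
  classical
  rw [(cuntzUnitOp_isUnitSystem hs).mul_eq (n + 1) m h, if_neg]
  intro hp
  have := hp n (by omega) h
  rw [snocWord, dif_neg (lt_irrefl n)] at this
  exact (hL ⟨n, h⟩).ne this.symm

/-- The index set of the matrix units of `UHF_∞`. -/
abbrev WordPair : Type := Σ n : ℕ, (Fin n → ℕ) × (Fin n → ℕ)

/-- Given a vanishing combination, take a letter `N` beyond all left letters and compress with the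
diagonal units of `J N` and `K N`. Shorter terms have zero coefficient by induction on the length,
other terms of the same length are orthogonal, longer terms lack the letter `N`; what remains is a
multiple of the nonzero unit with words `J N` and `K N`. With finitely many letters a relation
`E_{J,K} = ∑_l E_{Jl,Kl}` could hold. -/
theorem linearIndependent_cuntzUnitOp [Nonempty ι] (hs : IsCuntzFamily s) :
    LinearIndependent ℂ fun p : WordPair => cuntzUnitOp s p.2.1 p.2.2 := by
  classical
  rw [linearIndependent_iff']
  intro F c hc
  -- A crude bound; the left words suffice, since long terms are already killed by the left
  -- compression.
  obtain ⟨N, hN⟩ : ∃ N, ∀ p ∈ F, ∀ i, p.2.1 i < N := by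
    refine ⟨∑ p ∈ F, ∑ i, (p.2.1 i + 1), fun p hp i => ?_⟩
    calc p.2.1 i < p.2.1 i + 1 := by omega
      _ ≤ ∑ i, (p.2.1 i + 1) :=
        Finset.single_le_sum (f := fun i => p.2.1 i + 1) (fun _ _ => Nat.zero_le _)
          (Finset.mem_univ i)
      _ ≤ _ := Finset.single_le_sum (f := fun p : WordPair => ∑ i, (p.2.1 i + 1))
          (fun _ _ => Nat.zero_le _) hp
  have key : ∀ n, ∀ p ∈ F, p.1 = n → c p = 0 := by
    intro n
    induction n using Nat.strong_induction_on with
    | _ n ih =>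
      rintro ⟨n', J, K⟩ hp hn
      obtain rfl : n' = n := hn
      have h1 := congrArg (fun T => cuntzUnitOp s (snocWord J N) (snocWord J N) * T
        * cuntzUnitOp s (snocWord K N) (snocWord K N)) hc
      simp only [Finset.mul_sum, Finset.sum_mul, mul_zero, zero_mul, mul_smul_comm,
        smul_mul_assoc] at h1
      rw [Finset.sum_eq_single_of_mem (⟨n', J, K⟩ : WordPair) hp] at h1
      · rw [cuntzUnitOp_compress_self hs] at h1
        exact (smul_eq_zero.1 h1).resolve_right (cuntzUnitOp_ne_zero hs _ _)
      · rintro ⟨m, L, M⟩ hq hne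
        rcases lt_trichotomy m n' with h | h | h
        · rw [ih m h ⟨m, L, M⟩ hq rfl, zero_smul]
        · subst h
          rw [cuntzUnitOp_compress_same hs N J K L M, smul_zero]
          rintro ⟨rfl, rfl⟩
          exact hne rfl
        · rw [cuntzUnitOp_compress_long hs h N J L M (hN _ hq), zero_mul, smul_zero]
  exact fun p hp => key p.1 p hp rfl

theorem op_cuntzUnit (s : ℕ → Op ι) {n : ℕ} (J K : Fin n → ℕ) :
    (uhfInfty s).op (cuntzUnit s J K) = cuntzUnitOp s J K := op_of _ _

theorem cuntzUnit_isUnitSystem (hs : IsCuntzFamily s) :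
    IsUnitSystem (β := fun _ => ℕ) (fun _ J K => (cuntzUnit s J K : uhfInfty s)) where
  star_eq n J K := (uhfInfty s).op_injective <| by
    rw [map_star, op_cuntzUnit, op_cuntzUnit, (cuntzUnitOp_isUnitSystem hs).star_eq]
  mul_eq n m h J K L M := (uhfInfty s).op_injective <| by
    rw [map_mul, op_cuntzUnit, op_cuntzUnit, (cuntzUnitOp_isUnitSystem hs).mul_eq n m h]
    split_ifs
    · rw [op_cuntzUnit]
    · rw [map_zero]

theorem uhfInfty_hom_ext {B : Type*} [NonUnitalCStarAlgebra B] {f g : uhfInfty s →⋆ₙₐ[ℂ] B}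
    (h : ∀ n (J K : Fin n → ℕ), f (cuntzUnit s J K) = g (cuntzUnit s J K)) : f = g :=
  cstarGen_hom_ext (by
    rintro _ ⟨n, J, K, rfl⟩
    exact h n J K)

/-! #### The universal property of `UHF_∞` -/

section Universal

variable {B : Type*} [NonUnitalCStarAlgebra B] {v : ∀ n, (Fin n → ℕ) → (Fin n → ℕ) → B}

/-- The matrix units of length at most `N` with letters less than `N`. -/
def boundedUnits {E : Type*} (v : ∀ n, (Fin n → ℕ) → (Fin n → ℕ) → E) (N : ℕ) : Set E :=
  {b | ∃ n ≤ N, ∃ J K : Fin n → ℕ, (∀ i, J i < N) ∧ (∀ i, K i < N) ∧ b = v n J K}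

theorem finite_boundedUnits {E : Type*} (v : ∀ n, (Fin n → ℕ) → (Fin n → ℕ) → E) (N : ℕ) :
    (boundedUnits v N).Finite := by
  refine (Set.finite_range fun p : (Σ n : Fin (N + 1), (Fin n → Fin N) × (Fin n → Fin N)) =>
    v p.1 (fun i => p.2.1 i) (fun i => p.2.2 i)).subset ?_
  rintro _ ⟨n, hn, J, K, hJ, hK, rfl⟩
  exact ⟨⟨⟨n, by omega⟩, fun i => ⟨J i, hJ i⟩, fun i => ⟨K i, hK i⟩⟩, rfl⟩

theorem monotone_boundedUnits {E : Type*} (v : ∀ n, (Fin n → ℕ) → (Fin n → ℕ) → E) :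
    Monotone (boundedUnits v) := by
  rintro N N' h _ ⟨n, hn, J, K, hJ, hK, rfl⟩
  exact ⟨n, hn.trans h, J, K, fun i => (hJ i).trans_le h, fun i => (hK i).trans_le h, rfl⟩

theorem mem_boundedUnits {E : Type*} (v : ∀ n, (Fin n → ℕ) → (Fin n → ℕ) → E) {n : ℕ} (J K : Fin n → ℕ) :
    ∃ N, v n J K ∈ boundedUnits v N := by
  have h : ∀ (J : Fin n → ℕ) i, J i < (∑ i, (J i + 1)) := fun J i =>
    (Nat.lt_succ_self _).trans_le (Finset.single_le_sum (f := fun i => J i + 1)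
      (fun _ _ => Nat.zero_le _) (Finset.mem_univ i))
  exact ⟨n + (∑ i, (J i + 1)) + ∑ i, (K i + 1), n, by omega, J, K,
    fun i => by have := h J i; omega, fun i => by have := h K i; omega, rfl⟩

theorem boundedUnits_mul (hv : IsUnitSystem (β := fun _ => ℕ) v) (N : ℕ) :
    ∀ x ∈ boundedUnits v N, ∀ y ∈ boundedUnits v N,
      x * y ∈ Submodule.span ℂ (boundedUnits v N) := by
  rintro _ ⟨n, hn, J, K, hJ, hK, rfl⟩ _ ⟨m, hm, L, M, hL, hM, rfl⟩
  rcases hv.mul_mem (fun _ j => j < N) N hn hm hJ hK hL hM with h | ⟨k, hk, J', K', hJ', hK', h⟩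
  · rw [h]
    exact Submodule.zero_mem _
  · exact Submodule.subset_span ⟨k, hk, J', K', hJ', hK', h⟩

theorem boundedUnits_star (hv : IsUnitSystem (β := fun _ => ℕ) v) (N : ℕ) :
    ∀ x ∈ boundedUnits v N, star x ∈ Submodule.span ℂ (boundedUnits v N) := by
  rintro _ ⟨n, hn, J, K, hJ, hK, rfl⟩
  exact Submodule.subset_span ⟨n, hn, K, J, hK, hJ, hv.star_eq n J K⟩

theorem mem_span_boundedUnits (v : ∀ n, (Fin n → ℕ) → (Fin n → ℕ) → B) {x : B}
    (hx : x ∈ Submodule.span ℂ (⋃ N, boundedUnits v N)) :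
    ∃ N, x ∈ Submodule.span ℂ (boundedUnits v N) := by
  rw [Submodule.span_iUnion, Submodule.mem_iSup_of_directed] at hx
  · exact hx
  · exact (Monotone.directed_le fun N N' h => Submodule.span_mono (monotone_boundedUnits v h))

theorem iUnion_boundedUnits_mul (hv : IsUnitSystem (β := fun _ => ℕ) v) :
    ∀ x ∈ ⋃ N, boundedUnits v N, ∀ y ∈ ⋃ N, boundedUnits v N,
      x * y ∈ Submodule.span ℂ (⋃ N, boundedUnits v N) := by
  intro x hx y hy
  obtain ⟨N, hN⟩ := Set.mem_iUnion.1 hx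
  obtain ⟨N', hN'⟩ := Set.mem_iUnion.1 hy
  exact Submodule.span_mono (Set.subset_iUnion _ _) (boundedUnits_mul hv (max N N') x
    (monotone_boundedUnits v (le_max_left _ _) hN) y
    (monotone_boundedUnits v (le_max_right _ _) hN'))

theorem iUnion_boundedUnits_star (hv : IsUnitSystem (β := fun _ => ℕ) v) :
    ∀ x ∈ ⋃ N, boundedUnits v N, star x ∈ Submodule.span ℂ (⋃ N, boundedUnits v N) := by
  intro x hx
  obtain ⟨N, hN⟩ := Set.mem_iUnion.1 hx
  exact Submodule.span_mono (Set.subset_iUnion _ _) (boundedUnits_star hv N x hN)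

theorem IsUnitSystem.prod {v' : ∀ n, (Fin n → ℕ) → (Fin n → ℕ) → Op ι}
    (hv' : IsUnitSystem (β := fun _ => ℕ) v') (hv : IsUnitSystem (β := fun _ => ℕ) v) :
    IsUnitSystem (β := fun _ => ℕ) fun n J K => (v' n J K, v n J K) where
  star_eq n J K := Prod.ext (hv'.star_eq n J K) (hv.star_eq n J K)
  mul_eq n m h J K L M := by
    rw [Prod.mk_mul_mk, hv'.mul_eq n m h, hv.mul_eq n m h]
    split_ifs <;> rfl

/-- By linear independence the first coordinate determines the coefficients and with them the second
coordinate, so the span is the graph of a linear map. -/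
theorem snd_eq_zero_of_mem_span [Nonempty ι] (hs : IsCuntzFamily s) {N : ℕ} {d : Op ι × B}
    (hd : d ∈ Submodule.span ℂ (boundedUnits (fun _ J K => (cuntzUnitOp s J K, v _ J K)) N))
    (h0 : d.1 = 0) : d.2 = 0 := by
  have hle : boundedUnits (fun _ J K => (cuntzUnitOp s J K, v _ J K)) N
      ⊆ Set.range fun p : WordPair => (cuntzUnitOp s p.2.1 p.2.2, v p.1 p.2.1 p.2.2) := by
    rintro _ ⟨n, -, J, K, -, -, rfl⟩
    exact ⟨⟨n, J, K⟩, rfl⟩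
  obtain ⟨c, rfl⟩ := Finsupp.mem_span_range_iff_exists_finsupp.1 (Submodule.span_mono hle hd)
  have h1 : c = 0 := by
    refine linearIndependent_iff.1 (linearIndependent_cuntzUnitOp hs) c ?_
    rw [← h0, Finsupp.linearCombination_apply, Finsupp.sum, Finsupp.sum, Prod.fst_sum]
    rfl
  rw [h1, Finsupp.sum_zero_index]
  rfl

/-- An element of the span uses only units of bounded length and letters. These span a
finite-dimensional, hence closed, *-algebra of pairs, so `norm_snd_le_of_closed` gives the bound
without any estimate on `v`. -/
theorem norm_snd_le_of_mem_span [Nonempty ι] (hs : IsCuntzFamily s)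
    (hv : IsUnitSystem (β := fun _ => ℕ) v) {d : Op ι × B}
    (hd : d ∈ Submodule.span ℂ
      (⋃ N, boundedUnits (fun _ J K => (cuntzUnitOp s J K, v _ J K)) N)) :
    ‖d.2‖ ≤ ‖d.1‖ := by
  obtain ⟨N, hN⟩ := mem_span_boundedUnits _ hd
  have hw := (cuntzUnitOp_isUnitSystem hs).prod hv
  refine norm_snd_le_of_closed (spanStar _ (boundedUnits_mul hw N) (boundedUnits_star hw N)) ?_
    (fun d hd h0 => snd_eq_zero_of_mem_span hs hd h0) d hN
  have : FiniteDimensional ℂ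
      (Submodule.span ℂ (boundedUnits (fun _ J K => (cuntzUnitOp s J K, v _ J K)) N)) :=
    FiniteDimensional.span_of_finite ℂ (finite_boundedUnits _ N)
  exact Submodule.closed_of_finiteDimensional
    (Submodule.span ℂ (boundedUnits (fun _ J K => (cuntzUnitOp s J K, v _ J K)) N))

/-- The universal property of `UHF_∞`, for every choice of the family `s`: the pairs `(E_{J,K},
v_{J,K})` span the graph of a contractive *-homomorphism, which extends to the closure. -/
theorem exists_uhfInfty_lift [Nonempty ι] (hs : IsCuntzFamily s)
    (hv : IsUnitSystem (β := fun _ => ℕ) v) :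
    ∃ f : uhfInfty s →⋆ₙₐ[ℂ] B, ∀ n (J K : Fin n → ℕ), f (cuntzUnit s J K) = v n J K := by
  have hw := (cuntzUnitOp_isUnitSystem hs).prod hv
  have hmem : ∀ n (J K : Fin n → ℕ), (cuntzUnitOp s J K, v n J K) ∈ Submodule.span ℂ
      (⋃ N, boundedUnits (fun _ J K => (cuntzUnitOp s J K, v _ J K)) N) := fun n J K =>
    Submodule.subset_span (Set.mem_iUnion.2
      (mem_boundedUnits (fun _ J K => (cuntzUnitOp s J K, v _ J K)) J K))
  obtain ⟨f, hf⟩ := exists_hom_of_graph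
    (S := {T | ∃ (n : ℕ) (J K : Fin n → ℕ), T = cuntzUnitOp s J K})
    (spanStar _ (iUnion_boundedUnits_mul hw) (iUnion_boundedUnits_star hw))
    (fun d hd => norm_snd_le_of_mem_span hs hv hd) (by
      rintro _ ⟨n, J, K, rfl⟩
      exact ⟨_, hmem n J K⟩)
  refine ⟨f, fun n J K => hf (cuntzUnit s J K : uhfInfty s) _ ?_⟩
  have h := hmem n J K
  rw [← op_cuntzUnit] at h
  exact h

end Universal

/-! #### The coproducts `φ_{∞,a}` -/

section InftyCoproduct

variable {a : seqMonoid}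

theorem seqMonoid_pos (a : seqMonoid) (i : ℕ) : 0 < a.1 i := by
  rcases a.2 with h | h
  · exact Nat.lt_of_lt_of_le (by norm_num) (h i)
  · rw [h]
    exact Nat.one_pos

/-- The quotients of the letters of a word. -/
def quoWord (a : seqMonoid) {n : ℕ} (J : Fin n → ℕ) : Fin n → ℕ := fun i => J i / a.1 i

/-- The remainders of the letters of a word. -/
def remWord (a : seqMonoid) {n : ℕ} (J : Fin n → ℕ) : Word a n :=
  fun i => ⟨J i % a.1 i, Nat.mod_lt _ (seqMonoid_pos a i)⟩

theorem combineInfty_quoWord_remWord {n : ℕ} (J : Fin n → ℕ) :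
    combineInfty (quoWord a J) (remWord a J) = J := by
  funext i
  exact Nat.div_add_mod _ _

theorem quoWord_combineInfty {n : ℕ} (J' : Fin n → ℕ) (J'' : Word a n) :
    quoWord a (combineInfty J' J'') = J' := by
  funext i
  rw [quoWord, combineInfty, Nat.mul_add_div (seqMonoid_pos a i), Nat.div_eq_of_lt (J'' i).2,
    add_zero]

theorem remWord_combineInfty {n : ℕ} (J' : Fin n → ℕ) (J'' : Word a n) :
    remWord a (combineInfty J' J'') = J'' := by
  funext i
  apply Fin.ext
  change (a.1 i * J' i + J'' i) % a.1 i = J'' i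
  rw [Nat.mul_add_mod, Nat.mod_eq_of_lt (J'' i).2]

theorem isPrefix_quoWord_remWord {n m : ℕ} (K : Fin n → ℕ) (L : Fin m → ℕ) :
    IsPrefix (β := fun _ => ℕ) K L ↔ IsPrefix (β := fun _ => ℕ) (quoWord a K) (quoWord a L) ∧
      IsPrefix (β := fun i => Fin (a.1 i)) (remWord a K) (remWord a L) := by
  constructor
  · intro h
    refine ⟨fun i hi hi' => ?_, fun i hi hi' => Fin.ext ?_⟩
    · exact congrArg (· / a.1 i) (h i hi hi')
    · exact congrArg (· % a.1 i) (h i hi hi')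
  · rintro ⟨h1, h2⟩ i hi hi'
    have h3 : K ⟨i, hi⟩ / a.1 i = L ⟨i, hi'⟩ / a.1 i := h1 i hi hi'
    have h4 : K ⟨i, hi⟩ % a.1 i = L ⟨i, hi'⟩ % a.1 i := congrArg Fin.val (h2 i hi hi')
    rw [← Nat.div_add_mod (K ⟨i, hi⟩) (a.1 i), h3, h4, Nat.div_add_mod]

theorem quoWord_splice {n m : ℕ} (J : Fin n → ℕ) (L : Fin m → ℕ) :
    quoWord a (splice (β := fun _ => ℕ) J L)
      = splice (β := fun _ => ℕ) (quoWord a J) (quoWord a L) := by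
  funext i
  unfold quoWord splice
  split_ifs <;> rfl

theorem remWord_splice {n m : ℕ} (J : Fin n → ℕ) (L : Fin m → ℕ) :
    remWord a (splice (β := fun _ => ℕ) J L)
      = splice (β := fun i => Fin (a.1 i)) (remWord a J) (remWord a L) := by
  funext i
  apply Fin.ext
  unfold remWord splice
  split_ifs <;> rfl

/-- One word is a prefix of another exactly when this holds for both quotients and remainders, and
splicing is done digitwise. The two prefix conditions in the tensor factors thus combine to the one
on the original words. -/
theorem tensorUnit_isUnitSystem (hs : IsCuntzFamily s) (a : seqMonoid) :
    IsUnitSystem (β := fun _ => ℕ) fun _ J K =>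
      (tmul (cuntzUnit s (quoWord a J) (quoWord a K)) (matUnit (remWord a J) (remWord a K)) :
        spatialTensor (uhfInfty s) (uhf a)) where
  star_eq n J K := by
    rw [star_tmul, (cuntzUnit_isUnitSystem hs).star_eq, (matUnit_isUnitSystem a).star_eq]
  mul_eq n m h J K L M := by
    rw [tmul_mul_tmul, (cuntzUnit_isUnitSystem hs).mul_eq n m h,
      (matUnit_isUnitSystem a).mul_eq n m h, quoWord_splice, remWord_splice]
    by_cases h1 : IsPrefix (β := fun _ => ℕ) (quoWord a K) (quoWord a L)
    · by_cases h2 : IsPrefix (β := fun i => Fin (a.1 i)) (remWord a K) (remWord a L)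
      · rw [if_pos h1, if_pos h2, if_pos ((isPrefix_quoWord_remWord K L).2 ⟨h1, h2⟩)]
      · rw [if_neg h2, tmul_zero_right, if_neg fun h => h2 ((isPrefix_quoWord_remWord K L).1 h).2]
    · rw [if_neg h1, tmul_zero_left, if_neg fun h => h1 ((isPrefix_quoWord_remWord K L).1 h).1]

theorem existsUnique_inftyCoproduct [Nonempty ι] (hs : IsCuntzFamily s) :
    ∃! φ : ∀ a : seqMonoid, uhfInfty s →⋆ₙₐ[ℂ] spatialTensor (uhfInfty s) (uhf a),
      IsInftyCoproduct s φ := by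
  choose φ hφ using fun a => exists_uhfInfty_lift hs (tensorUnit_isUnitSystem hs a)
  refine ⟨φ, fun a n J' K' J'' K'' => ?_, fun ψ hψ => ?_⟩
  · rw [hφ, quoWord_combineInfty, quoWord_combineInfty, remWord_combineInfty, remWord_combineInfty]
  · funext a
    refine uhfInfty_hom_ext fun n J K => ?_
    have := hψ a n (quoWord a J) (quoWord a K) (remWord a J) (remWord a K)
    rw [combineInfty_quoWord_remWord, combineInfty_quoWord_remWord] at this
    rw [hφ, this]

end InftyCoproduct

end Cuntz

/-! ### The comultiplication of `𝒜(*)` -/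

section Comultiplication

/-- The unit of `𝒜(a)`. -/
def uhfUnit (a : seqMonoid) : uhf a := matUnit (fun i : Fin 0 => i.elim0) fun i : Fin 0 => i.elim0

theorem op_uhfUnit (a : seqMonoid) : (uhf a).op (uhfUnit a) = 1 :=
  (op_matUnit _ _).trans (matUnitOp_zero _ _)

/-- The embedding of `𝒜(a)` into `𝒜(*)`. -/
def uhfSummand (a : seqMonoid) (x : uhf a) : uhfSum := summand uhf a x

/-- The blocks of `𝒜(*)`. -/
def uhfBlocks : Blocks uhfSum uhf := Blocks.ofDirectSum uhf uhfUnit op_uhfUnit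

theorem uhfBlocks_incl (a : seqMonoid) (x : uhf a) : uhfBlocks.incl a x = uhfSummand a x :=
  summandHom_apply uhf a x

theorem uhfBlocks_compA_summand (a : seqMonoid) (x : uhf a) :
    uhfBlocks.compA a (uhfSummand a x) = x := by
  rw [← uhfBlocks_incl, Blocks.compA_incl]

theorem uhfBlocks_compA_summand_of_ne {a b : seqMonoid} (h : a ≠ b) (x : uhf a) :
    uhfBlocks.compA b (uhfSummand a x) = 0 := by
  rw [← uhfBlocks_incl, Blocks.compA_incl_of_ne _ h]

theorem uhfSum_hom_ext {B : Type*} [NonUnitalCStarAlgebra B] {f g : uhfSum →⋆ₙₐ[ℂ] B}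
    (h : ∀ c (x : uhf c), f (uhfSummand c x) = g (uhfSummand c x)) : f = g :=
  cstarGen_hom_ext (by
    rintro _ ⟨c, x, rfl⟩
    exact h c x)

theorem uhfSum_hom_ext_matUnit {B : Type*} [NonUnitalCStarAlgebra B] {f g : uhfSum →⋆ₙₐ[ℂ] B}
    (h : ∀ c n (J K : Word c n), f (uhfSummand c (matUnit J K)) = g (uhfSummand c (matUnit J K))) :
    f = g := by
  refine uhfSum_hom_ext fun c x => ?_
  have h1 : f.comp (uhfBlocks.incl c) = g.comp (uhfBlocks.incl c) := uhf_hom_ext fun n J K => by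
    rw [NonUnitalStarAlgHom.comp_apply, NonUnitalStarAlgHom.comp_apply, uhfBlocks_incl, h]
  have h2 := DFunLike.congr_fun h1 x
  rwa [NonUnitalStarAlgHom.comp_apply, NonUnitalStarAlgHom.comp_apply, uhfBlocks_incl] at h2

variable {φ : ∀ a b : seqMonoid, uhf (a * b) →⋆ₙₐ[ℂ] spatialTensor (uhf a) (uhf b)}

/-- The components of the comultiplication. -/
def comultComp (φ : ∀ a b : seqMonoid, uhf (a * b) →⋆ₙₐ[ℂ] spatialTensor (uhf a) (uhf b))
    (p : seqMonoid × seqMonoid) : uhfSum →⋆ₙₐ[ℂ] spatialTensor (uhf p.1) (uhf p.2) :=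
  (φ p.1 p.2).comp (uhfBlocks.compA (p.1 * p.2))

theorem tmul_summand (a b : seqMonoid) (y : uhf a) (z : uhf b) :
    tmul (uhfSummand a y) (uhfSummand b z)
      = (uhfBlocks.tensor uhfBlocks).incl (a, b) (tmul y z) := by
  rw [← uhfBlocks_incl, ← uhfBlocks_incl]
  exact (uhfBlocks.tensor_incl_tmul uhfBlocks (a, b) y z).symm

theorem op_tensor_incl (a b : seqMonoid) (w : spatialTensor (uhf a) (uhf b)) :
    (spatialTensor uhfSum uhfSum).op ((uhfBlocks.tensor uhfBlocks).incl (a, b) w)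
      = extendOp (blockEmb a b) ((spatialTensor (uhf a) (uhf b)).op w) :=
  (uhfBlocks.tensor uhfBlocks).op_incl (a, b) w

/-- Testing at block units turns the description of `Δ` on summands into one of its components: at
`(a, b)` it is `φ_{a,b}` of the component of `x` at `a·b`, and the vanishing clause becomes
orthogonality of summands. -/
theorem isComultiplication_iff (Δ : uhfSum →⋆ₙₐ[ℂ] 𝓜(ℂ, spatialTensor uhfSum uhfSum)) :
    IsComultiplication φ Δ ↔
      ∀ x p, (uhfBlocks.tensor uhfBlocks).comp p (Δ x) = comultComp φ p x := by
  constructor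
  · intro h x ⟨a, b⟩
    have key : ((uhfBlocks.tensor uhfBlocks).comp (a, b)).comp Δ = comultComp φ (a, b) := by
      refine uhfSum_hom_ext fun c x => ?_
      refine (uhfBlocks.tensor uhfBlocks).comp_eq_of_fst ?_
      have hu : (uhfBlocks.tensor uhfBlocks).unit (a, b) = tmul (uhfUnit a) (uhfUnit b) := rfl
      rw [hu, ← tmul_summand]
      by_cases hc : a * b = c
      · subst hc
        apply (spatialTensor uhfSum uhfSum).op_injective
        refine (h.component a b x _ _).trans ?_
        rw [op_tensor_incl, comultComp, NonUnitalStarAlgHom.comp_apply, uhfBlocks_compA_summand]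
      · refine (h.component_zero a b c hc x _ _).trans ?_
        rw [comultComp, NonUnitalStarAlgHom.comp_apply,
          uhfBlocks_compA_summand_of_ne fun e => hc e.symm, map_zero, zero_mul, map_zero]
    exact DFunLike.congr_fun key x
  · intro h
    refine ⟨fun a b x y z => ?_, fun a b c hc x y z => ?_⟩
    · change (spatialTensor uhfSum uhfSum).op ((Δ (uhfSummand (a * b) x)).fst
        (tmul (uhfSummand a y) (uhfSummand b z))) = _
      rw [tmul_summand, Blocks.fst_incl, op_tensor_incl, h, comultComp,
        NonUnitalStarAlgHom.comp_apply, uhfBlocks_compA_summand]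
    · change (Δ (uhfSummand c x)).fst (tmul (uhfSummand a y) (uhfSummand b z)) = 0
      rw [tmul_summand, Blocks.fst_incl, h, comultComp, NonUnitalStarAlgHom.comp_apply,
        uhfBlocks_compA_summand_of_ne fun e => hc e.symm, map_zero, zero_mul, map_zero]

theorem existsUnique_comultiplication
    (φ : ∀ a b : seqMonoid, uhf (a * b) →⋆ₙₐ[ℂ] spatialTensor (uhf a) (uhf b)) :
    ∃! Δ : uhfSum →⋆ₙₐ[ℂ] 𝓜(ℂ, spatialTensor uhfSum uhfSum), IsComultiplication φ Δ := by
  refine ⟨(uhfBlocks.tensor uhfBlocks).family (comultComp φ),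
    (isComultiplication_iff _).2 fun x p => Blocks.comp_family _ _ x p, fun Δ hΔ => ?_⟩
  replace hΔ := (isComultiplication_iff Δ).1 hΔ
  ext1 x
  refine (uhfBlocks.tensor uhfBlocks).ext_comp fun p => ?_
  rw [hΔ, Blocks.comp_family]

/-- The unit is the matrix unit of the empty words, so the formula with `n = 0` covers it. -/
theorem IsKroneckerCoproduct.map_unit (hφ : IsKroneckerCoproduct φ) (a b : seqMonoid) :
    φ a b (uhfUnit (a * b)) = tmul (uhfUnit a) (uhfUnit b) := by
  rw [uhfUnit, uhfUnit, uhfUnit, ← hφ a b]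
  congr 2

/-- The sequences `(a·b)·c` and `a·(b·c)` are not equal by definition, so words over them have
different types. Inside `uhfSum` their matrix units can be compared, letter by letter as natural
numbers. -/
theorem summand_matUnit_congr {c d : seqMonoid} (h : c = d) {n : ℕ} {J K : Word c n}
    {J' K' : Word d n} (hJ : ∀ i, (J i : ℕ) = J' i) (hK : ∀ i, (K i : ℕ) = K' i) :
    uhfSummand c (matUnit J K) = uhfSummand d (matUnit J' K') := by
  subst h
  rw [show J = J' from funext fun i => Fin.ext (hJ i), show K = K' from funext fun i => Fin.ext (hK i)]

theorem combine_val {a b : seqMonoid} {n : ℕ} (J : Word a n) (L : Word b n) (i : Fin n) :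
    (combine J L i : ℕ) = L i + b.1 i * J i := finProdFinEquiv_apply_val (J i, L i)

theorem combine_assoc_val {a b c : seqMonoid} {n : ℕ} (J : Word a n) (K : Word b n) (L : Word c n)
    (i : Fin n) : (combine (combine J K) L i : ℕ) = combine J (combine K L) i := by
  simp only [combine_val]
  change (L i : ℕ) + c.1 i * (K i + b.1 i * J i) = L i + c.1 i * K i + b.1 i * c.1 i * J i
  ring

/-- Both sides are *-homomorphisms in `x`, so matrix units of the summands suffice. At the summand
`a·b·c` each side splits the letters into the same three digits; every other summand is killed by
both. -/
theorem kronecker_coassoc (hφ : IsKroneckerCoproduct φ) (a b c : seqMonoid) (x : uhfSum) :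
    extendOp (Equiv.prodAssoc (Path a) (Path b) (Path c)).toEmbedding
      ((spatialTensor (spatialTensor (uhf a) (uhf b)) (uhf c)).op
        (tensorMap (φ a b) (uhf c) (comultComp φ (a * b, c) x)))
    = (spatialTensor (uhf a) (spatialTensor (uhf b) (uhf c))).op
        (tensorMapRight (uhf a) (φ b c) (comultComp φ (a, b * c) x)) := by
  let f := (extendHom (Equiv.prodAssoc (Path a) (Path b) (Path c)).toEmbedding).comp
    ((spatialTensor (spatialTensor (uhf a) (uhf b)) (uhf c)).op.comp
      ((tensorMap (φ a b) (uhf c)).comp (comultComp φ (a * b, c))))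
  let g := (spatialTensor (uhf a) (spatialTensor (uhf b) (uhf c))).op.comp
    ((tensorMapRight (uhf a) (φ b c)).comp (comultComp φ (a, b * c)))
  have key : f = g := by
    refine uhfSum_hom_ext_matUnit fun d n J K => ?_
    change extendOp _ ((spatialTensor (spatialTensor (uhf a) (uhf b)) (uhf c)).op
      (tensorMap (φ a b) (uhf c) (φ (a * b) c (uhfBlocks.compA (a * b * c) _))))
      = (spatialTensor (uhf a) (spatialTensor (uhf b) (uhf c))).op
        (tensorMapRight (uhf a) (φ b c) (φ a (b * c) (uhfBlocks.compA (a * (b * c)) _)))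
    by_cases hd : d = a * b * c
    · subst hd
      obtain ⟨J₁, J₂, J₃, rfl⟩ : ∃ (J₁ : Word a n) (J₂ : Word b n) (J₃ : Word c n),
          J = combine (combine J₁ J₂) J₃ :=
        ⟨_, _, _, by rw [combine_wordFst_wordSnd, combine_wordFst_wordSnd]⟩
      obtain ⟨K₁, K₂, K₃, rfl⟩ : ∃ (K₁ : Word a n) (K₂ : Word b n) (K₃ : Word c n),
          K = combine (combine K₁ K₂) K₃ :=
        ⟨_, _, _, by rw [combine_wordFst_wordSnd, combine_wordFst_wordSnd]⟩
      rw [uhfBlocks_compA_summand, hφ, tensorMap_tmul, hφ,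
        summand_matUnit_congr (mul_assoc a b c) (combine_assoc_val J₁ J₂ J₃)
          (combine_assoc_val K₁ K₂ K₃), uhfBlocks_compA_summand, hφ, tensorMapRight_tmul, hφ]
      simp only [op_tmul, extendOp_prodAssoc]
    · rw [uhfBlocks_compA_summand_of_ne hd, uhfBlocks_compA_summand_of_ne (by rwa [← mul_assoc])]
      simp only [map_zero]
      exact map_zero (extendHom _)
  exact DFunLike.congr_fun key x

theorem isCStarBialgebra_uhfSum (hφ : IsKroneckerCoproduct φ)
    {Δ : uhfSum →⋆ₙₐ[ℂ] 𝓜(ℂ, spatialTensor uhfSum uhfSum)} (hΔ : IsComultiplication φ Δ) :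
    IsCStarBialgebra uhfSum Δ where
  dense := by
    refine (dense_span_tmul_of_dense uhfBlocks.dense uhfBlocks.dense).mono (Submodule.span_mono ?_)
    rintro _ ⟨_, ⟨a, y, rfl⟩, _, ⟨b, z, rfl⟩, rfl⟩
    -- Since `φ_{a,b}` is unital, `Δ` of the unit of `𝒜(a·b)` acts as the identity on the block `(a,
    -- b)`; every tensor of block elements is thus of the required form.
    refine ⟨uhfSummand (a * b) (uhfUnit (a * b)), uhfBlocks.incl a y, uhfBlocks.incl b z, ?_⟩
    rw [uhfBlocks_incl, uhfBlocks_incl, tmul_summand, Blocks.fst_incl,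
      (isComultiplication_iff Δ).1 hΔ, comultComp, NonUnitalStarAlgHom.comp_apply,
      uhfBlocks_compA_summand, hφ.map_unit]
    congr 1
    exact ((uhfBlocks.tensor uhfBlocks).unit_mul (a, b) (tmul y z)).symm
  coassoc := by
    rw [isComultiplication_iff] at hΔ
    obtain ⟨Θ₁, h1, h1'⟩ := uhfBlocks.exists_tensorId (uhfBlocks.tensor uhfBlocks) uhfBlocks
      (fun p => p.1 * p.2) (fun p => φ p.1 p.2) (fun p => hφ.map_unit p.1 p.2) Δ hΔ
    obtain ⟨Θ₂, h2, h2'⟩ := uhfBlocks.exists_idTensor (uhfBlocks.tensor uhfBlocks) uhfBlocks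
      (fun p => p.1 * p.2) (fun p => φ p.1 p.2) (fun p => hφ.map_unit p.1 p.2) Δ hΔ
    refine ⟨Θ₁, Θ₂, h1, h2, fun x => uhfBlocks.assocEq_of_comp uhfBlocks uhfBlocks _ _
      fun a b c => ?_⟩
    rw [h1', h2', hΔ, hΔ]
    exact kronecker_coassoc hφ a b c x

end Comultiplication

/-! ### The coaction on `UHF_∞` -/

section Coaction

variable {ι : Type*} {s : ℕ → Op ι}
  {φi : ∀ a : seqMonoid, uhfInfty s →⋆ₙₐ[ℂ] spatialTensor (uhfInfty s) (uhf a)}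

/-- The unit of `UHF_∞`. -/
def inftyUnit (s : ℕ → Op ι) : uhfInfty s :=
  cuntzUnit s (fun i : Fin 0 => i.elim0) fun i : Fin 0 => i.elim0

theorem op_inftyUnit (s : ℕ → Op ι) : (uhfInfty s).op (inftyUnit s) = 1 := by
  rw [inftyUnit, op_cuntzUnit, cuntzUnitOp_eq, wordOp_zero, star_one, one_mul]

/-- `UHF_∞` as its only block. -/
def inftyBlocks (s : ℕ → Op ι) : Blocks (uhfInfty s) fun _ : Unit => uhfInfty s :=
  Blocks.single (uhfInfty s) (inftyUnit s) (op_inftyUnit s)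

theorem inftyBlocks_compA (x : uhfInfty s) : (inftyBlocks s).compA () x = x :=
  (inftyBlocks s).compA_incl () x

theorem tmul_summand_right (a : seqMonoid) (y : uhfInfty s) (z : uhf a) :
    tmul y (uhfSummand a z) = ((inftyBlocks s).tensor uhfBlocks).incl ((), a) (tmul y z) := by
  rw [← uhfBlocks_incl]
  exact ((inftyBlocks s).tensor_incl_tmul uhfBlocks ((), a) y z).symm

theorem op_tensor_incl_infty (a : seqMonoid) (w : spatialTensor (uhfInfty s) (uhf a)) :
    (spatialTensor (uhfInfty s) uhfSum).op (((inftyBlocks s).tensor uhfBlocks).incl ((), a) w)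
      = extendOp ((Function.Embedding.refl ι).prodMap (sigmaEmb (fun a : seqMonoid => Path a) a))
        ((spatialTensor (uhfInfty s) (uhf a)).op w) :=
  ((inftyBlocks s).tensor uhfBlocks).op_incl ((), a) w

theorem isProductCoaction_iff (Γ : uhfInfty s →⋆ₙₐ[ℂ] 𝓜(ℂ, spatialTensor (uhfInfty s) uhfSum)) :
    IsProductCoaction s φi Γ ↔
      ∀ x (p : Unit × seqMonoid), ((inftyBlocks s).tensor uhfBlocks).comp p (Γ x) = φi p.2 x := by
  constructor
  · rintro h x ⟨⟨⟩, a⟩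
    refine ((inftyBlocks s).tensor uhfBlocks).comp_eq_of_fst ?_
    have hu : ((inftyBlocks s).tensor uhfBlocks).unit ((), a)
      = tmul (inftyUnit s) (uhfUnit a) := rfl
    rw [hu, ← tmul_summand_right]
    apply (spatialTensor (uhfInfty s) uhfSum).op_injective
    exact (h x a _ _).trans (op_tensor_incl_infty a _).symm
  · intro h x a y z
    change (spatialTensor (uhfInfty s) uhfSum).op ((Γ x).fst (tmul y (uhfSummand a z))) = _
    rw [tmul_summand_right, Blocks.fst_incl, op_tensor_incl_infty, h]

theorem existsUnique_productCoaction
    (φi : ∀ a : seqMonoid, uhfInfty s →⋆ₙₐ[ℂ] spatialTensor (uhfInfty s) (uhf a)) :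
    ∃! Γ : uhfInfty s →⋆ₙₐ[ℂ] 𝓜(ℂ, spatialTensor (uhfInfty s) uhfSum),
      IsProductCoaction s φi Γ := by
  refine ⟨((inftyBlocks s).tensor uhfBlocks).family fun p => φi p.2,
    (isProductCoaction_iff _).2 fun x p => Blocks.comp_family _ _ x p, fun Γ hΓ => ?_⟩
  replace hΓ := (isProductCoaction_iff Γ).1 hΓ
  ext1 x
  refine ((inftyBlocks s).tensor uhfBlocks).ext_comp fun p => ?_
  rw [hΓ, Blocks.comp_family]

theorem IsInftyCoproduct.map_unit (hφi : IsInftyCoproduct s φi) (a : seqMonoid) :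
    φi a (inftyUnit s) = tmul (inftyUnit s) (uhfUnit a) := by
  rw [inftyUnit, uhfUnit, ← hφi a]
  congr 2

theorem combineInfty_assoc {a b : seqMonoid} {n : ℕ} (J : Fin n → ℕ) (K : Word a n)
    (L : Word b n) :
    combineInfty (combineInfty J K) L = combineInfty (a := a * b) J (combine K L) := by
  funext i
  simp only [combineInfty, combine_val]
  change b.1 i * (a.1 i * J i + K i) + L i = a.1 i * b.1 i * J i + (L i + b.1 i * K i)
  ring

/-- On matrix units both sides split a letter `j` into three digits, and `b(a j₁ + j₂) + j₃ = ab j₁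
+ (b j₂ + j₃)`. -/
theorem infty_coassoc
    {φ : ∀ a b : seqMonoid, uhf (a * b) →⋆ₙₐ[ℂ] spatialTensor (uhf a) (uhf b)}
    (hφ : IsKroneckerCoproduct φ) (hφi : IsInftyCoproduct s φi) (a b : seqMonoid)
    (x : uhfInfty s) :
    extendOp (Equiv.prodAssoc ι (Path a) (Path b)).toEmbedding
      ((spatialTensor (spatialTensor (uhfInfty s) (uhf a)) (uhf b)).op
        (tensorMap (φi a) (uhf b) (φi b x)))
    = (spatialTensor (uhfInfty s) (spatialTensor (uhf a) (uhf b))).op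
        (tensorMapRight (uhfInfty s) (φ a b) (φi (a * b) x)) := by
  let f := (extendHom (Equiv.prodAssoc ι (Path a) (Path b)).toEmbedding).comp
    ((spatialTensor (spatialTensor (uhfInfty s) (uhf a)) (uhf b)).op.comp
      ((tensorMap (φi a) (uhf b)).comp (φi b)))
  let g := (spatialTensor (uhfInfty s) (spatialTensor (uhf a) (uhf b))).op.comp
    ((tensorMapRight (uhfInfty s) (φ a b)).comp (φi (a * b)))
  have key : f = g := by
    refine uhfInfty_hom_ext fun n J K => ?_
    change extendOp _ ((spatialTensor (spatialTensor (uhfInfty s) (uhf a)) (uhf b)).op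
      (tensorMap (φi a) (uhf b) (φi b (cuntzUnit s J K))))
      = (spatialTensor (uhfInfty s) (spatialTensor (uhf a) (uhf b))).op
        (tensorMapRight (uhfInfty s) (φ a b) (φi (a * b) (cuntzUnit s J K)))
    obtain ⟨J₁, J₂, J₃, rfl⟩ : ∃ (J₁ : Fin n → ℕ) (J₂ : Word a n) (J₃ : Word b n),
        J = combineInfty (combineInfty J₁ J₂) J₃ :=
      ⟨_, _, _, by rw [combineInfty_quoWord_remWord, combineInfty_quoWord_remWord]⟩
    obtain ⟨K₁, K₂, K₃, rfl⟩ : ∃ (K₁ : Fin n → ℕ) (K₂ : Word a n) (K₃ : Word b n),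
        K = combineInfty (combineInfty K₁ K₂) K₃ :=
      ⟨_, _, _, by rw [combineInfty_quoWord_remWord, combineInfty_quoWord_remWord]⟩
    rw [hφi, tensorMap_tmul, hφi, combineInfty_assoc, combineInfty_assoc, hφi,
      tensorMapRight_tmul, hφ]
    simp only [op_tmul, extendOp_prodAssoc]
  exact DFunLike.congr_fun key x

theorem isRightComodule_uhfInfty
    {φ : ∀ a b : seqMonoid, uhf (a * b) →⋆ₙₐ[ℂ] spatialTensor (uhf a) (uhf b)}
    (hφ : IsKroneckerCoproduct φ) (hφi : IsInftyCoproduct s φi)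
    {Δ : uhfSum →⋆ₙₐ[ℂ] 𝓜(ℂ, spatialTensor uhfSum uhfSum)} (hΔ : IsComultiplication φ Δ)
    {Γ : uhfInfty s →⋆ₙₐ[ℂ] 𝓜(ℂ, spatialTensor (uhfInfty s) uhfSum)}
    (hΓ : IsProductCoaction s φi Γ) : IsRightComoduleCStarAlgebra (uhfInfty s) uhfSum Δ Γ where
  bialgebra := isCStarBialgebra_uhfSum hφ hΔ
  nondegenerate := by
    -- All `φ_{∞,a}` are unital, so `Γ` maps the unit to `1` and nondegeneracy is immediate.
    have h1 : Γ (inftyUnit s) = 1 := ((inftyBlocks s).tensor uhfBlocks).ext_comp fun p => by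
      rw [(isProductCoaction_iff Γ).1 hΓ, Blocks.comp_one]
      exact hφi.map_unit p.2
    have h2 : {t : spatialTensor (uhfInfty s) uhfSum |
        ∃ (b : uhfInfty s) (y : spatialTensor (uhfInfty s) uhfSum), t = (Γ b).fst y} = Set.univ :=
      Set.eq_univ_of_forall fun t => ⟨inftyUnit s, t, by rw [h1]; rfl⟩
    rw [h2, Submodule.span_univ]
    exact dense_univ
  coaction := by
    rw [isComultiplication_iff] at hΔ
    rw [isProductCoaction_iff] at hΓ
    -- `UHF_∞` is a single block, so the index map is constant for `Γ`; for `Δ` it is the product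
    -- `a·b`.
    obtain ⟨Θ₁, h1, h1'⟩ := (inftyBlocks s).exists_tensorId ((inftyBlocks s).tensor uhfBlocks)
      uhfBlocks (fun _ => ()) (fun p => φi p.2) (fun p => hφi.map_unit p.2) Γ
      (fun x p => by rw [hΓ, inftyBlocks_compA])
    obtain ⟨Θ₂, h2, h2'⟩ := uhfBlocks.exists_idTensor (uhfBlocks.tensor uhfBlocks) (inftyBlocks s)
      (fun p => p.1 * p.2) (fun p => φ p.1 p.2) (fun p => hφ.map_unit p.1 p.2) Δ hΔ
    refine ⟨Θ₁, Θ₂, h1, h2, fun x => (inftyBlocks s).assocEq_of_comp uhfBlocks uhfBlocks _ _ ?_⟩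
    rintro ⟨⟩ a b
    rw [h1', h2', hΓ, hΓ]
    exact infty_coassoc hφ hφi a b x

end Coaction

end KroneckerCoproduct

end

theorem mainTheorem3 {ι : Type*} [Nonempty ι] (s : ℕ → Op ι) (hs : IsCuntzFamily s) :
    (∃! φ : ∀ a b : seqMonoid, uhf (a * b) →⋆ₙₐ[ℂ] spatialTensor (uhf a) (uhf b),
      IsKroneckerCoproduct φ) ∧
    (∃! φi : ∀ a : seqMonoid, uhfInfty s →⋆ₙₐ[ℂ] spatialTensor (uhfInfty s) (uhf a),
      IsInftyCoproduct s φi) ∧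
    ∀ (φ : ∀ a b : seqMonoid, uhf (a * b) →⋆ₙₐ[ℂ] spatialTensor (uhf a) (uhf b))
      (φi : ∀ a : seqMonoid, uhfInfty s →⋆ₙₐ[ℂ] spatialTensor (uhfInfty s) (uhf a)),
      IsKroneckerCoproduct φ → IsInftyCoproduct s φi →
      (∃! Δ : uhfSum →⋆ₙₐ[ℂ] 𝓜(ℂ, spatialTensor uhfSum uhfSum), IsComultiplication φ Δ) ∧
      (∃! Γ : uhfInfty s →⋆ₙₐ[ℂ] 𝓜(ℂ, spatialTensor (uhfInfty s) uhfSum),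
        IsProductCoaction s φi Γ) ∧
      ∀ (Δ : uhfSum →⋆ₙₐ[ℂ] 𝓜(ℂ, spatialTensor uhfSum uhfSum))
        (Γ : uhfInfty s →⋆ₙₐ[ℂ] 𝓜(ℂ, spatialTensor (uhfInfty s) uhfSum)),
        IsComultiplication φ Δ → IsProductCoaction s φi Γ →
        IsRightComoduleCStarAlgebra (uhfInfty s) uhfSum Δ Γ := by
  refine ⟨existsUnique_kroneckerCoproduct, existsUnique_inftyCoproduct hs, fun φ φi hφ hφi =>
    ⟨existsUnique_comultiplication φ, existsUnique_productCoaction φi, fun Δ Γ hΔ hΓ =>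
      isRightComodule_uhfInfty hφ hφi hΔ hΓ⟩⟩
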